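/- **Setting.** Let $0<q\le 1$ and $p>0$ be real. For a real number $x$ put $[x]=\frac{q^x-q^{-x}}{q-q^{-1}}$ if $q\neq 1$, and $[x]=x$ if $q=1$. Let $\mathcal H_{1/2}$ be the Hilbert space with orthonormal basis $|l,m\rangle$, $l\in\{\frac12,\frac32,\dots\}$, $m\in\{-l,-l+1,\dots,l\}$, let $V\subset\mathcal H_{1/2}$ be the linear span of this basis, let $\mathcal H=\mathcal H_{1/2}\oplus\mathcal H_{1/2}$, and write $|l,m\rangle_+$ and $|l,m\rangle_-$ for the basis vectors of the first and the second copy. *Symmetry.* $U_q(su(2))$ is the algebra generated by $e,f,k,k^{-1}$ with $ek=qke$, $kf=qfk$, $k^2-k^{-2}=(q-q^{-1})(fe-ef)$. It acts on each copy of $V$ by $f|l,m\rangle=\sqrt{[l-m][l+m+1]}\,|l,m+1\rangle$, $e|l,m\rangle=\sqrt{[l-m+1][l+m]}\,|l,m-1\rangle$, $k|l,m\rangle=q^m|l,m\rangle$. *Algebra.* $\mathcal A(S^2_q)$ is the algebra generated by $A,B,B^*$ with $AB=q^2BA$, $AB^*=q^{-2}B^*A$, $BB^*=q^{-2}A(1-A)$,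 $B^*B=A(1-q^2A)$. It acts on $\mathcal H$ by bounded operators through $\pi=\pi_+\oplus\pi_-$, where $\pi_\pm$ is given on $V$ by $$B|l,m\rangle=q^m\sqrt{[l+m+1][l+m+2]}\,\alpha^+_l|l+1,m+1\rangle+q^m\sqrt{[l+m+1][l-m]}\,\alpha^0_l|l,m+1\rangle+q^m\sqrt{[l-m][l-m-1]}\,\alpha^-_l|l-1,m+1\rangle,$$ $$B^*|l,m\rangle=q^{m-1}\sqrt{[l-m+2][l-m+1]}\,\alpha^-_{l+1}|l+1,m-1\rangle+q^{m-1}\sqrt{[l+m][l-m+1]}\,\alpha^0_l|l,m-1\rangle+q^{m-1}\sqrt{[l+m][l+m-1]}\,\alpha^+_{l-1}|l-1,m-1\rangle,$$ $$A|l,m\rangle=-q^{m+l+\frac12}\sqrt{[l-m+1][l+m+1]}\,\alpha^+_l|l+1,m\rangle+\Big(\tfrac{q^{-1/2}}{1+q^2}\big([l-m+1][l+m]-q^2[l-m][l+m+1]\big)\alpha^0_l+\tfrac1{1+q^2}\Big)|l,m\rangle+q^{m-l-\frac12}\sqrt{[l-m][l+m]}\,\alpha^-_l|l-1,m\rangle,$$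 terms with labels out of range being zero. Here $\alpha^-_{l+1}=-q^{2l+2}\alpha^+_l$ in both cases; for $\pi_+$: $\alpha^0_l=q^{-1/2}\frac{(q-q^{-1})[l-\frac12][l+\frac32]+q}{[2l][2l+2]}$ and $\alpha^+_l=\frac{q^{-l-2}}{\sqrt{[2l+2]([4l+4]+[2][2l+2])}}$; for $\pi_-$: $\alpha^0_l=q^{-1/2}\frac{(q-q^{-1})[l-\frac12][l+\frac32]-q^{-1}}{[2l][2l+2]}$ and $\alpha^+_l=\frac{q^{-l-1}}{\sqrt{[2l+2]([4l+4]+[2][2l+2])}}$. *Grading and reality operator.* $\gamma=\mathrm{diag}(1,-1)$ on $\mathcal H_{1/2}\oplus\mathcal H_{1/2}$, and $J$ is the antilinear operator on $V\oplus V$ with $J|l,m\rangle_\pm=i^{2m}p^m|l,-m\rangle_\mp$. **Theorem.** Let $D$ be an (in general unbounded) operator in $\mathcal H$. The following are equivalent. 1. $D$ is selfadjoint with compact resolvent, its domain contains $V\oplus V$, and - $Dh=hD$ on $V\oplus V$ for all $h\in U_q(su(2))$; - $D\gamma=-\gamma D$; - for every $\alpha\in\mathcal A(S^2_q)$, $\pi(\alpha)$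 maps the domain of $D$ into itself and $[D,\pi(\alpha)]$ is bounded; - $DJ=JD$ on $V\oplus V$; - $[[D,\pi(\alpha)],J\pi(\beta)J]=0$ on $V\oplus V$ for all $\alpha,\beta\in\mathcal A(S^2_q)$. (In the conditions on $V\oplus V$, the operators $h$, $J$ and $J\pi(\beta)J$, which have domain $V\oplus V$, are replaced by their closures wherever they are applied to vectors outside $V\oplus V$.) 2. There is a complex number $z\neq 0$ such that $$D=\begin{pmatrix}0&\bar z D_-\\ zD_+&0\end{pmatrix},\qquad D_\pm|l,m\rangle_\pm=[l+\tfrac12]\,|l,m\rangle_\mp,$$ on the maximal domain $\big\{\psi=\sum c_{l,m,\sigma}|l,m\rangle_\sigma\in\mathcal H:\ \sum |z|^2[l+\tfrac12]^2|c_{l,m,\sigma}|^2<\infty\big\}$. -/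

import Mathlib

set_option linter.unusedSimpArgs false
set_option linter.unusedVariables false

namespace Podles

/-- The q-number `[x] = (q^x - q^{-x}) / (q - q^{-1})`, with its limit value `x` at `q = 1`. -/
noncomputable def qnum (q x : ℝ) : ℝ :=
  if q = 1 then x else (q ^ x - q ^ (-x)) / (q - q⁻¹)

/-! ### The Hilbert space and its orthonormal basis -/

/-- Labels of the vectors `|l,m⟩_±`, with `l = n + 1/2` in `{1/2, 3/2, …}` and
`m = μ + 1/2` in `{-l, …, l}`; the flag `sgn` is `true` for `+` and `false` for `-`. -/
@[ext] structure Idx where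
  sgn : Bool
  n : ℤ
  μ : ℤ
  lower : -(n + 1) ≤ μ
  upper : μ ≤ n
deriving DecidableEq

noncomputable def Idx.l (i : Idx) : ℝ := i.n + 1 / 2

noncomputable def Idx.m (i : Idx) : ℝ := i.μ + 1 / 2

/-- Exchange of the two copies: `|l,m⟩_± ↦ |l,m⟩_∓` on labels. -/
def Idx.swap (i : Idx) : Idx := ⟨!i.sgn, i.n, i.μ, i.lower, i.upper⟩

/-- The algebraic direct sum `V ⊕ V`, `V = V_{1/2} ⊕ V_{3/2} ⊕ …`: finite linear combinations
of the basis vectors. -/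
abbrev VV : Type := Idx →₀ ℂ

/-- The Hilbert space `ℋ = ℋ_{1/2} ⊕ ℋ_{1/2}` in which the vectors `|l,m⟩_±` form an
orthonormal basis. -/
abbrev HH : Type := lp (fun _ : Idx => ℂ) 2

/-- The inclusion of `V ⊕ V` in `ℋ`. -/
noncomputable def incl : VV →ₗ[ℂ] HH :=
  Finsupp.lsum ℂ fun i => (lp.lsingle (𝕜 := ℂ) (E := fun _ : Idx => ℂ) 2 i)

/-- The vector `|n + 1/2, μ + 1/2⟩_s`, understood as `0` when the labels are out of range. -/
noncomputable def ket (s : Bool) (n μ : ℤ) : VV :=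
  if h : -(n + 1) ≤ μ ∧ μ ≤ n then Finsupp.single ⟨s, n, μ, h.1, h.2⟩ 1 else 0

/-! ### The quantized enveloping algebra -/

inductive UqGen
  | e | f | k | kinv

open FreeAlgebra in
/-- The defining relations `k k⁻¹ = k⁻¹ k = 1`, `e k = q k e`, `k f = q f k` and
`k² - k⁻² = (q - q⁻¹)(f e - e f)`. -/
inductive UqRel (q : ℝ) : FreeAlgebra ℂ UqGen → FreeAlgebra ℂ UqGen → Prop
  | k_kinv : UqRel q (ι ℂ .k * ι ℂ .kinv) 1
  | kinv_k : UqRel q (ι ℂ .kinv * ι ℂ .k) 1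
  | e_k : UqRel q (ι ℂ .e * ι ℂ .k) ((q : ℂ) • (ι ℂ .k * ι ℂ .e))
  | k_f : UqRel q (ι ℂ .k * ι ℂ .f) ((q : ℂ) • (ι ℂ .f * ι ℂ .k))
  | f_e : UqRel q (ι ℂ .k * ι ℂ .k - ι ℂ .kinv * ι ℂ .kinv)
      (((q - q⁻¹ : ℝ) : ℂ) • (ι ℂ .f * ι ℂ .e - ι ℂ .e * ι ℂ .f))

/-- The algebra `U_q(su(2))`. -/
abbrev Uq (q : ℝ) : Type := RingQuot (UqRel q)

/-- The linear map on `V ⊕ V` with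
`|l,m⟩_s ↦ P |l+1,m+d⟩_s + Z |l,m+d⟩_s + M |l-1,m+d⟩_s`, the coefficients `P`, `Z`, `M`
being functions of `s`, `l`, `m`. -/
noncomputable def shiftOp (d : ℤ) (P Z M : Bool → ℝ → ℝ → ℝ) : Module.End ℂ VV :=
  Finsupp.linearCombination ℂ fun i =>
    (P i.sgn i.l i.m : ℂ) • ket i.sgn (i.n + 1) (i.μ + d) +
    (Z i.sgn i.l i.m : ℂ) • ket i.sgn i.n (i.μ + d) +
    (M i.sgn i.l i.m : ℂ) • ket i.sgn (i.n - 1) (i.μ + d)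

/-- The generators of `U_q(su(2))` on `V ⊕ V`:
`f |l,m⟩ = √([l-m][l+m+1]) |l,m+1⟩`, `e |l,m⟩ = √([l-m+1][l+m]) |l,m-1⟩`,
`k |l,m⟩ = q^m |l,m⟩`, `k⁻¹ |l,m⟩ = q^{-m} |l,m⟩`. -/
noncomputable def uqGenOp (q : ℝ) : UqGen → Module.End ℂ VV
  | .e => shiftOp (-1) 0 (fun _ l m => √(qnum q (l - m + 1) * qnum q (l + m))) 0
  | .f => shiftOp 1 0 (fun _ l m => √(qnum q (l - m) * qnum q (l + m + 1))) 0
  | .k => shiftOp 0 0 (fun _ _ m => q ^ m) 0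
  | .kinv => shiftOp 0 0 (fun _ _ m => q ^ (-m)) 0

/-! ### The algebra of the standard Podleś sphere -/

inductive SphereGen
  | A | B | Bstar

open FreeAlgebra in
/-- The defining relations `A B = q² B A`, `A B* = q⁻² B* A`, `B B* = q⁻² A (1 - A)` and
`B* B = A (1 - q² A)`. -/
inductive SphereRel (q : ℝ) : FreeAlgebra ℂ SphereGen → FreeAlgebra ℂ SphereGen → Prop
  | A_B : SphereRel q (ι ℂ .A * ι ℂ .B) (((q ^ 2 : ℝ) : ℂ) • (ι ℂ .B * ι ℂ .A))
  | A_Bstar : SphereRel q (ι ℂ .A * ι ℂ .Bstar) (((q ^ 2 : ℝ) : ℂ)⁻¹ • (ι ℂ .Bstar * ι ℂ .A))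
  | B_Bstar : SphereRel q (ι ℂ .B * ι ℂ .Bstar) (((q ^ 2 : ℝ) : ℂ)⁻¹ • (ι ℂ .A * (1 - ι ℂ .A)))
  | Bstar_B : SphereRel q (ι ℂ .Bstar * ι ℂ .B) (ι ℂ .A * (1 - ((q ^ 2 : ℝ) : ℂ) • ι ℂ .A))

/-- The coordinate algebra `A(S²_q)` of the standard Podleś sphere. -/
abbrev Sphere (q : ℝ) : Type := RingQuot (SphereRel q)

/-- `α⁰_l` of the representation `π_+` (`s = true`) and `π_-` (`s = false`). -/
noncomputable def alpha0 (q : ℝ) (s : Bool) (l : ℝ) : ℝ :=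
  1 / √q * (((q - q⁻¹) * qnum q (l - 1 / 2) * qnum q (l + 3 / 2) + if s then q else -q⁻¹) /
    (qnum q (2 * l) * qnum q (2 * l + 2)))

/-- `α⁺_l` of the representation `π_+` (`s = true`) and `π_-` (`s = false`). -/
noncomputable def alphaP (q : ℝ) (s : Bool) (l : ℝ) : ℝ :=
  (if s then q ^ (-l - 2) else q ^ (-l - 1)) *
    (1 / √(qnum q (2 * l + 2) * (qnum q (4 * l + 4) + qnum q 2 * qnum q (2 * l + 2))))

/-- `α⁻_l = - q^{2l} α⁺_{l-1}`. -/
noncomputable def alphaM (q : ℝ) (s : Bool) (l : ℝ) : ℝ :=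
  -q ^ (2 * l) * alphaP q s (l - 1)

/-! The matrix elements `B^+, B^0, B^-`, `B̃^+, B̃^0, B̃^-` and `A^+, A^0, A^-` of `B`, `B*` and `A`;
the suffixes `P`, `Z`, `M` stand for `+`, `0`, `-`. -/

noncomputable def BP (q : ℝ) (s : Bool) (l m : ℝ) : ℝ :=
  q ^ m * √(qnum q (l + m + 1) * qnum q (l + m + 2)) * alphaP q s l

noncomputable def BZ (q : ℝ) (s : Bool) (l m : ℝ) : ℝ :=
  q ^ m * √(qnum q (l + m + 1) * qnum q (l - m)) * alpha0 q s l

noncomputable def BM (q : ℝ) (s : Bool) (l m : ℝ) : ℝ :=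
  q ^ m * √(qnum q (l - m) * qnum q (l - m - 1)) * alphaM q s l

noncomputable def BstarP (q : ℝ) (s : Bool) (l m : ℝ) : ℝ :=
  q ^ (m - 1) * √(qnum q (l - m + 2) * qnum q (l - m + 1)) * alphaM q s (l + 1)

noncomputable def BstarZ (q : ℝ) (s : Bool) (l m : ℝ) : ℝ :=
  q ^ (m - 1) * √(qnum q (l + m) * qnum q (l - m + 1)) * alpha0 q s l

noncomputable def BstarM (q : ℝ) (s : Bool) (l m : ℝ) : ℝ :=
  q ^ (m - 1) * √(qnum q (l + m) * qnum q (l + m - 1)) * alphaP q s (l - 1)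

noncomputable def AP (q : ℝ) (s : Bool) (l m : ℝ) : ℝ :=
  -q ^ (m + l + 1 / 2) * √(qnum q (l - m + 1) * qnum q (l + m + 1)) * alphaP q s l

noncomputable def AZ (q : ℝ) (s : Bool) (l m : ℝ) : ℝ :=
  1 / √q * (1 / (1 + q ^ 2)) * (qnum q (l - m + 1) * qnum q (l + m) -
    q ^ 2 * qnum q (l - m) * qnum q (l + m + 1)) * alpha0 q s l + 1 / (1 + q ^ 2)

noncomputable def AM (q : ℝ) (s : Bool) (l m : ℝ) : ℝ :=
  q ^ (m - l - 1 / 2) * √(qnum q (l - m) * qnum q (l + m)) * alphaM q s l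

/-- The generators of `A(S²_q)` on `V ⊕ V`, acting by `π_+` on the first copy and by `π_-` on
the second one. -/
noncomputable def sphereGenOp (q : ℝ) : SphereGen → Module.End ℂ VV
  | .A => shiftOp 0 (AP q) (AZ q) (AM q)
  | .B => shiftOp 1 (BP q) (BZ q) (BM q)
  | .Bstar => shiftOp (-1) (BstarP q) (BstarZ q) (BstarM q)

/-! ### Auxiliary facts: the relations hold for these operators, and the action of `A(S²_q)` is
bounded -/

theorem qnum_one {x : ℝ} : qnum 1 x = x := by simp [qnum]

theorem qnum_zero (q : ℝ) : qnum q 0 = 0 := by simp [qnum]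

theorem qnum_pos {q : ℝ} (hq : 0 < q) {x : ℝ} (hx : 0 < x) : 0 < qnum q x := by
  unfold qnum
  split_ifs with h
  · exact hx
  rcases lt_or_gt_of_ne h with h | h
  · apply div_pos_of_neg_of_neg
    · rw [sub_neg]; exact Real.rpow_lt_rpow_of_exponent_gt hq h (by linarith)
    · rw [sub_neg]; exact h.trans (one_lt_inv₀ hq |>.2 h)
  · apply div_pos
    · rw [sub_pos]; exact Real.rpow_lt_rpow_of_exponent_lt h (by linarith)
    · rw [sub_pos]; exact (inv_lt_one_of_one_lt₀ h).trans h

theorem qnum_nonneg {q : ℝ} (hq : 0 < q) {x : ℝ} (hx : 0 ≤ x) : 0 ≤ qnum q x := by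
  rcases hx.eq_or_lt with rfl | h
  · rw [qnum_zero]
  · exact (qnum_pos hq h).le

theorem qnum_neg (q x : ℝ) : qnum q (-x) = -qnum q x := by
  unfold qnum
  split_ifs <;> simp; ring

theorem incl_single (i : Idx) (c : ℂ) :
    incl (Finsupp.single i c) = lp.single (E := fun _ : Idx => ℂ) 2 i c := by
  simp [incl]

theorem ket_valid {s : Bool} {n μ : ℤ} (h : -(n + 1) ≤ μ ∧ μ ≤ n) :
    ket s n μ = Finsupp.single ⟨s, n, μ, h.1, h.2⟩ 1 := dif_pos h

theorem ket_eq_zero {s : Bool} {n μ : ℤ} (h : ¬(-(n + 1) ≤ μ ∧ μ ≤ n)) : ket s n μ = 0 :=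
  dif_neg h

theorem shiftOp_ket (d : ℤ) (P Z M : Bool → ℝ → ℝ → ℝ) (s : Bool) (n μ : ℤ) (c l m : ℝ)
    (hl : l = n + 1 / 2) (hm : m = μ + 1 / 2) (h : ¬(-(n + 1) ≤ μ ∧ μ ≤ n) → c = 0) :
    shiftOp d P Z M ((c : ℂ) • ket s n μ) =
      ((c * P s l m : ℝ) : ℂ) • ket s (n + 1) (μ + d) + ((c * Z s l m : ℝ) : ℂ) • ket s n (μ + d) +
      ((c * M s l m : ℝ) : ℂ) • ket s (n - 1) (μ + d) := by
  subst hl hm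
  by_cases hv : -(n + 1) ≤ μ ∧ μ ≤ n
  · rw [ket_valid hv, map_smul, shiftOp, Finsupp.linearCombination_single]
    simp only [Idx.l, Idx.m, smul_add, smul_smul, one_mul]
    push_cast
    simp
  · simp [h hv]

theorem end_ext {S T : Module.End ℂ VV}
    (h : ∀ s n μ, -(n + 1) ≤ μ → μ ≤ n → S (ket s n μ) = T (ket s n μ)) : S = T := by
  apply Finsupp.lhom_ext'
  rintro ⟨s, n, μ, h1, h2⟩
  apply LinearMap.ext_ring
  have := h s n μ h1 h2
  rwa [ket_valid ⟨h1, h2⟩] at this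

theorem shiftOp_ket' (d : ℤ) (P Z M : Bool → ℝ → ℝ → ℝ) (s : Bool) (n μ : ℤ) (l m : ℝ)
    (hl : l = n + 1 / 2) (hm : m = μ + 1 / 2) (h1 : -(n + 1) ≤ μ) (h2 : μ ≤ n) :
    shiftOp d P Z M (ket s n μ) =
      ((P s l m : ℝ) : ℂ) • ket s (n + 1) (μ + d) + ((Z s l m : ℝ) : ℂ) • ket s n (μ + d) +
      ((M s l m : ℝ) : ℂ) • ket s (n - 1) (μ + d) := by
  have := shiftOp_ket d P Z M s n μ 1 l m hl hm (fun h => absurd ⟨h1, h2⟩ h)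
  simpa using this

theorem shiftOp_mul_ket (d d' : ℤ) (P Z M P' Z' M' : Bool → ℝ → ℝ → ℝ) (s : Bool) (n μ : ℤ)
    (l m : ℝ) (hl : l = n + 1 / 2) (hm : m = μ + 1 / 2) (h1 : -(n + 1) ≤ μ) (h2 : μ ≤ n)
    (hP : ¬(-(n + 1 + 1) ≤ μ + d ∧ μ + d ≤ n + 1) → P s l m = 0)
    (hZ : ¬(-(n + 1) ≤ μ + d ∧ μ + d ≤ n) → Z s l m = 0)
    (hM : ¬(-(n - 1 + 1) ≤ μ + d ∧ μ + d ≤ n - 1) → M s l m = 0) :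
    (shiftOp d' P' Z' M' * shiftOp d P Z M) (ket s n μ) =
      ((P s l m * P' s (l + 1) (m + d) : ℝ) : ℂ) • ket s (n + 2) (μ + (d + d')) +
      ((P s l m * Z' s (l + 1) (m + d) + Z s l m * P' s l (m + d) : ℝ) : ℂ) •
        ket s (n + 1) (μ + (d + d')) +
      ((P s l m * M' s (l + 1) (m + d) + Z s l m * Z' s l (m + d) + M s l m * P' s (l - 1) (m + d)
        : ℝ) : ℂ) • ket s n (μ + (d + d')) +
      ((Z s l m * M' s l (m + d) + M s l m * Z' s (l - 1) (m + d) : ℝ) : ℂ) •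
        ket s (n - 1) (μ + (d + d')) +
      ((M s l m * M' s (l - 1) (m + d) : ℝ) : ℂ) • ket s (n - 2) (μ + (d + d')) := by
  rw [Module.End.mul_apply, shiftOp_ket' d P Z M s n μ l m hl hm h1 h2, map_add, map_add,
    shiftOp_ket d' P' Z' M' s (n + 1) (μ + d) _ (l + 1) (m + d)
      (by push_cast; linarith) (by push_cast; linarith) hP,
    shiftOp_ket d' P' Z' M' s n (μ + d) _ l (m + d) hl (by push_cast; linarith) hZ,
    shiftOp_ket d' P' Z' M' s (n - 1) (μ + d) _ (l - 1) (m + d)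
      (by push_cast; linarith) (by push_cast; linarith) hM]
  simp only [show n + 1 + 1 = n + 2 by ring, show n - 1 - 1 = n - 2 by ring, add_sub_cancel_right,
    sub_add_cancel, add_assoc μ d d']
  push_cast
  module


theorem qnum_eq {q : ℝ} (hq : 0 < q) (h1 : q ≠ 1) {x y : ℝ} (h : q ^ x = y) :
    qnum q x = (y - y⁻¹) / (q - q⁻¹) := by
  rw [qnum, if_neg h1, Real.rpow_neg hq.le, h]

theorem qdiff_ne {q : ℝ} (hq : 0 < q) (h1 : q ≠ 1) : q - q⁻¹ ≠ 0 := by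
  intro h
  have : q * q = 1 := by
    have := congrArg (q * ·) h
    simp only [mul_sub, mul_inv_cancel₀ hq.ne', mul_zero] at this
    linarith
  apply h1
  nlinarith

theorem qnum_comm_identity {q : ℝ} (hq : 0 < q) (l m : ℝ) :
    q ^ m * q ^ m - q ^ (-m) * q ^ (-m) =
      (q - q⁻¹) * (qnum q (l - m + 1) * qnum q (l + m) - qnum q (l - m) * qnum q (l + m + 1)) := by
  by_cases h1 : q = 1
  · subst h1; simp
  have hD := qdiff_ne hq h1
  have hX : q ^ l ≠ 0 := (Real.rpow_pos_of_pos hq l).ne'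
  have hY : q ^ m ≠ 0 := (Real.rpow_pos_of_pos hq m).ne'
  rw [qnum_eq hq h1 (x := l - m + 1) (y := q ^ l / q ^ m * q) (by
      rw [Real.rpow_add hq, Real.rpow_sub hq, Real.rpow_one]),
    qnum_eq hq h1 (x := l + m + 1) (y := q ^ l * q ^ m * q) (by
      rw [Real.rpow_add hq, Real.rpow_add hq, Real.rpow_one]),
    qnum_eq hq h1 (Real.rpow_sub hq l m), qnum_eq hq h1 (Real.rpow_add hq l m),
    Real.rpow_neg hq.le]
  generalize q ^ l = X at *
  generalize q ^ m = Y at *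
  have hD' : q ^ 2 - 1 ≠ 0 := by
    intro h; apply hD; field_simp; linarith
  field_simp
  ring

theorem nonneg_uv {n μ : ℤ} {l m : ℝ} (hl : l = n + 1 / 2)
    (hm : m = μ + 1 / 2) (h1 : -(n + 1) ≤ μ) (h2 : μ ≤ n) :
    0 ≤ l + m ∧ 0 ≤ l - m := by
  have h1' : (-(n + 1) : ℝ) ≤ μ := by exact_mod_cast h1
  have h2' : (μ : ℝ) ≤ n := by exact_mod_cast h2
  constructor <;> linarith

theorem uq_relations {q : ℝ} (hq : 0 < q) ⦃x y : FreeAlgebra ℂ UqGen⦄ (h : UqRel q x y) :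
    FreeAlgebra.lift ℂ (uqGenOp q) x = FreeAlgebra.lift ℂ (uqGenOp q) y := by
  have key : ∀ (s : Bool) (n μ : ℤ), -(n + 1) ≤ μ → μ ≤ n → ∃ l m : ℝ, l = n + 1 / 2 ∧
      m = μ + 1 / 2 := fun s n μ _ _ => ⟨_, _, rfl, rfl⟩
  have bf : ∀ (s : Bool) (n μ : ℤ) (l m : ℝ), l = n + 1 / 2 → m = μ + 1 / 2 → -(n + 1) ≤ μ →
      μ ≤ n → ¬(-(n + 1) ≤ μ + 1 ∧ μ + 1 ≤ n) →
      (fun _ l m => √(qnum q (l - m) * qnum q (l + m + 1)) : Bool → ℝ → ℝ → ℝ) s l m = 0 := by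
    intro s n μ l m hl hm h1 h2 h
    have : μ = n := by omega
    subst this
    simp [show l - m = 0 by linarith, qnum_zero]
  have be : ∀ (s : Bool) (n μ : ℤ) (l m : ℝ), l = n + 1 / 2 → m = μ + 1 / 2 → -(n + 1) ≤ μ →
      μ ≤ n → ¬(-(n + 1) ≤ μ + -1 ∧ μ + -1 ≤ n) →
      (fun _ l m => √(qnum q (l - m + 1) * qnum q (l + m)) : Bool → ℝ → ℝ → ℝ) s l m = 0 := by
    intro s n μ l m hl hm h1 h2 h
    have : μ = -(n + 1) := by omega
    subst this
    push_cast at hm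
    simp [show l + m = 0 by linarith, qnum_zero]
  cases h <;> simp only [map_mul, map_sub, map_smul, map_one, FreeAlgebra.lift_ι_apply, uqGenOp] <;>
    apply end_ext <;> intro s n μ h1 h2 <;>
    obtain ⟨l, m, hl, hm⟩ := key s n μ h1 h2
  · rw [shiftOp_mul_ket _ _ _ _ _ _ _ _ s n μ l m hl hm h1 h2 (by simp) (by omega) (by simp)]
    simp [← Real.rpow_add hq]
  · rw [shiftOp_mul_ket _ _ _ _ _ _ _ _ s n μ l m hl hm h1 h2 (by simp) (by omega) (by simp)]
    simp [← Real.rpow_add hq]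
  · rw [LinearMap.smul_apply,
      shiftOp_mul_ket _ _ _ _ _ _ _ _ s n μ l m hl hm h1 h2 (by simp) (by omega) (by simp),
      shiftOp_mul_ket _ _ _ _ _ _ _ _ s n μ l m hl hm h1 h2 (by simp) (be s n μ l m hl hm h1 h2)
        (by simp)]
    simp only [Pi.zero_apply, zero_mul, mul_zero, add_zero, zero_add, Complex.ofReal_zero, zero_smul,
      Int.cast_zero, smul_smul, ← Complex.ofReal_mul, Int.cast_neg, Int.cast_one]
    congr 2
    rw [show m = 1 + (m + -1) by ring, Real.rpow_add hq, Real.rpow_one,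
      show 1 + (m + -1) = m by ring]
    ring
  · rw [LinearMap.smul_apply,
      shiftOp_mul_ket _ _ _ _ _ _ _ _ s n μ l m hl hm h1 h2 (by simp) (bf s n μ l m hl hm h1 h2)
        (by simp),
      shiftOp_mul_ket _ _ _ _ _ _ _ _ s n μ l m hl hm h1 h2 (by simp) (by omega) (by simp)]
    simp only [Pi.zero_apply, zero_mul, mul_zero, add_zero, zero_add, Complex.ofReal_zero, zero_smul,
      Int.cast_zero, smul_smul, ← Complex.ofReal_mul, Int.cast_one]
    congr 2
    rw [Real.rpow_add hq, Real.rpow_one]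
    ring
  · rw [LinearMap.smul_apply, LinearMap.sub_apply, LinearMap.sub_apply,
      shiftOp_mul_ket _ _ _ _ _ _ _ _ s n μ l m hl hm h1 h2 (by simp) (by omega) (by simp),
      shiftOp_mul_ket _ _ _ _ _ _ _ _ s n μ l m hl hm h1 h2 (by simp) (by omega) (by simp),
      shiftOp_mul_ket _ _ _ _ _ _ _ _ s n μ l m hl hm h1 h2 (by simp) (be s n μ l m hl hm h1 h2)
        (by simp),
      shiftOp_mul_ket _ _ _ _ _ _ _ _ s n μ l m hl hm h1 h2 (by simp) (bf s n μ l m hl hm h1 h2)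
        (by simp)]
    simp only [Pi.zero_apply, zero_mul, mul_zero, add_zero, zero_add, Complex.ofReal_zero, zero_smul,
      Int.cast_zero, smul_smul, ← Complex.ofReal_mul, Int.cast_one, Int.cast_neg, ← sub_smul,
      ← Complex.ofReal_sub, neg_add_cancel, add_neg_cancel]
    obtain ⟨hu, hv⟩ := nonneg_uv hl hm h1 h2
    have e1 : √(qnum q (l - m + 1) * qnum q (l + m)) *
        √(qnum q (l - (m + -1)) * qnum q (l + (m + -1) + 1)) =
        qnum q (l - m + 1) * qnum q (l + m) := by
      rw [show l - (m + -1) = l - m + 1 by ring, show l + (m + -1) + 1 = l + m by ring]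
      exact Real.mul_self_sqrt (mul_nonneg (qnum_nonneg hq (by linarith)) (qnum_nonneg hq hu))
    have e2 : √(qnum q (l - m) * qnum q (l + m + 1)) *
        √(qnum q (l - (m + 1) + 1) * qnum q (l + (m + 1))) =
        qnum q (l - m) * qnum q (l + m + 1) := by
      rw [show l - (m + 1) + 1 = l - m by ring, show l + (m + 1) = l + m + 1 by ring]
      exact Real.mul_self_sqrt (mul_nonneg (qnum_nonneg hq hv) (qnum_nonneg hq (by linarith)))
    rw [e1, e2, qnum_comm_identity hq l m]

/-- The representation of `U_q(su(2))` on `V ⊕ V`. -/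
noncomputable def rho (q : ℝ) (hq : 0 < q) : Uq q →ₐ[ℂ] Module.End ℂ VV :=
  RingQuot.liftAlgHom ℂ ⟨FreeAlgebra.lift ℂ (uqGenOp q), uq_relations hq⟩

/-! The relations of `A(S²_q)` hold for the generators on `V ⊕ V`. -/

/-- The numbers entering the matrix elements near a fixed pair `(l, m)`: `h = √q`, `X = q^l`,
`Y = q^m`, `U k = [l+m+k]`, `W k = [l-m+k]`, `Z k = α⁰_{l+k}`, `P k = α⁺_{l+k}`. -/
structure Dat where
  h : ℝ
  X : ℝ
  Y : ℝ
  U : ℤ → ℝ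
  W : ℤ → ℝ
  Z : ℤ → ℝ
  P : ℤ → ℝ

namespace Dat

variable (d : Dat) (i j : ℤ)

noncomputable def bp : ℝ :=
  d.Y * d.h ^ (2 * j) * √(d.U (i + j + 1) * d.U (i + j + 2)) * d.P i

noncomputable def bz : ℝ :=
  d.Y * d.h ^ (2 * j) * √(d.U (i + j + 1) * d.W (i - j)) * d.Z i

noncomputable def bm : ℝ :=
  -(d.Y * d.X ^ 2 * d.h ^ (2 * j + 4 * i) * √(d.W (i - j) * d.W (i - j - 1)) * d.P (i - 1))

noncomputable def cp : ℝ :=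
  -(d.Y * d.X ^ 2 * d.h ^ (2 * j + 4 * i + 2) *
    √(d.W (i - j + 1) * d.W (i - j + 2)) * d.P i)

noncomputable def cz : ℝ :=
  d.Y * d.h ^ (2 * j - 2) * √(d.U (i + j) * d.W (i - j + 1)) * d.Z i

noncomputable def cm : ℝ :=
  d.Y * d.h ^ (2 * j - 2) * √(d.U (i + j) * d.U (i + j - 1)) * d.P (i - 1)

noncomputable def ap : ℝ :=
  -(d.Y * d.X * d.h ^ (2 * i + 2 * j + 1) * √(d.U (i + j + 1) * d.W (i - j + 1)) * d.P i)

noncomputable def az : ℝ :=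
  1 / d.h * (1 / (1 + d.h ^ 4)) * (d.W (i - j + 1) * d.U (i + j) -
    d.h ^ 4 * d.W (i - j) * d.U (i + j + 1)) * d.Z i + 1 / (1 + d.h ^ 4)

noncomputable def am : ℝ :=
  -(d.Y * d.X * d.h ^ (2 * i + 2 * j - 1) * √(d.U (i + j) * d.W (i - j)) * d.P (i - 1))

structure Pos : Prop where
  U0 : 0 ≤ d.U 0
  U1 : 0 ≤ d.U 1
  U2 : 0 ≤ d.U 2
  W0 : 0 ≤ d.W 0
  W1 : 0 ≤ d.W 1
  W2 : 0 ≤ d.W 2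
  Um : 0 ≤ d.U (-1) ∨ d.U 0 = 0
  Wm : 0 ≤ d.W (-1) ∨ d.W 0 = 0

/-- The case `q ≠ 1`, with `D = q² - 1` and `δ k = q^{4(l+k)} - 1`. -/
structure Quantum (s : Bool) (D : ℝ) (δ : ℤ → ℝ) : Prop where
  hh : 0 < d.h
  hX : 0 < d.X
  hY : 0 < d.Y
  hD : D ≠ 0
  hDeq : D = d.h ^ 4 - 1
  hδ0 : ∀ k : ℤ, δ k ≠ 0
  hδ : ∀ k : ℤ, δ k = d.X ^ 4 * d.h ^ (8 * k) - 1
  hU : ∀ k : ℤ, d.U k = (d.X * d.Y * d.h ^ (2 * k) - (d.X * d.Y * d.h ^ (2 * k))⁻¹) / (D / d.h ^ 2)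
  hW : ∀ k : ℤ, d.W k = (d.X / d.Y * d.h ^ (2 * k) - (d.X / d.Y * d.h ^ (2 * k))⁻¹) / (D / d.h ^ 2)
  hZ : ∀ k : ℤ, d.Z k = 1 / d.h * (D / d.h ^ 2) *
    (d.X ^ 2 * d.h ^ (4 * k) * d.h ^ 2 + (d.X ^ 2 * d.h ^ (4 * k) * d.h ^ 2)⁻¹ -
      if s then 1 + (d.h ^ 4)⁻¹ else d.h ^ 4 + 1) * (d.X ^ 4 * d.h ^ (8 * k) * d.h ^ 4) /
    (δ k * δ (k + 1))
  hP : ∀ k : ℤ, -1 ≤ k → d.P k ^ 2 = (if s then 1 / d.h ^ 4 else 1) * (D / d.h ^ 2) ^ 2 *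
    (d.X ^ 4 * d.h ^ (8 * k) * d.h ^ 10) / (δ (k + 1) ^ 2 *
      (d.X ^ 2 * d.h ^ (4 * (k + 1)) + d.h ^ 2) * (d.X ^ 2 * d.h ^ (4 * (k + 1)) * d.h ^ 2 + 1))

/-- The case `q = 1`, with `δ k = 2(l+k)`. -/
structure Classical (s : Bool) (u w : ℝ) (δ : ℤ → ℝ) : Prop where
  hh : d.h = 1
  hX : d.X = 1
  hY : d.Y = 1
  hδ0 : ∀ k : ℤ, δ k ≠ 0
  hδ : ∀ k : ℤ, δ k = u + w + 2 * k
  hU : ∀ k : ℤ, d.U k = u + k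
  hW : ∀ k : ℤ, d.W k = w + k
  hZ : ∀ k : ℤ, d.Z k = (if s then 1 else -1) / (δ k * δ (k + 1))
  hP : ∀ k : ℤ, -1 ≤ k → d.P k ^ 2 = 1 / (4 * δ (k + 1) ^ 2)

def Good (s : Bool) : Prop :=
  (∃ D δ, d.Quantum s D δ) ∨ ∃ u w δ, d.Classical s u w δ

theorem sqz {x y z p r t : ℝ} (hp : p = x * y) (hr : r = x * z) (ht : t = y * z) (hy : 0 ≤ y)
    (hx : 0 ≤ x ∨ y = 0) : √p * √r = x * √t := by
  subst hp hr ht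
  rcases hx with hx | rfl
  · rw [Real.sqrt_mul hx, Real.sqrt_mul hx, Real.sqrt_mul hy]
    linear_combination √y * √z * Real.mul_self_sqrt hx
  · simp

theorem sqq {x y : ℝ} (hx : 0 ≤ x) (hy : 0 ≤ y ∨ x = 0) : √(x * y) * √(x * y) = x * y := by
  rcases hy with hy | rfl
  · exact Real.mul_self_sqrt (mul_nonneg hx hy)
  · simp

theorem sq4 {a b c e p r t v : ℝ} (hp : p = a * b) (hr : r = c * e) (ht : t = a * c)
    (hv : v = b * e) (ha : 0 ≤ a) (hc : 0 ≤ c) (hb : 0 ≤ b ∨ a = 0) :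
    √p * √r = √t * √v := by
  subst hp hr ht hv
  rcases hb with hb | rfl
  · rw [Real.sqrt_mul ha, Real.sqrt_mul hc, Real.sqrt_mul ha, Real.sqrt_mul hb]
    ring
  · simp

variable {d} {s : Bool}


theorem AB_p2 (H : d.Pos) (hh : 0 < d.h) :
    d.bp 0 0 * d.ap 1 1 =
      d.h ^ 4 * (d.ap 0 0 * d.bp 1 0) := by
  have s1 : √(d.U 1 * d.U 2) * √(d.U 3 * d.W 1) =
      √(d.U 1 * d.W 1) * √(d.U 2 * d.U 3) :=
    sq4 (a := d.U 1) (b := d.U 2) (c := d.W 1) (e := d.U 3)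
      (by ring) (by ring) (by ring) (by ring) H.U1 H.W1 (.inl H.U2)
  simp only [bp, bz, bm, cp, cz, cm, ap, am, Int.reduceAdd, Int.reduceMul, Int.reduceSub, Int.reduceNeg,
    zpow_zero, zpow_neg, zpow_ofNat, zpow_one]
  linear_combination (norm := skip) ((-1) * d.Y ^ 2 * d.X * d.h ^ 5 * d.P 0 * d.P 1) * s1
  field_simp
  ring


theorem AB_p1_rat (G : d.Good s) :
    d.Y * d.az 1 1 +
    (-1) * d.Y ^ 2 * d.X * d.h ^ 3 * d.W 0 * d.Z 0 +
    (-1) * (-d.h ^ 4) * d.Y ^ 2 * d.X * d.h * d.W 1 * d.Z 1 +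
    (-d.h ^ 4) * d.Y * d.az 0 0 = 0 := by
  rcases G with ⟨D, δ, ⟨hh, hX, hY, hD, rfl, hδ0, hδ, hU, hW, hZ, hP⟩⟩ |
    ⟨u, w, δ, ⟨hh, hX, hY, hδ0, hδ, hU, hW, hZ, hP⟩⟩ <;>
  · have w9 := hδ0 (-1)
    have w0 := hδ0 0
    have w1 := hδ0 1
    have w2 := hδ0 2
    have e9 := hδ (-1)
    have e0 := hδ 0
    have e1 := hδ 1
    have e2 := hδ 2
    have p0 := hP 0 (by norm_num)
    have p9 := hP (-1) (by norm_num)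
    norm_num [zpow_ofNat, zpow_neg] at e9 e0 e1 e2 p0 p9
    norm_num [az, hh, hX, hY, hU, hW, hZ, p0, p9, zpow_ofNat, zpow_neg]
    cases s <;> norm_num <;> field_simp <;> simp only [e9, e0, e1, e2] <;> try field_simp
    all_goals ring

theorem AB_p1 (H : d.Pos) (G : d.Good s) :
    d.bp 0 0 * d.az 1 1 + d.bz 0 0 * d.ap 0 1 =
      d.h ^ 4 * (d.ap 0 0 * d.bz 1 0 + d.az 0 0 * d.bp 0 0) := by
  have s1 : √(d.U 1 * d.W 0) * √(d.U 2 * d.W 0) =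
      d.W 0 * √(d.U 1 * d.U 2) :=
    sqz (y := d.U 1) (z := d.U 2) (by ring) (by ring) (by ring) H.U1 (.inl H.W0)
  have s2 : √(d.U 1 * d.W 1) * √(d.U 2 * d.W 1) =
      d.W 1 * √(d.U 1 * d.U 2) :=
    sqz (y := d.U 1) (z := d.U 2) (by ring) (by ring) (by ring) H.U1 (.inl H.W1)
  simp only [bp, bz, bm, cp, cz, cm, ap, am, Int.reduceAdd, Int.reduceMul, Int.reduceSub, Int.reduceNeg,
    zpow_zero, zpow_neg, zpow_ofNat, zpow_one]
  linear_combination (-1) * d.Y ^ 2 * d.X * d.h ^ 3 * d.Z 0 * d.P 0 * s1 +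
    (-1) * (-d.h ^ 4) * d.Y ^ 2 * d.X * d.h * d.P 0 * d.Z 1 * s2 +
    √(d.U 1 * d.U 2) * d.P 0 * AB_p1_rat G


theorem AB_z_rat (G : d.Good s) :
    (-1) * d.Y ^ 2 * d.X * d.h ^ 3 * d.U 2 * d.P 0 ^ 2 +
    d.Y * d.az 0 1 * d.Z 0 +
    d.Y ^ 2 * d.X ^ 3 * d.h * d.W (-1) * d.P (-1) ^ 2 +
    (-d.h ^ 4) * d.Y ^ 2 * d.X ^ 3 * d.h * d.h ^ 4 * d.W 1 * d.P 0 ^ 2 +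
    (-d.h ^ 4) * d.Y * d.az 0 0 * d.Z 0 +
    (-1) * (-d.h ^ 4) * d.Y ^ 2 * d.X * d.h⁻¹ * d.U 0 * d.P (-1) ^ 2 = 0 := by
  rcases G with ⟨D, δ, ⟨hh, hX, hY, hD, rfl, hδ0, hδ, hU, hW, hZ, hP⟩⟩ |
    ⟨u, w, δ, ⟨hh, hX, hY, hδ0, hδ, hU, hW, hZ, hP⟩⟩ <;>
  · have w9 := hδ0 (-1)
    have w0 := hδ0 0
    have w1 := hδ0 1
    have w2 := hδ0 2
    have e9 := hδ (-1)
    have e0 := hδ 0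
    have e1 := hδ 1
    have e2 := hδ 2
    have p0 := hP 0 (by norm_num)
    have p9 := hP (-1) (by norm_num)
    norm_num [zpow_ofNat, zpow_neg] at e9 e0 e1 e2 p0 p9
    norm_num [az, hh, hX, hY, hU, hW, hZ, p0, p9, zpow_ofNat, zpow_neg]
    cases s <;> norm_num <;> field_simp <;> simp only [e9, e0, e1, e2] <;> try field_simp
    all_goals ring

theorem AB_z (H : d.Pos) (G : d.Good s) :
    d.bp 0 0 * d.am 1 1 + d.bz 0 0 * d.az 0 1 + d.bm 0 0 * d.ap (-1) 1 =
      d.h ^ 4 * (d.ap 0 0 * d.bm 1 0 + d.az 0 0 * d.bz 0 0 + d.am 0 0 * d.bp (-1) 0) := by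
  have s1 : √(d.U 1 * d.U 2) * √(d.U 2 * d.W 0) =
      d.U 2 * √(d.U 1 * d.W 0) :=
    sqz (y := d.U 1) (z := d.W 0) (by ring) (by ring) (by ring) H.U1 (.inl H.U2)
  have s2 : √(d.W 0 * d.W (-1)) * √(d.U 1 * d.W (-1)) =
      d.W (-1) * √(d.U 1 * d.W 0) :=
    sqz (y := d.W 0) (z := d.U 1) (by ring) (by ring) (by ring) H.W0 H.Wm
  have s3 : √(d.U 1 * d.W 1) * √(d.W 1 * d.W 0) =
      d.W 1 * √(d.U 1 * d.W 0) :=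
    sqz (y := d.U 1) (z := d.W 0) (by ring) (by ring) (by ring) H.U1 (.inl H.W1)
  have s4 : √(d.U 0 * d.W 0) * √(d.U 0 * d.U 1) =
      d.U 0 * √(d.U 1 * d.W 0) :=
    sqz (y := d.W 0) (z := d.U 1) (by ring) (by ring) (by ring) H.W0 (.inl H.U0)
  simp only [bp, bz, bm, cp, cz, cm, ap, am, Int.reduceAdd, Int.reduceMul, Int.reduceSub, Int.reduceNeg,
    zpow_zero, zpow_neg, zpow_ofNat, zpow_one]
  linear_combination (-1) * d.Y ^ 2 * d.X * d.h ^ 3 * d.P 0 ^ 2 * s1 +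
    d.Y ^ 2 * d.X ^ 3 * d.h * d.P (-1) ^ 2 * s2 +
    (-d.h ^ 4) * d.Y ^ 2 * d.X ^ 3 * d.h * d.h ^ 4 * d.P 0 ^ 2 * s3 +
    (-1) * (-d.h ^ 4) * d.Y ^ 2 * d.X * d.h⁻¹ * d.P (-1) ^ 2 * s4 +
    √(d.U 1 * d.W 0) * AB_z_rat G


theorem AB_m1_rat (G : d.Good s) :
    (-1) * d.Y ^ 2 * d.X * d.h * d.U 1 * d.Z 0 +
    (-1) * d.Y * d.X ^ 2 * d.az (-1) 1 +
    (-1) * (-d.h ^ 4) * d.Y * d.X ^ 2 * d.az 0 0 +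
    (-1) * (-d.h ^ 4) * d.Y ^ 2 * d.X * d.h⁻¹ * d.U 0 * d.Z (-1) = 0 := by
  rcases G with ⟨D, δ, ⟨hh, hX, hY, hD, rfl, hδ0, hδ, hU, hW, hZ, hP⟩⟩ |
    ⟨u, w, δ, ⟨hh, hX, hY, hδ0, hδ, hU, hW, hZ, hP⟩⟩ <;>
  · have w9 := hδ0 (-1)
    have w0 := hδ0 0
    have w1 := hδ0 1
    have w2 := hδ0 2
    have e9 := hδ (-1)
    have e0 := hδ 0
    have e1 := hδ 1
    have e2 := hδ 2
    have p0 := hP 0 (by norm_num)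
    have p9 := hP (-1) (by norm_num)
    norm_num [zpow_ofNat, zpow_neg] at e9 e0 e1 e2 p0 p9
    norm_num [az, hh, hX, hY, hU, hW, hZ, p0, p9, zpow_ofNat, zpow_neg]
    cases s <;> norm_num <;> field_simp <;> simp only [e9, e0, e1, e2] <;> try field_simp
    all_goals ring

theorem AB_m1 (H : d.Pos) (G : d.Good s) :
    d.bz 0 0 * d.am 0 1 + d.bm 0 0 * d.az (-1) 1 =
      d.h ^ 4 * (d.az 0 0 * d.bm 0 0 + d.am 0 0 * d.bz (-1) 0) := by
  have s1 : √(d.U 1 * d.W 0) * √(d.U 1 * d.W (-1)) =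
      d.U 1 * √(d.W 0 * d.W (-1)) :=
    sqz (y := d.W 0) (z := d.W (-1)) (by ring) (by ring) (by ring) H.W0 (.inl H.U1)
  have s2 : √(d.U 0 * d.W 0) * √(d.U 0 * d.W (-1)) =
      d.U 0 * √(d.W 0 * d.W (-1)) :=
    sqz (y := d.W 0) (z := d.W (-1)) (by ring) (by ring) (by ring) H.W0 (.inl H.U0)
  simp only [bp, bz, bm, cp, cz, cm, ap, am, Int.reduceAdd, Int.reduceMul, Int.reduceSub, Int.reduceNeg,
    zpow_zero, zpow_neg, zpow_ofNat, zpow_one]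
  linear_combination (-1) * d.Y ^ 2 * d.X * d.h * d.Z 0 * d.P (-1) * s1 +
    (-1) * (-d.h ^ 4) * d.Y ^ 2 * d.X * d.h⁻¹ * d.P (-1) * d.Z (-1) * s2 +
    √(d.W 0 * d.W (-1)) * d.P (-1) * AB_m1_rat G



theorem AB_m2 (H : d.Pos) (hh : 0 < d.h) :
    d.bm 0 0 * d.am (-1) 1 =
      d.h ^ 4 * (d.am 0 0 * d.bm (-1) 0) := by
  have s1 : √(d.W 0 * d.W (-1)) * √(d.U 0 * d.W (-2)) =
      √(d.U 0 * d.W 0) * √(d.W (-1) * d.W (-2)) :=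
    sq4 (a := d.W 0) (b := d.W (-1)) (c := d.U 0) (e := d.W (-2))
      (by ring) (by ring) (by ring) (by ring) H.W0 H.U0 H.Wm
  simp only [bp, bz, bm, cp, cz, cm, ap, am, Int.reduceAdd, Int.reduceMul, Int.reduceSub, Int.reduceNeg,
    zpow_zero, zpow_neg, zpow_ofNat, zpow_one]
  linear_combination (norm := skip) (d.Y ^ 2 * d.X ^ 3 * d.h⁻¹ * d.P (-1) * d.P (-2)) * s1
  field_simp
  ring



theorem BBs_p2 (H : d.Pos) (hh : 0 < d.h) :
    d.cp 0 0 * d.bp 1 (-1) =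
      (d.h ^ 4)⁻¹ * (0 - (d.ap 0 0 * d.ap 1 0)) := by
  have s1 : √(d.W 1 * d.W 2) * √(d.U 1 * d.U 2) =
      √(d.U 1 * d.W 1) * √(d.U 2 * d.W 2) :=
    sq4 (a := d.W 1) (b := d.W 2) (c := d.U 1) (e := d.U 2)
      (by ring) (by ring) (by ring) (by ring) H.W1 H.U1 (.inl H.W2)
  simp only [bp, bz, bm, cp, cz, cm, ap, am, Int.reduceAdd, Int.reduceMul, Int.reduceSub, Int.reduceNeg,
    zpow_zero, zpow_neg, zpow_ofNat, zpow_one]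
  linear_combination (norm := skip) ((-1) * d.Y ^ 2 * d.X ^ 2 * d.h ^ 2 * (d.h ^ 2)⁻¹ * d.P 0 * d.P 1) * s1
  field_simp
  ring


theorem BBs_p1_rat (G : d.Good s) :
    (-1) * d.Y ^ 2 * d.X ^ 2 * d.h ^ 2 * (d.h ^ 2)⁻¹ * d.W 2 * d.Z 1 +
    d.Y ^ 2 * (d.h ^ 2)⁻¹ * (d.h ^ 2)⁻¹ * d.U 0 * d.Z 0 +
    (-1) * (-(d.h ^ 4)⁻¹) * d.Y * d.X * d.h +
    (-1) * ((d.h ^ 4)⁻¹) * d.Y * d.X * d.h * d.az 1 0 +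
    (-1) * ((d.h ^ 4)⁻¹) * d.Y * d.X * d.h * d.az 0 0 = 0 := by
  rcases G with ⟨D, δ, ⟨hh, hX, hY, hD, rfl, hδ0, hδ, hU, hW, hZ, hP⟩⟩ |
    ⟨u, w, δ, ⟨hh, hX, hY, hδ0, hδ, hU, hW, hZ, hP⟩⟩ <;>
  · have w9 := hδ0 (-1)
    have w0 := hδ0 0
    have w1 := hδ0 1
    have w2 := hδ0 2
    have e9 := hδ (-1)
    have e0 := hδ 0
    have e1 := hδ 1
    have e2 := hδ 2
    have p0 := hP 0 (by norm_num)
    have p9 := hP (-1) (by norm_num)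
    norm_num [zpow_ofNat, zpow_neg] at e9 e0 e1 e2 p0 p9
    norm_num [az, hh, hX, hY, hU, hW, hZ, p0, p9, zpow_ofNat, zpow_neg]
    cases s <;> norm_num <;> field_simp <;> simp only [e9, e0, e1, e2] <;> try field_simp
    all_goals ring

theorem BBs_p1 (H : d.Pos) (G : d.Good s) :
    d.cp 0 0 * d.bz 1 (-1) + d.cz 0 0 * d.bp 0 (-1) =
      (d.h ^ 4)⁻¹ * (d.ap 0 0 - (d.ap 0 0 * d.az 1 0 + d.az 0 0 * d.ap 0 0)) := by
  have s1 : √(d.W 1 * d.W 2) * √(d.U 1 * d.W 2) =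
      d.W 2 * √(d.U 1 * d.W 1) :=
    sqz (y := d.W 1) (z := d.U 1) (by ring) (by ring) (by ring) H.W1 (.inl H.W2)
  have s2 : √(d.U 0 * d.W 1) * √(d.U 0 * d.U 1) =
      d.U 0 * √(d.U 1 * d.W 1) :=
    sqz (y := d.W 1) (z := d.U 1) (by ring) (by ring) (by ring) H.W1 (.inl H.U0)
  simp only [bp, bz, bm, cp, cz, cm, ap, am, Int.reduceAdd, Int.reduceMul, Int.reduceSub, Int.reduceNeg,
    zpow_zero, zpow_neg, zpow_ofNat, zpow_one]
  linear_combination (-1) * d.Y ^ 2 * d.X ^ 2 * d.h ^ 2 * (d.h ^ 2)⁻¹ * d.P 0 * d.Z 1 * s1 +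
    d.Y ^ 2 * (d.h ^ 2)⁻¹ * (d.h ^ 2)⁻¹ * d.Z 0 * d.P 0 * s2 +
    √(d.U 1 * d.W 1) * d.P 0 * BBs_p1_rat G


theorem BBs_z_rat (G : d.Good s) :
    d.Y ^ 2 * d.X ^ 4 * d.h ^ 2 * d.h ^ 2 * d.W 1 * d.W 2 * d.P 0 ^ 2 +
    d.Y ^ 2 * (d.h ^ 2)⁻¹ * (d.h ^ 2)⁻¹ * d.U 0 * d.W 1 * d.Z 0 ^ 2 +
    d.Y ^ 2 * (d.h ^ 2)⁻¹ * (d.h ^ 2)⁻¹ * d.U 0 * d.U (-1) * d.P (-1) ^ 2 +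
    (-(d.h ^ 4)⁻¹) * d.az 0 0 +
    ((d.h ^ 4)⁻¹) * d.Y ^ 2 * d.X ^ 2 * d.h * d.h * d.U 1 * d.W 1 * d.P 0 ^ 2 +
    ((d.h ^ 4)⁻¹) * d.az 0 0 * d.az 0 0 +
    ((d.h ^ 4)⁻¹) * d.Y ^ 2 * d.X ^ 2 * d.h⁻¹ * d.h⁻¹ * d.U 0 * d.W 0 * d.P (-1) ^ 2 = 0 := by
  rcases G with ⟨D, δ, ⟨hh, hX, hY, hD, rfl, hδ0, hδ, hU, hW, hZ, hP⟩⟩ |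
    ⟨u, w, δ, ⟨hh, hX, hY, hδ0, hδ, hU, hW, hZ, hP⟩⟩ <;>
  · have w9 := hδ0 (-1)
    have w0 := hδ0 0
    have w1 := hδ0 1
    have w2 := hδ0 2
    have e9 := hδ (-1)
    have e0 := hδ 0
    have e1 := hδ 1
    have e2 := hδ 2
    have p0 := hP 0 (by norm_num)
    have p9 := hP (-1) (by norm_num)
    norm_num [zpow_ofNat, zpow_neg] at e9 e0 e1 e2 p0 p9
    norm_num [az, hh, hX, hY, hU, hW, hZ, p0, p9, zpow_ofNat, zpow_neg]
    cases s <;> norm_num <;> field_simp <;> simp only [e9, e0, e1, e2] <;> try field_simp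
    all_goals ring

theorem BBs_z (H : d.Pos) (G : d.Good s) :
    d.cp 0 0 * d.bm 1 (-1) + d.cz 0 0 * d.bz 0 (-1) + d.cm 0 0 * d.bp (-1) (-1) =
      (d.h ^ 4)⁻¹ * (d.az 0 0 - (d.ap 0 0 * d.am 1 0 + d.az 0 0 * d.az 0 0 + d.am 0 0 * d.ap (-1) 0)) := by
  have s1 : √(d.W 1 * d.W 2) * √(d.W 2 * d.W 1) = d.W 1 * d.W 2 := by
    simpa only [mul_comm] using sqq H.W1 (.inl H.W2)
  have s2 := sqq H.U0 (.inl H.W1)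
  have s3 : √(d.U 0 * d.U (-1)) * √(d.U (-1) * d.U 0) = d.U 0 * d.U (-1) := by
    simpa only [mul_comm] using sqq H.U0 H.Um
  have s4 := sqq H.U1 (.inl H.W1)
  have s5 := sqq H.U0 (.inl H.W0)
  simp only [bp, bz, bm, cp, cz, cm, ap, am, Int.reduceAdd, Int.reduceMul, Int.reduceSub, Int.reduceNeg,
    zpow_zero, zpow_neg, zpow_ofNat, zpow_one]
  linear_combination d.Y ^ 2 * d.X ^ 4 * d.h ^ 2 * d.h ^ 2 * d.P 0 ^ 2 * s1 +
    d.Y ^ 2 * (d.h ^ 2)⁻¹ * (d.h ^ 2)⁻¹ * d.Z 0 ^ 2 * s2 +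
    d.Y ^ 2 * (d.h ^ 2)⁻¹ * (d.h ^ 2)⁻¹ * d.P (-1) ^ 2 * s3 +
    ((d.h ^ 4)⁻¹) * d.Y ^ 2 * d.X ^ 2 * d.h * d.h * d.P 0 ^ 2 * s4 +
    ((d.h ^ 4)⁻¹) * d.Y ^ 2 * d.X ^ 2 * d.h⁻¹ * d.h⁻¹ * d.P (-1) ^ 2 * s5 +
    1 * BBs_z_rat G


theorem BBs_m1_rat (G : d.Good s) :
    (-1) * d.Y ^ 2 * d.X ^ 2 * (d.h ^ 2)⁻¹ * (d.h ^ 2)⁻¹ * d.W 1 * d.Z 0 +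
    d.Y ^ 2 * (d.h ^ 2)⁻¹ * (d.h ^ 2)⁻¹ * d.U (-1) * d.Z (-1) +
    (-1) * (-(d.h ^ 4)⁻¹) * d.Y * d.X * d.h⁻¹ +
    (-1) * ((d.h ^ 4)⁻¹) * d.Y * d.X * d.h⁻¹ * d.az 0 0 +
    (-1) * ((d.h ^ 4)⁻¹) * d.Y * d.X * d.h⁻¹ * d.az (-1) 0 = 0 := by
  rcases G with ⟨D, δ, ⟨hh, hX, hY, hD, rfl, hδ0, hδ, hU, hW, hZ, hP⟩⟩ |
    ⟨u, w, δ, ⟨hh, hX, hY, hδ0, hδ, hU, hW, hZ, hP⟩⟩ <;>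
  · have w9 := hδ0 (-1)
    have w0 := hδ0 0
    have w1 := hδ0 1
    have w2 := hδ0 2
    have e9 := hδ (-1)
    have e0 := hδ 0
    have e1 := hδ 1
    have e2 := hδ 2
    have p0 := hP 0 (by norm_num)
    have p9 := hP (-1) (by norm_num)
    norm_num [zpow_ofNat, zpow_neg] at e9 e0 e1 e2 p0 p9
    norm_num [az, hh, hX, hY, hU, hW, hZ, p0, p9, zpow_ofNat, zpow_neg]
    cases s <;> norm_num <;> field_simp <;> simp only [e9, e0, e1, e2] <;> try field_simp
    all_goals ring

theorem BBs_m1 (H : d.Pos) (G : d.Good s) :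
    d.cz 0 0 * d.bm 0 (-1) + d.cm 0 0 * d.bz (-1) (-1) =
      (d.h ^ 4)⁻¹ * (d.am 0 0 - (d.az 0 0 * d.am 0 0 + d.am 0 0 * d.az (-1) 0)) := by
  have s1 : √(d.U 0 * d.W 1) * √(d.W 1 * d.W 0) =
      d.W 1 * √(d.U 0 * d.W 0) :=
    sqz (y := d.U 0) (z := d.W 0) (by ring) (by ring) (by ring) H.U0 (.inl H.W1)
  have s2 : √(d.U 0 * d.U (-1)) * √(d.U (-1) * d.W 0) =
      d.U (-1) * √(d.U 0 * d.W 0) :=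
    sqz (y := d.U 0) (z := d.W 0) (by ring) (by ring) (by ring) H.U0 H.Um
  simp only [bp, bz, bm, cp, cz, cm, ap, am, Int.reduceAdd, Int.reduceMul, Int.reduceSub, Int.reduceNeg,
    zpow_zero, zpow_neg, zpow_ofNat, zpow_one]
  linear_combination (-1) * d.Y ^ 2 * d.X ^ 2 * (d.h ^ 2)⁻¹ * (d.h ^ 2)⁻¹ * d.Z 0 * d.P (-1) * s1 +
    d.Y ^ 2 * (d.h ^ 2)⁻¹ * (d.h ^ 2)⁻¹ * d.P (-1) * d.Z (-1) * s2 +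
    √(d.U 0 * d.W 0) * d.P (-1) * BBs_m1_rat G



theorem BBs_m2 (H : d.Pos) (hh : 0 < d.h) :
    d.cm 0 0 * d.bm (-1) (-1) =
      (d.h ^ 4)⁻¹ * (0 - (d.am 0 0 * d.am (-1) 0)) := by
  have s1 : √(d.U 0 * d.U (-1)) * √(d.W 0 * d.W (-1)) =
      √(d.U 0 * d.W 0) * √(d.U (-1) * d.W (-1)) :=
    sq4 (a := d.U 0) (b := d.U (-1)) (c := d.W 0) (e := d.W (-1))
      (by ring) (by ring) (by ring) (by ring) H.U0 H.W0 H.Um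
  simp only [bp, bz, bm, cp, cz, cm, ap, am, Int.reduceAdd, Int.reduceMul, Int.reduceSub, Int.reduceNeg,
    zpow_zero, zpow_neg, zpow_ofNat, zpow_one]
  linear_combination (norm := skip) ((-1) * d.Y ^ 2 * d.X ^ 2 * (d.h ^ 2)⁻¹ * (d.h ^ 6)⁻¹ * d.P (-1) * d.P (-2)) * s1
  field_simp
  ring



theorem BsB_p2 (H : d.Pos) (hh : 0 < d.h) :
    d.bp 0 0 * d.cp 1 1 =
      0 - d.h ^ 4 * (d.ap 0 0 * d.ap 1 0) := by
  have s1 : √(d.U 1 * d.U 2) * √(d.W 1 * d.W 2) =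
      √(d.U 1 * d.W 1) * √(d.U 2 * d.W 2) :=
    sq4 (a := d.U 1) (b := d.U 2) (c := d.W 1) (e := d.W 2)
      (by ring) (by ring) (by ring) (by ring) H.U1 H.W1 (.inl H.U2)
  simp only [bp, bz, bm, cp, cz, cm, ap, am, Int.reduceAdd, Int.reduceMul, Int.reduceSub, Int.reduceNeg,
    zpow_zero, zpow_neg, zpow_ofNat, zpow_one]
  linear_combination (norm := skip) ((-1) * d.Y ^ 2 * d.X ^ 2 * d.h ^ 8 * d.P 0 * d.P 1) * s1
  field_simp
  ring


theorem BsB_p1_rat (G : d.Good s) :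
    d.Y ^ 2 * d.U 2 * d.Z 1 +
    (-1) * d.Y ^ 2 * d.X ^ 2 * d.h ^ 4 * d.W 0 * d.Z 0 +
    (-1) * (-1) * d.Y * d.X * d.h +
    (-1) * (d.h ^ 4) * d.Y * d.X * d.h * d.az 1 0 +
    (-1) * (d.h ^ 4) * d.Y * d.X * d.h * d.az 0 0 = 0 := by
  rcases G with ⟨D, δ, ⟨hh, hX, hY, hD, rfl, hδ0, hδ, hU, hW, hZ, hP⟩⟩ |
    ⟨u, w, δ, ⟨hh, hX, hY, hδ0, hδ, hU, hW, hZ, hP⟩⟩ <;>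
  · have w9 := hδ0 (-1)
    have w0 := hδ0 0
    have w1 := hδ0 1
    have w2 := hδ0 2
    have e9 := hδ (-1)
    have e0 := hδ 0
    have e1 := hδ 1
    have e2 := hδ 2
    have p0 := hP 0 (by norm_num)
    have p9 := hP (-1) (by norm_num)
    norm_num [zpow_ofNat, zpow_neg] at e9 e0 e1 e2 p0 p9
    norm_num [az, hh, hX, hY, hU, hW, hZ, p0, p9, zpow_ofNat, zpow_neg]
    cases s <;> norm_num <;> field_simp <;> simp only [e9, e0, e1, e2] <;> try field_simp
    all_goals ring

theorem BsB_p1 (H : d.Pos) (G : d.Good s) :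
    d.bp 0 0 * d.cz 1 1 + d.bz 0 0 * d.cp 0 1 =
      d.ap 0 0 - d.h ^ 4 * (d.ap 0 0 * d.az 1 0 + d.az 0 0 * d.ap 0 0) := by
  have s1 : √(d.U 1 * d.U 2) * √(d.U 2 * d.W 1) =
      d.U 2 * √(d.U 1 * d.W 1) :=
    sqz (y := d.U 1) (z := d.W 1) (by ring) (by ring) (by ring) H.U1 (.inl H.U2)
  have s2 : √(d.U 1 * d.W 0) * √(d.W 0 * d.W 1) =
      d.W 0 * √(d.U 1 * d.W 1) :=
    sqz (y := d.U 1) (z := d.W 1) (by ring) (by ring) (by ring) H.U1 (.inl H.W0)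
  simp only [bp, bz, bm, cp, cz, cm, ap, am, Int.reduceAdd, Int.reduceMul, Int.reduceSub, Int.reduceNeg,
    zpow_zero, zpow_neg, zpow_ofNat, zpow_one]
  linear_combination d.Y ^ 2 * d.P 0 * d.Z 1 * s1 +
    (-1) * d.Y ^ 2 * d.X ^ 2 * d.h ^ 4 * d.Z 0 * d.P 0 * s2 +
    √(d.U 1 * d.W 1) * d.P 0 * BsB_p1_rat G


theorem BsB_z_rat (G : d.Good s) :
    d.Y ^ 2 * d.U 1 * d.U 2 * d.P 0 ^ 2 +
    d.Y ^ 2 * d.U 1 * d.W 0 * d.Z 0 ^ 2 +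
    d.Y ^ 2 * d.X ^ 4 * d.W 0 * d.W (-1) * d.P (-1) ^ 2 +
    (-1) * d.az 0 0 +
    (d.h ^ 4) * d.Y ^ 2 * d.X ^ 2 * d.h * d.h * d.U 1 * d.W 1 * d.P 0 ^ 2 +
    (d.h ^ 4) * d.az 0 0 * d.az 0 0 +
    (d.h ^ 4) * d.Y ^ 2 * d.X ^ 2 * d.h⁻¹ * d.h⁻¹ * d.U 0 * d.W 0 * d.P (-1) ^ 2 = 0 := by
  rcases G with ⟨D, δ, ⟨hh, hX, hY, hD, rfl, hδ0, hδ, hU, hW, hZ, hP⟩⟩ |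
    ⟨u, w, δ, ⟨hh, hX, hY, hδ0, hδ, hU, hW, hZ, hP⟩⟩ <;>
  · have w9 := hδ0 (-1)
    have w0 := hδ0 0
    have w1 := hδ0 1
    have w2 := hδ0 2
    have e9 := hδ (-1)
    have e0 := hδ 0
    have e1 := hδ 1
    have e2 := hδ 2
    have p0 := hP 0 (by norm_num)
    have p9 := hP (-1) (by norm_num)
    norm_num [zpow_ofNat, zpow_neg] at e9 e0 e1 e2 p0 p9
    norm_num [az, hh, hX, hY, hU, hW, hZ, p0, p9, zpow_ofNat, zpow_neg]
    cases s <;> norm_num <;> field_simp <;> simp only [e9, e0, e1, e2] <;> try field_simp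
    all_goals ring

theorem BsB_z (H : d.Pos) (G : d.Good s) :
    d.bp 0 0 * d.cm 1 1 + d.bz 0 0 * d.cz 0 1 + d.bm 0 0 * d.cp (-1) 1 =
      d.az 0 0 - d.h ^ 4 * (d.ap 0 0 * d.am 1 0 + d.az 0 0 * d.az 0 0 + d.am 0 0 * d.ap (-1) 0) := by
  have s1 : √(d.U 1 * d.U 2) * √(d.U 2 * d.U 1) = d.U 1 * d.U 2 := by
    simpa only [mul_comm] using sqq H.U1 (.inl H.U2)
  have s2 := sqq H.U1 (.inl H.W0)
  have s3 : √(d.W 0 * d.W (-1)) * √(d.W (-1) * d.W 0) = d.W 0 * d.W (-1) := by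
    simpa only [mul_comm] using sqq H.W0 H.Wm
  have s4 := sqq H.U1 (.inl H.W1)
  have s5 := sqq H.U0 (.inl H.W0)
  simp only [bp, bz, bm, cp, cz, cm, ap, am, Int.reduceAdd, Int.reduceMul, Int.reduceSub, Int.reduceNeg,
    zpow_zero, zpow_neg, zpow_ofNat, zpow_one]
  linear_combination d.Y ^ 2 * d.P 0 ^ 2 * s1 +
    d.Y ^ 2 * d.Z 0 ^ 2 * s2 +
    d.Y ^ 2 * d.X ^ 4 * d.P (-1) ^ 2 * s3 +
    (d.h ^ 4) * d.Y ^ 2 * d.X ^ 2 * d.h * d.h * d.P 0 ^ 2 * s4 +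
    (d.h ^ 4) * d.Y ^ 2 * d.X ^ 2 * d.h⁻¹ * d.h⁻¹ * d.P (-1) ^ 2 * s5 +
    1 * BsB_z_rat G


theorem BsB_m1_rat (G : d.Good s) :
    d.Y ^ 2 * d.U 1 * d.Z 0 +
    (-1) * d.Y ^ 2 * d.X ^ 2 * d.W (-1) * d.Z (-1) +
    (-1) * (-1) * d.Y * d.X * d.h⁻¹ +
    (-1) * (d.h ^ 4) * d.Y * d.X * d.h⁻¹ * d.az 0 0 +
    (-1) * (d.h ^ 4) * d.Y * d.X * d.h⁻¹ * d.az (-1) 0 = 0 := by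
  rcases G with ⟨D, δ, ⟨hh, hX, hY, hD, rfl, hδ0, hδ, hU, hW, hZ, hP⟩⟩ |
    ⟨u, w, δ, ⟨hh, hX, hY, hδ0, hδ, hU, hW, hZ, hP⟩⟩ <;>
  · have w9 := hδ0 (-1)
    have w0 := hδ0 0
    have w1 := hδ0 1
    have w2 := hδ0 2
    have e9 := hδ (-1)
    have e0 := hδ 0
    have e1 := hδ 1
    have e2 := hδ 2
    have p0 := hP 0 (by norm_num)
    have p9 := hP (-1) (by norm_num)
    norm_num [zpow_ofNat, zpow_neg] at e9 e0 e1 e2 p0 p9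
    norm_num [az, hh, hX, hY, hU, hW, hZ, p0, p9, zpow_ofNat, zpow_neg]
    cases s <;> norm_num <;> field_simp <;> simp only [e9, e0, e1, e2] <;> try field_simp
    all_goals ring

theorem BsB_m1 (H : d.Pos) (G : d.Good s) :
    d.bz 0 0 * d.cm 0 1 + d.bm 0 0 * d.cz (-1) 1 =
      d.am 0 0 - d.h ^ 4 * (d.az 0 0 * d.am 0 0 + d.am 0 0 * d.az (-1) 0) := by
  have s1 : √(d.U 1 * d.W 0) * √(d.U 1 * d.U 0) =
      d.U 1 * √(d.U 0 * d.W 0) :=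
    sqz (y := d.W 0) (z := d.U 0) (by ring) (by ring) (by ring) H.W0 (.inl H.U1)
  have s2 : √(d.W 0 * d.W (-1)) * √(d.U 0 * d.W (-1)) =
      d.W (-1) * √(d.U 0 * d.W 0) :=
    sqz (y := d.W 0) (z := d.U 0) (by ring) (by ring) (by ring) H.W0 H.Wm
  simp only [bp, bz, bm, cp, cz, cm, ap, am, Int.reduceAdd, Int.reduceMul, Int.reduceSub, Int.reduceNeg,
    zpow_zero, zpow_neg, zpow_ofNat, zpow_one]
  linear_combination d.Y ^ 2 * d.Z 0 * d.P (-1) * s1 +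
    (-1) * d.Y ^ 2 * d.X ^ 2 * d.P (-1) * d.Z (-1) * s2 +
    √(d.U 0 * d.W 0) * d.P (-1) * BsB_m1_rat G



theorem BsB_m2 (H : d.Pos) (hh : 0 < d.h) :
    d.bm 0 0 * d.cm (-1) 1 =
      0 - d.h ^ 4 * (d.am 0 0 * d.am (-1) 0) := by
  have s1 : √(d.W 0 * d.W (-1)) * √(d.U 0 * d.U (-1)) =
      √(d.U 0 * d.W 0) * √(d.U (-1) * d.W (-1)) :=
    sq4 (a := d.W 0) (b := d.W (-1)) (c := d.U 0) (e := d.U (-1))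
      (by ring) (by ring) (by ring) (by ring) H.W0 H.U0 H.Wm
  simp only [bp, bz, bm, cp, cz, cm, ap, am, Int.reduceAdd, Int.reduceMul, Int.reduceSub, Int.reduceNeg,
    zpow_zero, zpow_neg, zpow_ofNat, zpow_one]
  linear_combination (norm := skip) ((-1) * d.Y ^ 2 * d.X ^ 2 * d.P (-1) * d.P (-2)) * s1
  field_simp
  ring


end Dat
theorem alpha0_eq {q L h x : ℝ} (s : Bool) (hh : 0 < h) (hx : 0 < x) (hq : q = h ^ 2) (h1 : q ≠ 1)
    (hxL : q ^ L = x) (w0 : x ^ 4 - 1 ≠ 0) (w1 : x ^ 4 * h ^ 8 - 1 ≠ 0) :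
    alpha0 q s L = 1 / h * ((h ^ 4 - 1) / h ^ 2) *
      (x ^ 2 * h ^ 2 + (x ^ 2 * h ^ 2)⁻¹ - if s then 1 + (h ^ 4)⁻¹ else h ^ 4 + 1) *
      (x ^ 4 * h ^ 4) / ((x ^ 4 - 1) * (x ^ 4 * h ^ 8 - 1)) := by
  have hq0 : 0 < q := by rw [hq]; positivity
  have hsq : √q = h := by rw [hq]; exact Real.sqrt_sq hh.le
  have hhalf : q ^ (1 / 2 : ℝ) = h := by rw [← Real.sqrt_eq_rpow, hsq]
  have a1 : q ^ (L - 1 / 2) = x / h := by rw [Real.rpow_sub hq0, hxL, hhalf]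
  have a2 : q ^ (L + 3 / 2) = x * h ^ 3 := by
    rw [show L + 3 / 2 = L + (1 + 1 / 2) by ring, Real.rpow_add hq0, Real.rpow_add hq0, hxL, hhalf,
      Real.rpow_one, hq]
    ring
  have a3 : q ^ (2 * L) = x ^ 2 := by rw [two_mul, Real.rpow_add hq0, hxL]; ring
  have a4 : q ^ (2 * L + 2) = x ^ 2 * h ^ 4 := by
    rw [Real.rpow_add hq0, a3, Real.rpow_ofNat, hq]; ring
  have hD : h ^ 4 - 1 ≠ 0 := by
    intro h'
    apply h1
    have : 0 < h ^ 2 := by positivity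
    rw [hq]; nlinarith
  have hD' : q - q⁻¹ = (h ^ 4 - 1) / h ^ 2 := by rw [hq]; field_simp
  rw [alpha0, qnum_eq hq0 h1 a1, qnum_eq hq0 h1 a2, qnum_eq hq0 h1 a3, qnum_eq hq0 h1 a4, hsq, hD', hq]
  have e1 : x ^ 2 - (x ^ 2)⁻¹ = (x ^ 4 - 1) / x ^ 2 := by field_simp
  have e2 : x ^ 2 * h ^ 4 - (x ^ 2 * h ^ 4)⁻¹ = (x ^ 4 * h ^ 8 - 1) / (x ^ 2 * h ^ 4) := by
    field_simp
  rw [e1, e2]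
  generalize x ^ 4 - 1 = A at *
  generalize x ^ 4 * h ^ 8 - 1 = B at *
  cases s <;> norm_num <;> field_simp <;> ring

theorem alphaP_sq {q L h x : ℝ} (s : Bool) (hh : 0 < h) (hx : 0 < x) (hq : q = h ^ 2) (h1 : q ≠ 1)
    (hxL : q ^ L = x) (w1 : x ^ 4 * h ^ 8 - 1 ≠ 0) (hL : 0 < L + 1) :
    alphaP q s L ^ 2 = (if s then 1 / h ^ 4 else 1) * ((h ^ 4 - 1) / h ^ 2) ^ 2 *
      (x ^ 4 * h ^ 10) / ((x ^ 4 * h ^ 8 - 1) ^ 2 * (x ^ 2 * h ^ 4 + h ^ 2) *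
        (x ^ 2 * h ^ 4 * h ^ 2 + 1)) := by
  have hq0 : 0 < q := by rw [hq]; positivity
  have a3 : q ^ (2 * L) = x ^ 2 := by rw [two_mul, Real.rpow_add hq0, hxL]; ring
  have a4 : q ^ (2 * L + 2) = x ^ 2 * h ^ 4 := by
    rw [Real.rpow_add hq0, a3, Real.rpow_ofNat, hq]; ring
  have a5 : q ^ (4 * L + 4) = x ^ 4 * h ^ 8 := by
    rw [show 4 * L + 4 = (2 * L + 2) + (2 * L + 2) by ring, Real.rpow_add hq0, a4]; ring
  have a6 : q ^ (2 : ℝ) = h ^ 4 := by rw [Real.rpow_ofNat, hq]; ring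
  have b1 : q ^ (-L - 2) = x⁻¹ * (h ^ 4)⁻¹ := by
    rw [show -L - 2 = -L + -2 by ring, Real.rpow_add hq0, Real.rpow_neg hq0.le, Real.rpow_neg hq0.le,
      hxL, a6]
  have b2 : q ^ (-L - 1) = x⁻¹ * (h ^ 2)⁻¹ := by
    rw [show -L - 1 = -L + -1 by ring, Real.rpow_add hq0, Real.rpow_neg hq0.le, Real.rpow_neg hq0.le,
      hxL, Real.rpow_one, hq]
  have hD : h ^ 4 - 1 ≠ 0 := by
    intro h'
    apply h1
    have : 0 < h ^ 2 := by positivity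
    rw [hq]; nlinarith
  have hD' : q - q⁻¹ = (h ^ 4 - 1) / h ^ 2 := by rw [hq]; field_simp
  have hpos : 0 ≤ qnum q (2 * L + 2) * (qnum q (4 * L + 4) + qnum q 2 * qnum q (2 * L + 2)) := by
    have := qnum_pos hq0 (x := 2 * L + 2) (by linarith)
    have := qnum_pos hq0 (x := 4 * L + 4) (by linarith)
    have := qnum_pos hq0 (x := 2) (by norm_num)
    positivity
  rw [alphaP, mul_pow, div_pow, Real.sq_sqrt hpos, qnum_eq hq0 h1 a4, qnum_eq hq0 h1 a5,
    qnum_eq hq0 h1 a6, hD', b1, b2]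
  have e2 : x ^ 2 * h ^ 4 - (x ^ 2 * h ^ 4)⁻¹ = (x ^ 4 * h ^ 8 - 1) / (x ^ 2 * h ^ 4) := by
    field_simp
  have e3 : (x ^ 4 * h ^ 8 - (x ^ 4 * h ^ 8)⁻¹) / ((h ^ 4 - 1) / h ^ 2) +
      (h ^ 4 - (h ^ 4)⁻¹) / ((h ^ 4 - 1) / h ^ 2) * ((x ^ 4 * h ^ 8 - 1) / (x ^ 2 * h ^ 4) /
        ((h ^ 4 - 1) / h ^ 2)) =
      (x ^ 4 * h ^ 8 - 1) / ((h ^ 4 - 1) / h ^ 2) *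
        ((x ^ 2 * h ^ 4 + h ^ 2) * (x ^ 2 * h ^ 4 * h ^ 2 + 1)) / (x ^ 4 * h ^ 8 * h ^ 2) := by
    field_simp
    ring
  rw [e2, e3]
  have c1 : x ^ 2 * h ^ 4 + h ^ 2 ≠ 0 := by positivity
  have c2 : x ^ 2 * h ^ 4 * h ^ 2 + 1 ≠ 0 := by positivity
  generalize x ^ 2 * h ^ 4 + h ^ 2 = A at *
  generalize x ^ 2 * h ^ 4 * h ^ 2 + 1 = B at *
  generalize x ^ 4 * h ^ 8 - 1 = C at *
  cases s <;> norm_num <;> field_simp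

/-- The data at the pair `(l, m)`. -/
noncomputable def datOf (q : ℝ) (s : Bool) (l m : ℝ) : Dat where
  h := √q
  X := q ^ l
  Y := q ^ m
  U k := qnum q (l + m + k)
  W k := qnum q (l - m + k)
  Z k := alpha0 q s (l + k)
  P k := alphaP q s (l + k)

theorem datOf_good {q : ℝ} (hq : 0 < q) (s : Bool) {n μ : ℤ} {l m : ℝ} (hl : l = n + 1 / 2)
    (hm : m = μ + 1 / 2) (h1 : -(n + 1) ≤ μ) (h2 : μ ≤ n) : (datOf q s l m).Good s := by
  have hn : (0 : ℝ) ≤ n := by exact_mod_cast (by omega : 0 ≤ n)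
  have hodd : ∀ k : ℤ, l + k ≠ 0 := by
    intro k h
    have : (2 * (n + k) + 1 : ℝ) = 0 := by rw [hl] at h; linarith
    have : 2 * (n + k) + 1 = 0 := by exact_mod_cast this
    omega
  by_cases hq1 : q = 1
  · subst hq1
    refine .inr ⟨l + m, l - m, fun k => 2 * (l + k), ⟨by simp [datOf], by simp [datOf],
      by simp [datOf], fun k => mul_ne_zero two_ne_zero (hodd k), fun k => by ring,
      fun k => qnum_one, fun k => qnum_one, fun k => ?_, fun k hk => ?_⟩⟩
    · have w0 := hodd k
      have w1 := hodd (k + 1)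
      push_cast at w1
      have w1' : l + k + 1 ≠ 0 := by rwa [add_assoc]
      simp only [datOf, alpha0, qnum_one]
      rw [show 2 * (l + k) + 2 = 2 * (l + ↑(k + 1)) by push_cast; ring]
      cases s <;> simp
    · have hk' : (-1 : ℝ) ≤ k := by exact_mod_cast hk
      have hpos : 0 < l + k + 1 := by rw [hl]; linarith
      simp only [datOf, alphaP, qnum_one]
      rw [show (2 * (l + k) + 2) * (4 * (l + k) + 4 + 2 * (2 * (l + k) + 2)) =
        (4 * (l + k + 1)) ^ 2 by ring, Real.sqrt_sq (by positivity),
        show l + ((k + 1 : ℤ) : ℝ) = l + k + 1 by push_cast; ring]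
      have := hpos.ne'
      cases s <;> simp <;> field_simp <;> norm_num
  · have hh : 0 < √q := Real.sqrt_pos.2 hq
    have hqh : q = √q ^ 2 := (Real.sq_sqrt hq.le).symm
    have hX : 0 < q ^ l := Real.rpow_pos_of_pos hq l
    have hY : 0 < q ^ m := Real.rpow_pos_of_pos hq m
    have hk : ∀ k : ℤ, q ^ (k : ℝ) = √q ^ (2 * k) := by
      intro k
      rw [Real.rpow_intCast, zpow_mul]
      conv_lhs => rw [hqh]
      norm_cast
    have hD : √q ^ 4 - 1 ≠ 0 := by
      intro h'
      apply hq1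
      have : (√q ^ 2) ^ 2 - 1 = 0 := by rw [← h']; ring
      rw [← hqh] at this
      nlinarith
    have hDq : q - q⁻¹ = (√q ^ 4 - 1) / √q ^ 2 := by
      rw [show √q ^ 4 = (√q ^ 2) ^ 2 by ring, ← hqh]; field_simp
    have hxk : ∀ k : ℤ, q ^ (l + k) = q ^ l * √q ^ (2 * k) := fun k => by
      rw [Real.rpow_add hq, hk]
    have p2 : ∀ (k : ℤ), (√q ^ (2 * k)) ^ 2 = √q ^ (4 * k) := fun k => by
      rw [← zpow_natCast, ← zpow_mul]; congr 1; push_cast; ring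
    have p4 : ∀ (k : ℤ), (√q ^ (2 * k)) ^ 4 = √q ^ (8 * k) := fun k => by
      rw [← zpow_natCast, ← zpow_mul]; congr 1; push_cast; ring
    have s8 : ∀ k : ℤ, √q ^ (8 * (k + 1)) = √q ^ (8 * k) * √q ^ 8 := fun k => by
      rw [mul_add, mul_one, zpow_add₀ hh.ne']; norm_cast
    have s4 : ∀ k : ℤ, √q ^ (4 * (k + 1)) = √q ^ (4 * k) * √q ^ 4 := fun k => by
      rw [mul_add, mul_one, zpow_add₀ hh.ne']; norm_cast
    have hδ : ∀ k : ℤ, (q ^ l) ^ 4 * √q ^ (8 * k) - 1 ≠ 0 := by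
      intro k h
      have e : (q ^ (l + k)) ^ 4 = 1 := by rw [hxk, mul_pow, p4]; linarith
      have e' : q ^ (l + k) = 1 := (pow_eq_one_iff_of_nonneg (by positivity) (by norm_num)).1 e
      rw [← Real.rpow_zero q, Real.rpow_right_inj hq hq1] at e'
      exact hodd k e'
    refine .inl ⟨√q ^ 4 - 1, fun k => (q ^ l) ^ 4 * √q ^ (8 * k) - 1, ⟨hh, hX, hY, hD, rfl, hδ,
      fun k => rfl, fun k => ?_, fun k => ?_, fun k => ?_, fun k hk1 => ?_⟩⟩
    · simp only [datOf]
      rw [qnum_eq hq hq1 (y := q ^ l * q ^ m * √q ^ (2 * k))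
        (by rw [Real.rpow_add hq, Real.rpow_add hq, hk]), hDq]
    · simp only [datOf]
      rw [qnum_eq hq hq1 (y := q ^ l / q ^ m * √q ^ (2 * k))
        (by rw [Real.rpow_add hq, Real.rpow_sub hq, hk]), hDq]
    · simp only [datOf]
      have w0 := hδ k
      have w1 := hδ (k + 1)
      rw [s8] at w1
      rw [alpha0_eq s hh (mul_pos hX (zpow_pos hh _)) hqh hq1 (hxk k) (by rwa [mul_pow, p4])
        (by rwa [mul_pow, p4, mul_assoc]), mul_pow, mul_pow, p2, p4, s8, mul_assoc _ _ (√q ^ 8)]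
    · simp only [datOf]
      have w1 := hδ (k + 1)
      rw [s8] at w1
      have hk' : (-1 : ℝ) ≤ k := by exact_mod_cast hk1
      rw [alphaP_sq s hh (mul_pos hX (zpow_pos hh _)) hqh hq1 (hxk k)
        (by rwa [mul_pow, p4, mul_assoc]) (by rw [hl]; linarith), mul_pow, mul_pow, p2, p4, s8, s4]
      simp only [mul_assoc]

theorem datOf_pos {q : ℝ} (hq : 0 < q) (s : Bool) {n μ : ℤ} {l m : ℝ} (hl : l = n + 1 / 2)
    (hm : m = μ + 1 / 2) (h1 : -(n + 1) ≤ μ) (h2 : μ ≤ n) : (datOf q s l m).Pos := by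
  obtain ⟨hu, hw⟩ := nonneg_uv hl hm h1 h2
  have hk : ∀ x : ℝ, 0 ≤ x → ∀ k : ℤ, 0 ≤ k → 0 ≤ qnum q (x + k) := fun x hx k h0 =>
    qnum_nonneg hq (add_nonneg hx (by exact_mod_cast h0))
  have hneg : ∀ (x : ℝ) (a : ℤ), x = a → 0 ≤ a → 0 ≤ qnum q (x + (-1 : ℤ)) ∨
      qnum q (x + (0 : ℤ)) = 0 := by
    rintro x a rfl ha
    rcases ha.eq_or_lt with rfl | ha
    · exact .inr (by simp [qnum_zero])
    · refine .inl (qnum_nonneg hq ?_)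
      exact_mod_cast (by omega : 0 ≤ a + -1)
  exact ⟨hk _ hu 0 le_rfl, hk _ hu 1 (by norm_num), hk _ hu 2 (by norm_num), hk _ hw 0 le_rfl,
    hk _ hw 1 (by norm_num), hk _ hw 2 (by norm_num),
    hneg _ (n + μ + 1) (by rw [hl, hm]; push_cast; ring) (by omega),
    hneg _ (n - μ) (by rw [hl, hm]; push_cast; ring) (by omega)⟩

theorem rpow_add_int {q : ℝ} (hq : 0 < q) (m : ℝ) (j : ℤ) :
    q ^ (m + j) = q ^ m * √q ^ (2 * j) := by
  rw [Real.rpow_add hq, Real.rpow_intCast, zpow_mul]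
  congr 2
  exact_mod_cast (Real.sq_sqrt hq.le).symm

theorem rpow_half {q : ℝ} (hq : 0 < q) (k : ℤ) : q ^ ((k : ℝ) / 2) = √q ^ k := by
  rw [Real.sqrt_eq_rpow, ← Real.rpow_intCast, ← Real.rpow_mul hq.le]
  congr 1
  ring

theorem BP_dat {q : ℝ} (hq : 0 < q) (s : Bool) (l m : ℝ) (i j : ℤ) :
    BP q s (l + i) (m + j) = (datOf q s l m).bp i j := by
  simp only [BP, Dat.bp, datOf, rpow_add_int hq]
  push_cast
  ring_nf

theorem BZ_dat {q : ℝ} (hq : 0 < q) (s : Bool) (l m : ℝ) (i j : ℤ) :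
    BZ q s (l + i) (m + j) = (datOf q s l m).bz i j := by
  simp only [BZ, Dat.bz, datOf, rpow_add_int hq]
  push_cast
  ring_nf

theorem alphaM_dat {q : ℝ} (hq : 0 < q) (s : Bool) (l : ℝ) (i : ℤ) :
    alphaM q s (l + i) = -((q ^ l) ^ 2 * √q ^ (4 * i)) * alphaP q s (l + ↑(i - 1)) := by
  have : q ^ (2 * (l + i)) = (q ^ l) ^ 2 * √q ^ (4 * i) := by
    rw [show 2 * (l + i) = l + l + ((4 * i : ℤ) : ℝ) / 2 by push_cast; ring, Real.rpow_add hq,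
      Real.rpow_add hq, rpow_half hq]
    ring
  rw [alphaM, this]
  push_cast
  ring_nf

theorem BM_dat {q : ℝ} (hq : 0 < q) (s : Bool) (l m : ℝ) (i j : ℤ) :
    BM q s (l + i) (m + j) = (datOf q s l m).bm i j := by
  simp only [BM, Dat.bm, datOf, rpow_add_int hq, alphaM_dat hq]
  rw [zpow_add₀ (Real.sqrt_pos.2 hq).ne']
  push_cast
  ring_nf

theorem BstarP_dat {q : ℝ} (hq : 0 < q) (s : Bool) (l m : ℝ) (i j : ℤ) :
    BstarP q s (l + i) (m + j) = (datOf q s l m).cp i j := by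
  have h1 := rpow_add_int hq m (j - 1)
  have h2 := alphaM_dat hq s l (i + 1)
  rw [show m + ((j - 1 : ℤ) : ℝ) = m + j - 1 by push_cast; ring] at h1
  rw [show l + ((i + 1 : ℤ) : ℝ) = l + i + 1 by push_cast; ring] at h2
  simp only [BstarP, Dat.cp, datOf, h1, h2]
  rw [show 2 * j + 4 * i + 2 = 2 * (j - 1) + 4 * (i + 1) by ring,
    zpow_add₀ (Real.sqrt_pos.2 hq).ne', mul_comm (qnum q (l + i - (m + j) + 2))]
  push_cast
  ring_nf

theorem BstarZ_dat {q : ℝ} (hq : 0 < q) (s : Bool) (l m : ℝ) (i j : ℤ) :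
    BstarZ q s (l + i) (m + j) = (datOf q s l m).cz i j := by
  have h1 := rpow_add_int hq m (j - 1)
  rw [show m + ((j - 1 : ℤ) : ℝ) = m + j - 1 by push_cast; ring] at h1
  simp only [BstarZ, Dat.cz, datOf, h1]
  push_cast
  ring_nf

theorem BstarM_dat {q : ℝ} (hq : 0 < q) (s : Bool) (l m : ℝ) (i j : ℤ) :
    BstarM q s (l + i) (m + j) = (datOf q s l m).cm i j := by
  have h1 := rpow_add_int hq m (j - 1)
  rw [show m + ((j - 1 : ℤ) : ℝ) = m + j - 1 by push_cast; ring] at h1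
  simp only [BstarM, Dat.cm, datOf, h1]
  push_cast
  ring_nf

theorem AP_dat {q : ℝ} (hq : 0 < q) (s : Bool) (l m : ℝ) (i j : ℤ) :
    AP q s (l + i) (m + j) = (datOf q s l m).ap i j := by
  have h1 : q ^ (m + j + (l + i) + 1 / 2) = q ^ m * q ^ l * √q ^ (2 * i + 2 * j + 1) := by
    rw [show m + j + (l + i) + 1 / 2 = m + l + ((2 * i + 2 * j + 1 : ℤ) : ℝ) / 2 by push_cast; ring,
      Real.rpow_add hq, Real.rpow_add hq, rpow_half hq]
  simp only [AP, Dat.ap, datOf, h1]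
  rw [mul_comm (qnum q (l + i - (m + j) + 1))]
  push_cast
  ring_nf

theorem AZ_dat {q : ℝ} (hq : 0 < q) (s : Bool) (l m : ℝ) (i j : ℤ) :
    AZ q s (l + i) (m + j) = (datOf q s l m).az i j := by
  have h4 : √q ^ 4 = q ^ 2 := by
    rw [show √q ^ 4 = (√q ^ 2) ^ 2 by ring, Real.sq_sqrt hq.le]
  simp only [AZ, Dat.az, datOf, h4]
  push_cast
  ring_nf

theorem AM_dat {q : ℝ} (hq : 0 < q) (s : Bool) (l m : ℝ) (i j : ℤ) :
    AM q s (l + i) (m + j) = (datOf q s l m).am i j := by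
  have hX : q ^ l ≠ 0 := (Real.rpow_pos_of_pos hq l).ne'
  have h1 : q ^ (m + j - (l + i) - 1 / 2) * ((q ^ l) ^ 2 * √q ^ (4 * i)) =
      q ^ m * q ^ l * √q ^ (2 * i + 2 * j - 1) := by
    rw [show 2 * i + 2 * j - 1 = (2 * j - 2 * i - 1) + 4 * i by ring,
      show m + j - (l + i) - 1 / 2 = m - l + ((2 * j - 2 * i - 1 : ℤ) : ℝ) / 2 by push_cast; ring,
      Real.rpow_add hq, Real.rpow_sub hq, rpow_half hq, zpow_add₀ (Real.sqrt_pos.2 hq).ne']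
    field_simp
  simp only [AM, Dat.am, datOf, alphaM_dat hq, ← h1]
  rw [mul_comm (qnum q (l + i - (m + j)))]
  push_cast
  ring_nf

theorem BZ_bd {q : ℝ} {s : Bool} {n μ : ℤ} {l m : ℝ} (hl : l = n + 1 / 2) (hm : m = μ + 1 / 2)
    (h1 : -(n + 1) ≤ μ) (h2 : μ ≤ n) (h : ¬(-(n + 1) ≤ μ + 1 ∧ μ + 1 ≤ n)) : BZ q s l m = 0 := by
  obtain rfl : μ = n := by omega
  simp [BZ, hl, hm, qnum_zero]

theorem BM_bd {q : ℝ} {s : Bool} {n μ : ℤ} {l m : ℝ} (hl : l = n + 1 / 2) (hm : m = μ + 1 / 2)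
    (h1 : -(n + 1) ≤ μ) (h2 : μ ≤ n) (h : ¬(-(n - 1 + 1) ≤ μ + 1 ∧ μ + 1 ≤ n - 1)) :
    BM q s l m = 0 := by
  obtain rfl | rfl : μ = n ∨ μ = n - 1 := by omega
  · simp [BM, hl, hm, qnum_zero]
  · rw [BM, show l - m - 1 = 0 by rw [hl, hm]; push_cast; ring, qnum_zero]; simp

theorem BstarZ_bd {q : ℝ} {s : Bool} {n μ : ℤ} {l m : ℝ} (hl : l = n + 1 / 2) (hm : m = μ + 1 / 2)
    (h1 : -(n + 1) ≤ μ) (h2 : μ ≤ n) (h : ¬(-(n + 1) ≤ μ + -1 ∧ μ + -1 ≤ n)) :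
    BstarZ q s l m = 0 := by
  obtain rfl : μ = -(n + 1) := by omega
  rw [BstarZ, show l + m = 0 by rw [hl, hm]; push_cast; ring, qnum_zero]; simp

theorem BstarM_bd {q : ℝ} {s : Bool} {n μ : ℤ} {l m : ℝ} (hl : l = n + 1 / 2) (hm : m = μ + 1 / 2)
    (h1 : -(n + 1) ≤ μ) (h2 : μ ≤ n) (h : ¬(-(n - 1 + 1) ≤ μ + -1 ∧ μ + -1 ≤ n - 1)) :
    BstarM q s l m = 0 := by
  obtain rfl | rfl : μ = -(n + 1) ∨ μ = -n := by omega
  · rw [BstarM, show l + m = 0 by rw [hl, hm]; push_cast; ring, qnum_zero]; simp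
  · rw [BstarM, show l + m - 1 = 0 by rw [hl, hm]; push_cast; ring, qnum_zero]; simp

theorem AM_bd {q : ℝ} {s : Bool} {n μ : ℤ} {l m : ℝ} (hl : l = n + 1 / 2) (hm : m = μ + 1 / 2)
    (h1 : -(n + 1) ≤ μ) (h2 : μ ≤ n) (h : ¬(-(n - 1 + 1) ≤ μ + 0 ∧ μ + 0 ≤ n - 1)) :
    AM q s l m = 0 := by
  obtain rfl | rfl : μ = n ∨ μ = -(n + 1) := by omega
  · simp [AM, hl, hm, qnum_zero]
  · rw [AM, show l + m = 0 by rw [hl, hm]; push_cast; ring, qnum_zero]; simp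

theorem shiftOp_mul_dat (d d' : ℤ) (P Z M P' Z' M' : Bool → ℝ → ℝ → ℝ) (s : Bool) (n μ : ℤ)
    (l m : ℝ) (p z r p' z' r' : ℤ → ℤ → ℝ)
    (hP : ∀ i j : ℤ, P s (l + i) (m + j) = p i j) (hZ : ∀ i j : ℤ, Z s (l + i) (m + j) = z i j)
    (hM : ∀ i j : ℤ, M s (l + i) (m + j) = r i j) (hP' : ∀ i j : ℤ, P' s (l + i) (m + j) = p' i j)
    (hZ' : ∀ i j : ℤ, Z' s (l + i) (m + j) = z' i j)
    (hM' : ∀ i j : ℤ, M' s (l + i) (m + j) = r' i j)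
    (hl : l = n + 1 / 2) (hm : m = μ + 1 / 2) (h1 : -(n + 1) ≤ μ) (h2 : μ ≤ n)
    (bP : -(n + 1 + 1) ≤ μ + d ∧ μ + d ≤ n + 1)
    (bZ : ¬(-(n + 1) ≤ μ + d ∧ μ + d ≤ n) → Z s l m = 0)
    (bM : ¬(-(n - 1 + 1) ≤ μ + d ∧ μ + d ≤ n - 1) → M s l m = 0) :
    (shiftOp d' P' Z' M' * shiftOp d P Z M) (ket s n μ) =
      ((p 0 0 * p' 1 d : ℝ) : ℂ) • ket s (n + 2) (μ + (d + d')) +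
      ((p 0 0 * z' 1 d + z 0 0 * p' 0 d : ℝ) : ℂ) • ket s (n + 1) (μ + (d + d')) +
      ((p 0 0 * r' 1 d + z 0 0 * z' 0 d + r 0 0 * p' (-1) d : ℝ) : ℂ) • ket s n (μ + (d + d')) +
      ((z 0 0 * r' 0 d + r 0 0 * z' (-1) d : ℝ) : ℂ) • ket s (n - 1) (μ + (d + d')) +
      ((r 0 0 * r' (-1) d : ℝ) : ℂ) • ket s (n - 2) (μ + (d + d')) := by
  rw [shiftOp_mul_ket d d' P Z M P' Z' M' s n μ l m hl hm h1 h2 (fun h => absurd bP h) bZ bM]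
  simp only [← hP, ← hZ, ← hM, ← hP', ← hZ', ← hM', Int.cast_zero, Int.cast_one, Int.cast_neg,
    add_zero, ← sub_eq_add_neg]

theorem shiftOp_dat (d : ℤ) (P Z M : Bool → ℝ → ℝ → ℝ) (s : Bool) (n μ : ℤ)
    (l m : ℝ) (p z r : ℤ → ℤ → ℝ)
    (hP : ∀ i j : ℤ, P s (l + i) (m + j) = p i j) (hZ : ∀ i j : ℤ, Z s (l + i) (m + j) = z i j)
    (hM : ∀ i j : ℤ, M s (l + i) (m + j) = r i j)
    (hl : l = n + 1 / 2) (hm : m = μ + 1 / 2) (h1 : -(n + 1) ≤ μ) (h2 : μ ≤ n) :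
    shiftOp d P Z M (ket s n μ) =
      ((p 0 0 : ℝ) : ℂ) • ket s (n + 1) (μ + d) + ((z 0 0 : ℝ) : ℂ) • ket s n (μ + d) +
      ((r 0 0 : ℝ) : ℂ) • ket s (n - 1) (μ + d) := by
  rw [shiftOp_ket' d P Z M s n μ l m hl hm h1 h2]
  simp only [← hP, ← hZ, ← hM, Int.cast_zero, add_zero]

theorem inner_ket {s s' : Bool} {n μ n' μ' : ℤ} (h : (-(n + 1) ≤ μ ∧ μ ≤ n) ∨ (-(n' + 1) ≤ μ' ∧ μ' ≤ n')) :
    inner ℂ (incl (ket s n μ)) (incl (ket s' n' μ')) = if s = s' ∧ n = n' ∧ μ = μ' then 1 else 0 := by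
  by_cases hv : -(n + 1) ≤ μ ∧ μ ≤ n
  · by_cases hv' : -(n' + 1) ≤ μ' ∧ μ' ≤ n'
    · rw [ket_valid hv, ket_valid hv', incl_single, incl_single, lp.inner_single_left,
        lp.single_apply, Pi.single_apply]
      simp [Idx.ext_iff]
    · rw [ket_eq_zero hv', map_zero, inner_zero_right, if_neg]
      rintro ⟨-, rfl, rfl⟩
      exact hv' hv
  · rw [ket_eq_zero hv, map_zero, inner_zero_left, if_neg]
    rintro ⟨-, rfl, rfl⟩
    tauto

theorem ket_induction {p : VV → Prop} (h0 : p 0) (hadd : ∀ v w, p v → p w → p (v + w))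
    (hket : ∀ (c : ℂ) (s : Bool) (n μ : ℤ), -(n + 1) ≤ μ → μ ≤ n → p (c • ket s n μ)) (v : VV) : p v := by
  induction v using Finsupp.induction_linear with
  | zero => exact h0
  | add v w hv hw => exact hadd v w hv hw
  | single i c =>
    have := hket c i.sgn i.n i.μ i.lower i.upper
    rw [ket_valid ⟨i.lower, i.upper⟩, Finsupp.smul_single, smul_eq_mul, mul_one] at this
    exact this

theorem shiftOp_adjoint (d : ℤ) (P Z M P' Z' M' : Bool → ℝ → ℝ → ℝ)
    (hP : ∀ s l m, P s l m = M' s (l + 1) (m + d)) (hZ : ∀ s l m, Z s l m = Z' s l (m + d))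
    (hM : ∀ s l m, M s l m = P' s (l - 1) (m + d)) (v w : VV) :
    inner ℂ (incl (shiftOp d P Z M v)) (incl w) =
      inner ℂ (incl v) (incl (shiftOp (-d) P' Z' M' w)) := by
  induction v using ket_induction with
  | h0 => simp
  | hadd v v' h h' => simp only [map_add, inner_add_left, h, h']
  | hket c s n μ h1 h2 =>
  induction w using ket_induction with
  | h0 => simp
  | hadd v v' h h' => simp only [map_add, inner_add_right, h, h']
  | hket c' s' n' μ' h1' h2' =>
  simp only [map_smul, inner_smul_left, inner_smul_right]
  congr 2
  rw [shiftOp_ket' d P Z M s n μ _ _ rfl rfl h1 h2,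
    shiftOp_ket' (-d) P' Z' M' s' n' μ' _ _ rfl rfl h1' h2']
  simp only [map_add, map_smul, inner_add_left, inner_add_right, inner_smul_left, inner_smul_right,
    Complex.conj_ofReal, inner_ket (Or.inl (And.intro h1 h2)), inner_ket (Or.inr (And.intro h1' h2'))]
  by_cases hs : s = s'
  swap
  · simp [hs]
  by_cases hμ : μ' = μ + d
  swap
  · have : ¬μ + d = μ' := fun h => hμ h.symm
    have h3 : ¬μ = μ' + -d := fun h => hμ (by omega)
    simp [this, h3]
  subst hs hμ
  have hc : ∀ a b : ℝ, a + 2⁻¹ + b = a + b + 2⁻¹ := fun a b => by ring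
  rcases eq_or_ne n' (n + 1) with rfl | hn1
  · have : ¬n = n + 1 + 1 := by omega
    have : ¬n - 1 = n + 1 := by omega
    simp [*, hc]
  rcases eq_or_ne n' n with rfl | hn2
  · have : ¬n' = n' - 1 := by omega
    simp [this, hZ, hc]
  rcases eq_or_ne n' (n - 1) with rfl | hn3
  · have : ¬n = n - 1 - 1 := by omega
    have : ¬n + 1 = n - 1 := by omega
    have e5 : ¬n = n - 1 := by omega
    have hc' : ∀ a : ℝ, a + 2⁻¹ - 1 = a - 1 + 2⁻¹ := fun a => by ring
    simp [*, hc, hc']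
  · have e1 : ¬n + 1 = n' := by omega
    have e2 : ¬n = n' := by omega
    have e3 : ¬n - 1 = n' := by omega
    have e4 : ¬n = n' + 1 := by omega
    have e5 : ¬n = n' - 1 := by omega
    simp [e1, e2, e3, e4, e5]

theorem B_adjoint (q : ℝ) (v w : VV) :
    inner ℂ (incl (sphereGenOp q .B v)) (incl w) =
      inner ℂ (incl v) (incl (sphereGenOp q .Bstar w)) := by
  apply shiftOp_adjoint 1
  · intro s l m
    simp only [BP, BstarM, Int.cast_one]
    rw [mul_comm (qnum q (l + 1 + (m + 1)))]
    ring_nf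
  · intro s l m
    simp only [BZ, BstarZ, Int.cast_one]
    ring_nf
  · intro s l m
    simp only [BM, BstarP, Int.cast_one]
    ring_nf

theorem A_adjoint {q : ℝ} (hq : 0 < q) (v w : VV) :
    inner ℂ (incl (sphereGenOp q .A v)) (incl w) =
      inner ℂ (incl v) (incl (sphereGenOp q .A w)) := by
  have key : ∀ s l m, AP q s l m = AM q s (l + 1) (m + 0) := by
    intro s l m
    have : q ^ (m - (l + 1) - 1 / 2) * q ^ (2 * (l + 1)) = q ^ (m + l + 1 / 2) := by
      rw [← Real.rpow_add hq]
      congr 1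
      ring
    simp only [AP, AM, alphaM, ← this]
    rw [mul_comm (qnum q (l - m + 1))]
    ring_nf
  refine shiftOp_adjoint 0 (AP q) (AZ q) (AM q) (AP q) (AZ q) (AM q) ?_ ?_ ?_ v w
  · simpa using key
  · simp
  · intro s l m
    have := key s (l - 1) m
    rw [sub_add_cancel, add_zero] at this
    simp [this]

theorem incl_apply (v : VV) (i : Idx) : incl v i = v i := by
  induction v using Finsupp.induction_linear with
  | zero => simp
  | add v w hv hw => simp [hv, hw]
  | single j c => rw [incl_single, lp.single_apply, Pi.single_apply, Finsupp.single_apply]; simp [eq_comm]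

theorem incl_injective : Function.Injective incl := fun v w h => by
  ext i
  rw [← incl_apply, ← incl_apply, h]

theorem incl_dense : DenseRange incl := by
  intro x
  have hs := lp.hasSum_single (E := fun _ : Idx => ℂ) (p := 2) (by norm_num) x
  refine mem_closure_of_tendsto hs (Filter.Eventually.of_forall fun s => ?_)
  refine ⟨∑ i ∈ s, Finsupp.single i (x i), ?_⟩
  rw [map_sum]
  exact Finset.sum_congr rfl fun i _ => incl_single i _

theorem A_B_rel {q : ℝ} (hq : 0 < q) : sphereGenOp q .A * sphereGenOp q .B =
    ((q ^ 2 : ℝ) : ℂ) • (sphereGenOp q .B * sphereGenOp q .A) := by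
  have h4 : √q ^ 4 = q ^ 2 := by
    rw [show √q ^ 4 = (√q ^ 2) ^ 2 by ring, Real.sq_sqrt hq.le]
  apply end_ext
  intro s n μ h1 h2
  obtain ⟨l, hl⟩ : ∃ l : ℝ, l = n + 1 / 2 := ⟨_, rfl⟩
  obtain ⟨m, hm⟩ : ∃ m : ℝ, m = μ + 1 / 2 := ⟨_, rfl⟩
  have H := datOf_pos hq s hl hm h1 h2
  have G := datOf_good hq s hl hm h1 h2
  have hh : 0 < (datOf q s l m).h := Real.sqrt_pos.2 hq
  have h4' : (datOf q s l m).h ^ 4 = q ^ 2 := h4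
  rw [LinearMap.smul_apply]
  simp only [sphereGenOp]
  rw [shiftOp_mul_dat _ _ _ _ _ _ _ _ s n μ l m _ _ _ _ _ _ (BP_dat hq s l m) (BZ_dat hq s l m)
      (BM_dat hq s l m) (AP_dat hq s l m) (AZ_dat hq s l m) (AM_dat hq s l m) hl hm h1 h2 (by omega)
      (BZ_bd hl hm h1 h2) (BM_bd hl hm h1 h2),
    shiftOp_mul_dat _ _ _ _ _ _ _ _ s n μ l m _ _ _ _ _ _ (AP_dat hq s l m) (AZ_dat hq s l m)
      (AM_dat hq s l m) (BP_dat hq s l m) (BZ_dat hq s l m) (BM_dat hq s l m) hl hm h1 h2 (by omega)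
      (fun h => absurd ⟨by omega, by omega⟩ h) (AM_bd hl hm h1 h2),
    Dat.AB_p2 H hh, Dat.AB_p1 H G, Dat.AB_z H G, Dat.AB_m1 H G, Dat.AB_m2 H hh, h4']
  simp only [add_zero, zero_add]
  push_cast
  module

theorem A_Bstar_rel {q : ℝ} (hq : 0 < q) : sphereGenOp q .A * sphereGenOp q .Bstar =
    ((q ^ 2 : ℝ) : ℂ)⁻¹ • (sphereGenOp q .Bstar * sphereGenOp q .A) := by
  have hq2 : ((q ^ 2 : ℝ) : ℂ) ≠ 0 := by exact_mod_cast (pow_pos hq 2).ne'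
  rw [eq_inv_smul_iff₀ hq2]
  ext1 i
  apply LinearMap.ext_ring
  apply incl_injective
  refine ext_inner_left ℂ fun x => ?_
  refine incl_dense.induction_on x (isClosed_eq (by fun_prop) (by fun_prop)) fun v => ?_
  have := congrArg (fun T => inner ℂ (incl (T v)) (incl (Finsupp.single i 1))) (A_B_rel hq)
  simp only [LinearMap.smul_apply, Module.End.mul_apply, map_smul, inner_smul_left, A_adjoint hq,
    B_adjoint, Complex.conj_ofReal] at this
  simp only [LinearMap.comp_apply, LinearMap.smul_apply, Module.End.mul_apply, map_smul,
    inner_smul_right, Finsupp.lsingle_apply]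
  exact this.symm

theorem B_Bstar_rel {q : ℝ} (hq : 0 < q) : sphereGenOp q .B * sphereGenOp q .Bstar =
    ((q ^ 2 : ℝ) : ℂ)⁻¹ • (sphereGenOp q .A * (1 - sphereGenOp q .A)) := by
  have h4 : √q ^ 4 = q ^ 2 := by
    rw [show √q ^ 4 = (√q ^ 2) ^ 2 by ring, Real.sq_sqrt hq.le]
  apply end_ext
  intro s n μ h1 h2
  obtain ⟨l, hl⟩ : ∃ l : ℝ, l = n + 1 / 2 := ⟨_, rfl⟩
  obtain ⟨m, hm⟩ : ∃ m : ℝ, m = μ + 1 / 2 := ⟨_, rfl⟩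
  have H := datOf_pos hq s hl hm h1 h2
  have G := datOf_good hq s hl hm h1 h2
  have hh : 0 < (datOf q s l m).h := Real.sqrt_pos.2 hq
  have h4' : (datOf q s l m).h ^ 4 = q ^ 2 := h4
  have e : ∀ T : Module.End ℂ VV, T * (1 - T) = T - T * T := fun T => by
    ext1; simp [LinearMap.ext_iff]
  rw [e, LinearMap.smul_apply, LinearMap.sub_apply]
  simp only [sphereGenOp]
  rw [shiftOp_mul_dat _ _ _ _ _ _ _ _ s n μ l m _ _ _ _ _ _ (BstarP_dat hq s l m)
      (BstarZ_dat hq s l m) (BstarM_dat hq s l m) (BP_dat hq s l m) (BZ_dat hq s l m)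
      (BM_dat hq s l m) hl hm h1 h2 (by omega) (BstarZ_bd hl hm h1 h2) (BstarM_bd hl hm h1 h2),
    shiftOp_mul_dat _ _ _ _ _ _ _ _ s n μ l m _ _ _ _ _ _ (AP_dat hq s l m) (AZ_dat hq s l m)
      (AM_dat hq s l m) (AP_dat hq s l m) (AZ_dat hq s l m) (AM_dat hq s l m) hl hm h1 h2 (by omega)
      (fun h => absurd ⟨by omega, by omega⟩ h) (AM_bd hl hm h1 h2),
    shiftOp_dat _ _ _ _ s n μ l m _ _ _ (AP_dat hq s l m) (AZ_dat hq s l m)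
      (AM_dat hq s l m) hl hm h1 h2,
    Dat.BBs_p2 H hh, Dat.BBs_p1 H G, Dat.BBs_z H G, Dat.BBs_m1 H G, Dat.BBs_m2 H hh, h4']
  simp only [add_zero, neg_add_cancel]
  push_cast
  module

theorem Bstar_B_rel {q : ℝ} (hq : 0 < q) : sphereGenOp q .Bstar * sphereGenOp q .B =
    sphereGenOp q .A * (1 - ((q ^ 2 : ℝ) : ℂ) • sphereGenOp q .A) := by
  have h4 : √q ^ 4 = q ^ 2 := by
    rw [show √q ^ 4 = (√q ^ 2) ^ 2 by ring, Real.sq_sqrt hq.le]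
  apply end_ext
  intro s n μ h1 h2
  obtain ⟨l, hl⟩ : ∃ l : ℝ, l = n + 1 / 2 := ⟨_, rfl⟩
  obtain ⟨m, hm⟩ : ∃ m : ℝ, m = μ + 1 / 2 := ⟨_, rfl⟩
  have H := datOf_pos hq s hl hm h1 h2
  have G := datOf_good hq s hl hm h1 h2
  have hh : 0 < (datOf q s l m).h := Real.sqrt_pos.2 hq
  have h4' : (datOf q s l m).h ^ 4 = q ^ 2 := h4
  have e : ∀ (c : ℂ) (T : Module.End ℂ VV), T * (1 - c • T) = T - c • (T * T) := fun c T => by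
    ext1; simp [LinearMap.ext_iff]
  rw [e, LinearMap.sub_apply, LinearMap.smul_apply]
  simp only [sphereGenOp]
  rw [shiftOp_mul_dat _ _ _ _ _ _ _ _ s n μ l m _ _ _ _ _ _ (BP_dat hq s l m)
      (BZ_dat hq s l m) (BM_dat hq s l m) (BstarP_dat hq s l m) (BstarZ_dat hq s l m)
      (BstarM_dat hq s l m) hl hm h1 h2 (by omega) (BZ_bd hl hm h1 h2) (BM_bd hl hm h1 h2),
    shiftOp_mul_dat _ _ _ _ _ _ _ _ s n μ l m _ _ _ _ _ _ (AP_dat hq s l m) (AZ_dat hq s l m)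
      (AM_dat hq s l m) (AP_dat hq s l m) (AZ_dat hq s l m) (AM_dat hq s l m) hl hm h1 h2 (by omega)
      (fun h => absurd ⟨by omega, by omega⟩ h) (AM_bd hl hm h1 h2),
    shiftOp_dat _ _ _ _ s n μ l m _ _ _ (AP_dat hq s l m) (AZ_dat hq s l m)
      (AM_dat hq s l m) hl hm h1 h2,
    Dat.BsB_p2 H hh, Dat.BsB_p1 H G, Dat.BsB_z H G, Dat.BsB_m1 H G, Dat.BsB_m2 H hh, h4']
  simp only [add_zero, add_neg_cancel]
  push_cast
  module

theorem sphere_relations {q : ℝ} (hq : 0 < q) ⦃x y : FreeAlgebra ℂ SphereGen⦄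
    (h : SphereRel q x y) :
    FreeAlgebra.lift ℂ (sphereGenOp q) x = FreeAlgebra.lift ℂ (sphereGenOp q) y := by
  cases h <;> simp only [map_mul, map_sub, map_smul, map_one, FreeAlgebra.lift_ι_apply]
  · exact A_B_rel hq
  · exact A_Bstar_rel hq
  · exact B_Bstar_rel hq
  · exact Bstar_B_rel hq

/-- The representation `π = π_+ ⊕ π_-` of `A(S²_q)` on `V ⊕ V`. -/
noncomputable def piV (q : ℝ) (hq : 0 < q) : Sphere q →ₐ[ℂ] Module.End ℂ VV :=
  RingQuot.liftAlgHom ℂ ⟨FreeAlgebra.lift ℂ (sphereGenOp q), sphere_relations hq⟩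

theorem norm_A_le {q : ℝ} (hq : 0 < q) (v : VV) :
    ‖incl (sphereGenOp q .A v)‖ ^ 2 ≤ RCLike.re (inner ℂ (incl v) (incl (sphereGenOp q .A v))) ∧
      ‖incl (sphereGenOp q .A v)‖ ≤ ‖incl v‖ := by
  have h := congrArg (fun T => RCLike.re (inner ℂ (incl v) (incl (T v)))) (B_Bstar_rel hq)
  have e1 : RCLike.re (inner ℂ (incl v) (incl (sphereGenOp q .B (sphereGenOp q .Bstar v)))) =
      ‖incl (sphereGenOp q .Bstar v)‖ ^ 2 := by
    rw [← inner_conj_symm, B_adjoint, inner_conj_symm, inner_self_eq_norm_sq]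
  have e2 : RCLike.re (inner ℂ (incl v) (incl (sphereGenOp q .A (sphereGenOp q .A v)))) =
      ‖incl (sphereGenOp q .A v)‖ ^ 2 := by
    rw [← A_adjoint hq, inner_self_eq_norm_sq]
  simp only [LinearMap.smul_apply, Module.End.mul_apply, LinearMap.sub_apply, Module.End.one_apply,
    map_sub, map_smul, inner_smul_right, inner_sub_right] at h
  rw [e1, ← Complex.ofReal_inv, ← RCLike.ofReal_eq_complex_ofReal, RCLike.re_ofReal_mul, map_sub, e2] at h
  have hq2 : 0 < (q ^ 2)⁻¹ := by positivity
  have h1 : ‖incl (sphereGenOp q .A v)‖ ^ 2 ≤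
      RCLike.re (inner ℂ (incl v) (incl (sphereGenOp q .A v))) := by
    have := sq_nonneg ‖incl (sphereGenOp q .Bstar v)‖
    rw [h] at this
    have := nonneg_of_mul_nonneg_right this hq2
    linarith
  refine ⟨h1, ?_⟩
  have h2 := h1.trans (re_inner_le_norm (𝕜 := ℂ) (incl v) (incl (sphereGenOp q .A v)))
  by_contra! h3
  have := norm_nonneg (incl v)
  nlinarith

theorem norm_B_le {q : ℝ} (hq : 0 < q) (v : VV) : ‖incl (sphereGenOp q .B v)‖ ≤ ‖incl v‖ := by
  have h := congrArg (fun T => RCLike.re (inner ℂ (incl v) (incl (T v)))) (Bstar_B_rel hq)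
  simp only [LinearMap.smul_apply, Module.End.mul_apply, LinearMap.sub_apply, Module.End.one_apply,
    map_sub, map_smul, inner_smul_right, inner_sub_right] at h
  rw [← B_adjoint, inner_self_eq_norm_sq, ← RCLike.ofReal_eq_complex_ofReal,
    RCLike.re_ofReal_mul, ← A_adjoint hq v (sphereGenOp q .A v), inner_self_eq_norm_sq] at h
  have h1 : 0 ≤ q ^ 2 * ‖incl (sphereGenOp q .A v)‖ ^ 2 := mul_nonneg (sq_nonneg _) (sq_nonneg _)
  have h2 := re_inner_le_norm (𝕜 := ℂ) (incl v) (incl (sphereGenOp q .A v))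
  have h3 := (norm_A_le hq v).2
  have h4 := norm_nonneg (incl v)
  have h5 := norm_nonneg (incl (sphereGenOp q .B v))
  generalize ‖incl v‖ = a at *
  generalize ‖incl (sphereGenOp q .A v)‖ = b at *
  generalize ‖incl (sphereGenOp q .B v)‖ = c at *
  have h6 : a * b ≤ a * a := mul_le_mul_of_nonneg_left h3 h4
  nlinarith

theorem norm_Bstar_le {q : ℝ} (hq : 0 < q) (v : VV) :
    ‖incl (sphereGenOp q .Bstar v)‖ ≤ ‖incl v‖ := by
  have h1 := inner_self_eq_norm_sq (𝕜 := ℂ) (incl (sphereGenOp q .Bstar v))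
  rw [← B_adjoint] at h1
  have h2 := re_inner_le_norm (𝕜 := ℂ) (incl (sphereGenOp q .B (sphereGenOp q .Bstar v))) (incl v)
  have h3 := norm_B_le hq (sphereGenOp q .Bstar v)
  have h4 := norm_nonneg (incl (sphereGenOp q .Bstar v))
  have h5 := norm_nonneg (incl v)
  by_contra! h
  nlinarith

/-- Each element of `A(S²_q)` acts on `V ⊕ V` by an operator that is bounded for the norm of `ℋ`. -/
theorem piV_bounded {q : ℝ} (hq : 0 < q) (α : Sphere q) :
    ∃ C : ℝ, ∀ v : VV, ‖(incl ∘ₗ piV q hq α) v‖ ≤ C * ‖incl v‖ := by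
  obtain ⟨x, rfl⟩ := RingQuot.mkAlgHom_surjective ℂ _ α
  simp only [piV, RingQuot.liftAlgHom_mkAlgHom_apply, LinearMap.comp_apply]
  induction x using FreeAlgebra.induction with
  | grade0 r =>
    refine ⟨‖r‖, fun v => ?_⟩
    rw [AlgHom.commutes, Module.algebraMap_end_apply, map_smul, norm_smul]
  | grade1 x =>
    simp only [FreeAlgebra.lift_ι_apply]
    cases x with
    | A => exact ⟨1, fun v => by simpa using (norm_A_le hq v).2⟩
    | B => exact ⟨1, fun v => by simpa using norm_B_le hq v⟩
    | Bstar => exact ⟨1, fun v => by simpa using norm_Bstar_le hq v⟩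
  | mul a b ha hb =>
    obtain ⟨C, hC⟩ := ha
    obtain ⟨C', hC'⟩ := hb
    refine ⟨|C| * C', fun v => ?_⟩
    rw [map_mul, Module.End.mul_apply]
    calc _ ≤ C * ‖incl (FreeAlgebra.lift ℂ (sphereGenOp q) b v)‖ := hC _
      _ ≤ |C| * ‖incl (FreeAlgebra.lift ℂ (sphereGenOp q) b v)‖ := by gcongr; exact le_abs_self C
      _ ≤ |C| * (C' * ‖incl v‖) := by gcongr; exact hC' v
      _ = _ := by ring
  | add a b ha hb =>
    obtain ⟨C, hC⟩ := ha
    obtain ⟨C', hC'⟩ := hb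
    refine ⟨C + C', fun v => ?_⟩
    rw [map_add, LinearMap.add_apply, map_add, add_mul]
    exact (norm_add_le _ _).trans (add_le_add (hC v) (hC' v))

/-- The bounded representation `π` of `A(S²_q)` on `ℋ`, by continuous extension from `V ⊕ V`. -/
noncomputable def piH (q : ℝ) (hq : 0 < q) (α : Sphere q) : HH →L[ℂ] HH :=
  (incl ∘ₗ piV q hq α).extendOfNorm incl

theorem piH_incl {q : ℝ} (hq : 0 < q) (α : Sphere q) (v : VV) :
    piH q hq α (incl v) = incl (piV q hq α v) :=
  LinearMap.extendOfNorm_eq incl_dense (piV_bounded hq α) v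

/-! ### Grading, reality operator, Dirac operators -/

/-- The grading `γ = diag(1, -1)`. -/
noncomputable def gamma : HH →ₗ[ℂ] HH where
  toFun x := ⟨fun i => (if i.sgn then 1 else -1 : ℂ) * x i, by
    have h := (memℓp_gen_iff (p := 2) (by norm_num)).1 (lp.memℓp x)
    refine (memℓp_gen_iff (p := 2) (by norm_num)).2 (h.congr fun i => ?_)
    rw [norm_mul]
    split_ifs <;> simp⟩
  map_add' x y := by ext i; exact mul_add _ _ _
  map_smul' c x := by ext i; exact mul_left_comm _ _ _

/-- The antilinear reality operator, with domain `V ⊕ V` (it is unbounded unless `p = 1`):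
`J |l,m⟩_± = i^{2m} p^m |l,-m⟩_∓`. -/
noncomputable def J (p : ℝ) : VV →ₛₗ[starRingEnd ℂ] VV where
  toFun v := v.sum fun i c =>
    (starRingEnd ℂ c * (Complex.I ^ (2 * i.μ + 1) * ((p ^ i.m : ℝ) : ℂ))) •
      ket (!i.sgn) i.n (-i.μ - 1)
  map_add' v w := by
    refine Finsupp.sum_add_index' (fun i => ?_) fun i c c' => ?_
    · simp
    · rw [map_add, add_mul, add_smul]
  map_smul' c v := by
    rw [Finsupp.sum_smul_index' (fun i => by simp), Finsupp.smul_sum]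
    simp only [smul_eq_mul, map_mul, smul_smul, mul_assoc]

/-- `T S ⊆ S̄ T` on `V ⊕ V`: for an operator `S` with domain `V ⊕ V` and a map `T` from `V ⊕ V`
to `ℋ`, every `T v` lies in the domain of the closure `S̄` of `S` and `S̄ (T v) = T (S v)`;
that is, `(T v, T (S v))` lies in the closure of the graph of `S`. -/
def Intertwines (S : VV → VV) (T : VV → HH) : Prop :=
  ∀ v : VV, (T v, T (S v)) ∈ closure (Set.range fun w : VV => (incl w, incl (S w)))

/-- `D` has compact resolvent: `(D - c)⁻¹` exists as a compact operator for some `c ∈ ℂ`. -/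
def HasCompactResolvent (D : HH →ₗ.[ℂ] HH) : Prop :=
  ∃ (c : ℂ) (R : HH →L[ℂ] HH), IsCompactOperator R ∧
    (∀ x : HH, ∃ h : R x ∈ D.domain, D ⟨R x, h⟩ - c • R x = x) ∧
    ∀ x : D.domain, R (D x - c • (x : HH)) = x

/-- The conditions imposed on the Dirac operator `D`. -/
structure IsDirac (q : ℝ) (hq : 0 < q) (p : ℝ) (D : HH →ₗ.[ℂ] HH) : Prop where
  selfAdjoint : IsSelfAdjoint D
  compactResolvent : HasCompactResolvent D
  domain : ∀ v : VV, incl v ∈ D.domain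
  /-- `D h = h D` for all `h ∈ U_q(su(2))`. -/
  equivariant : ∀ h : Uq q, Intertwines (rho q hq h) fun v => D ⟨incl v, domain v⟩
  /-- `D γ = - γ D`. -/
  odd : ∀ x : D.domain, ∃ h : gamma x ∈ D.domain, D ⟨gamma x, h⟩ = -gamma (D x)
  /-- The commutators `[D, π(α)]` are defined on the domain of `D` and bounded. -/
  boundedCommutator : ∀ α : Sphere q, ∃ C : ℝ, ∀ x : D.domain,
    ∃ h : piH q hq α x ∈ D.domain, ‖D ⟨piH q hq α x, h⟩ - piH q hq α (D x)‖ ≤ C * ‖(x : HH)‖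
  /-- `D J = J D`. -/
  real : Intertwines (J p) fun v => D ⟨incl v, domain v⟩
  /-- `[[D, π(α)], J π(β) J] = 0`. -/
  firstOrder : ∀ α β : Sphere q, Intertwines (fun v => J p (piV q hq β (J p v))) fun v =>
    D ⟨incl (piV q hq α v), domain _⟩ - piH q hq α (D ⟨incl v, domain v⟩)

/-- The matrix entry of `diracOp q z` at the row `|l,m⟩_±` and the column `|l,m⟩_∓`. -/
noncomputable def diracEntry (q : ℝ) (z : ℂ) (i : Idx) : ℂ :=
  (if i.sgn then starRingEnd ℂ z else z) * (qnum q (i.l + 1 / 2) : ℂ)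

/-- The off-diagonal operator with blocks `z D_+` (from the first copy of `ℋ_{1/2}` to the second)
and `z̄ D_-` (from the second to the first), where `D_± |l,m⟩_± = [l + 1/2] |l,m⟩_∓`, on its
maximal domain, the `ψ = ∑ c_{l,m,σ} |l,m⟩_σ` with `∑ |z|² [l + 1/2]² |c_{l,m,σ}|² < ∞`. -/
noncomputable def diracOp (q : ℝ) (z : ℂ) : HH →ₗ.[ℂ] HH where
  domain :=
    { carrier := {ψ | Memℓp (fun i : Idx => diracEntry q z i * ψ i.swap) 2}
      zero_mem' := by
        have e : (fun i : Idx => diracEntry q z i * (0 : HH) i.swap) = 0 :=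
          funext fun i => mul_zero _
        rw [Set.mem_ofPred_eq, e]
        exact zero_memℓp
      add_mem' := fun {x y} hx hy => by
        have e : (fun i : Idx => diracEntry q z i * (x + y : HH) i.swap) =
            (fun i => diracEntry q z i * x i.swap) + fun i => diracEntry q z i * y i.swap :=
          funext fun i => mul_add _ _ _
        rw [Set.mem_ofPred_eq, e]
        exact Memℓp.add hx hy
      smul_mem' := fun c x hx => by
        have e : (fun i : Idx => diracEntry q z i * (c • x : HH) i.swap) =
            c • fun i => diracEntry q z i * x i.swap :=
          funext fun i => mul_left_comm _ _ _
        rw [Set.mem_ofPred_eq, e]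
        exact Memℓp.const_smul hx c }
  toFun :=
    { toFun := fun ψ => ⟨fun i => diracEntry q z i * (ψ : HH) i.swap, ψ.2⟩
      map_add' := fun x y => by ext i; exact mul_add _ _ _
      map_smul' := fun c x => by ext i; exact mul_left_comm _ _ _ }

end Podles

/-!
The operator of the second statement is written in the basis `|l,m⟩_±`, with `l = n + 1/2` and
`m = μ + 1/2`. Everything rests on the matrix elements of the generators of `A(S²_q)`, which are "bands":
they change `n` by at most `1`. After a rescaling of the basis (`gen_rescale`) their coefficients become
rational functions of `q`, `q^n`, `q^μ`, or of `n`, `μ` if `q = 1`, and conjugation by `J` acts on the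
coefficients by the reflection `m ↦ -m` and the exchange of the two copies (`conjJ_op`). In this way, the
conditions which involve `J` become identities between rational functions.

*Uniqueness.* The vector `|l,m⟩_s` is a joint eigenvector of `f e` and `e f`, whose eigenvalues separate the
labels `(l, m)` (`labels_eq_of_casimir`). Hence an equivariant odd operator maps `|l,m⟩_s` to a multiple of
`|l,m⟩_{-s}`; commutation with `f` makes the factor independent of `m`, and commutation with `J` makes the
factors for the two signs complex conjugate to each other (`exists_onV_eq_diracV`). One component of the
first-order condition for the pair `(B, B*)` says that the factors `δ_n` satisfy
`[n+1] δ_{n+1} = [n+2] δ_n` (`recursion_component`), so that `δ_n = z [n+1] = z [l + 1/2]`. A self-adjoint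
operator with these values on `V ⊕ V` is contained in the maximal one, `diracOp q z`, and two self-adjoint
operators one of which contains the other coincide (`eq_diracOp_of_selfAdjoint`). Finally `z ≠ 0`, because
`0` has no compact resolvent on an infinite-dimensional space.

*Existence.* The operator `diracOp q z` is self-adjoint (`diracOp_selfAdjoint`), and its inverse is the norm
limit of operators of finite rank since `[n+1] ≥ n+1` for `q ≤ 1` (`diracOp_compactResolvent`). The
first-order condition for generators amounts to the identities `intertwine_quantum` and
`intertwine_classical`; it passes to the generated algebras (`firstOrder_of_gens`). For `q ≠ 1` it suffices to
treat `B` and `B*`, as `A` is a combination of `B B*` and `B* B` (`A_mem`). The commutators with the generators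
have bounded coefficients because `[n+2] - q [n+1] = q^{-n-1}` and `q [n+2] - [n+1] = q^{n+2}`, while `α⁺`
differs in `π_+` and `π_-` by exactly this factor `q` (`kap_up`, `comm_gen_bounded`).
-/

namespace Podles

open SphereGen

/-! ### Coefficients of band operators -/

/-- Coefficients of a "band" operator on `V ⊕ V`: it shifts `μ` by `d`, and `n` by `1`, `0`, `-1`
with the coefficients `P`, `Z`, `M`, functions of the integral labels `(s, n, μ)`. -/
structure Band where
  d : ℤ
  P : Bool → ℤ → ℤ → ℝ
  Z : Bool → ℤ → ℤ → ℝ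
  M : Bool → ℤ → ℤ → ℝ

namespace Band

/-- Reflection `μ + 1/2 ↦ -(μ + 1/2)` together with the exchange of the two copies. -/
def refl (a : Band) : Band where
  d := -a.d
  P s n μ := a.P (!s) n (-μ - 1)
  Z s n μ := a.Z (!s) n (-μ - 1)
  M s n μ := a.M (!s) n (-μ - 1)

/-- Exchange of the two copies. -/
def exch (a : Band) : Band where
  d := a.d
  P s := a.P (!s)
  Z s := a.Z (!s)
  M s := a.M (!s)

/-- The commutator with the operator `|l,m⟩_s ↦ δ(n) |l,m⟩_{-s}`, followed by the exchange of the two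
copies. -/
def comm (δ : ℤ → ℝ) (a : Band) : Band where
  d := a.d
  P s n μ := δ (n + 1) * a.P s n μ - a.P (!s) n μ * δ n
  Z s n μ := δ n * (a.Z s n μ - a.Z (!s) n μ)
  M s n μ := δ (n - 1) * a.M s n μ - a.M (!s) n μ * δ n

/-- The coefficientwise form of `a b = b' a`. -/
structure Intertwine (a b b' : Band) (s : Bool) (n μ : ℤ) : Prop where
  p2 : b.P s n μ * a.P s (n + 1) (μ + b.d) = a.P s n μ * b'.P s (n + 1) (μ + a.d)
  p1 : b.P s n μ * a.Z s (n + 1) (μ + b.d) + b.Z s n μ * a.P s n (μ + b.d) =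
    a.P s n μ * b'.Z s (n + 1) (μ + a.d) + a.Z s n μ * b'.P s n (μ + a.d)
  z : b.P s n μ * a.M s (n + 1) (μ + b.d) + b.Z s n μ * a.Z s n (μ + b.d) +
      b.M s n μ * a.P s (n - 1) (μ + b.d) =
    a.P s n μ * b'.M s (n + 1) (μ + a.d) + a.Z s n μ * b'.Z s n (μ + a.d) +
      a.M s n μ * b'.P s (n - 1) (μ + a.d)
  m1 : b.Z s n μ * a.M s n (μ + b.d) + b.M s n μ * a.Z s (n - 1) (μ + b.d) =
    a.Z s n μ * b'.M s n (μ + a.d) + a.M s n μ * b'.Z s (n - 1) (μ + a.d)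
  m2 : b.M s n μ * a.M s (n - 1) (μ + b.d) = a.M s n μ * b'.M s (n - 1) (μ + a.d)

end Band

/-! ### q-integers and the rational model of the generators -/

/-- The q-integers `[k]`. -/
noncomputable def qn (q : ℝ) (k : ℤ) : ℝ := qnum q k

/-- The ratio `q^{0}` or `q^{1}` of `α⁺` in `π_±` to `α⁺` in `π_+`. -/
noncomputable def kap (q : ℝ) (s : Bool) : ℝ := if s then 1 else q

/-- `√q α⁰_{n+1/2}`. -/
noncomputable def A0 (q : ℝ) (s : Bool) (n : ℤ) : ℝ :=
  ((q - q⁻¹) * qn q n * qn q (n + 2) + if s then q else -q⁻¹) / (qn q (2 * n + 1) * qn q (2 * n + 3))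

/-- `q (α⁺_{n-1/2})²` for `π_+`. -/
noncomputable def R (q : ℝ) (n : ℤ) : ℝ :=
  q ^ (-2 * n - 2) / (qn q (2 * n + 1) ^ 2 * (q ^ (n + 1) + q ^ (-n - 1)) * (q ^ n + q ^ (-n)))

/-- The coefficients of the generators of `A(S²_q)` with respect to the rescaled vectors
`w(n, μ) |l,m⟩` (see `wt`), for which all square roots disappear: `R` is the only trace of the
products `α⁺ α⁻`. -/
noncomputable def rat (q : ℝ) : SphereGen → Band
  | .B =>
    { d := 1
      P := fun s n μ => q ^ μ * kap q s
      Z := fun s n μ => q ^ μ * qn q (n - μ) * A0 q s n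
      M := fun s n μ => -(q ^ μ * q ^ (2 * n + 1) * kap q s * qn q (n - μ) * qn q (n - μ - 1) * R q n) }
  | .Bstar =>
    { d := -1
      P := fun s n μ => -(q ^ μ * q ^ (2 * n + 2) * kap q s)
      Z := fun s n μ => q ^ (μ - 1) * qn q (n + μ + 1) * A0 q s n
      M := fun s n μ => q ^ (μ - 1) * kap q s * qn q (n + μ + 1) * qn q (n + μ) * R q n }
  | .A =>
    { d := 0
      P := fun s n μ => -(q ^ μ * q ^ (n + 1) * kap q s)
      Z := fun s n μ => 1 / (q * (1 + q ^ 2)) * (qn q (n - μ + 1) * qn q (n + μ + 1) -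
        q ^ 2 * qn q (n - μ) * qn q (n + μ + 2)) * A0 q s n + 1 / (1 + q ^ 2)
      M := fun s n μ => -(q ^ μ * q ^ n * kap q s * qn q (n - μ) * qn q (n + μ + 1) * R q n) }

theorem qn_eq {q : ℝ} (hq : 0 < q) (h1 : q ≠ 1) {k : ℤ} {x : ℝ} (h : q ^ k = x) :
    qn q k = (x ^ 2 - 1) / x / ((q ^ 2 - 1) / q) := by
  have hx : 0 < x := h ▸ zpow_pos hq k
  rw [qn, qnum_eq hq h1 (y := x) (by rw [Real.rpow_intCast, h])]
  congr 1
  · field_simp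
  · field_simp

theorem qn_one {q : ℝ} (hq : 0 < q) : qn q 1 = 1 := by
  rw [qn, Int.cast_one]
  by_cases hq1 : q = 1
  · rw [hq1, qnum_one]
  · rw [qnum_eq hq hq1 (Real.rpow_one q), div_self (qdiff_ne hq hq1)]

theorem qn_classical (k : ℤ) : qn 1 k = k := qnum_one

theorem zpow_sq_ne {q : ℝ} (hq : 0 < q) (h1 : q ≠ 1) {k : ℤ} (hk : k ≠ 0) : (q ^ k) ^ 2 - 1 ≠ 0 := by
  intro h
  have h2 : (q ^ k) ^ 2 = 1 := by linarith
  have h3 : q ^ k = 1 := (pow_eq_one_iff_of_nonneg (zpow_pos hq k).le two_ne_zero).1 h2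
  exact hk ((zpow_eq_one_iff_right₀ hq.le h1).1 h3)

/-- `δ = q^{4n+2} - 1` as a function of `x = q^n`. -/
def del (q x : ℝ) : ℝ := x ^ 4 * q ^ 2 - 1

theorem del_ne {q : ℝ} (hq : 0 < q) (h1 : q ≠ 1) (n : ℤ) {x : ℝ} (h : q ^ n = x) : del q x ≠ 0 := by
  have := zpow_sq_ne hq h1 (k := 2 * n + 1) (by omega)
  rw [zpow_add₀ hq.ne', two_mul, zpow_add₀ hq.ne', h, zpow_one] at this
  unfold del
  convert this using 1
  ring

theorem A0_eq {q : ℝ} (hq : 0 < q) (h1 : q ≠ 1) (s : Bool) {n : ℤ} {x : ℝ} (h : q ^ n = x) :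
    A0 q s n = (q ^ 2 - 1) / q * (x ^ 2 * q ^ 2) *
      ((x ^ 2 * q ^ 2) ^ 2 - (if s then 1 + q⁻¹ ^ 2 else 1 + q ^ 2) * (x ^ 2 * q ^ 2) + 1) /
      (del q x * del q (x * q)) := by
  have hx : 0 < x := h ▸ zpow_pos hq n
  have w0 := del_ne hq h1 n h
  have w1 := del_ne hq h1 (n + 1) (x := x * q) (by rw [zpow_add₀ hq.ne', h, zpow_one])
  have hD : q ^ 2 - 1 ≠ 0 := by simpa using zpow_sq_ne hq h1 (k := 1) one_ne_zero
  rw [A0, qn_eq hq h1 h, qn_eq hq h1 (k := n + 2) (x := x * q ^ 2) (by rw [zpow_add₀ hq.ne', h]; norm_cast),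
    qn_eq hq h1 (k := 2 * n + 1) (x := x ^ 2 * q)
      (by rw [zpow_add₀ hq.ne', two_mul, zpow_add₀ hq.ne', h, zpow_one]; ring),
    qn_eq hq h1 (k := 2 * n + 3) (x := x ^ 2 * q ^ 3)
      (by rw [zpow_add₀ hq.ne', two_mul, zpow_add₀ hq.ne', h]; norm_cast; ring)]
  have e0 : (x ^ 2 * q) ^ 2 - 1 = del q x := by unfold del; ring
  have e1 : (x ^ 2 * q ^ 3) ^ 2 - 1 = del q (x * q) := by unfold del; ring
  rw [e0, e1]
  generalize del q x = δ0 at *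
  generalize del q (x * q) = δ1 at *
  cases s <;> norm_num <;> field_simp <;> ring

theorem R_eq {q : ℝ} (hq : 0 < q) (h1 : q ≠ 1) {n : ℤ} {x : ℝ} (h : q ^ n = x) :
    R q n = x ^ 4 * q * ((q ^ 2 - 1) / q) ^ 2 /
      (del q x ^ 2 * (x ^ 2 * q ^ 2 + 1) * (x ^ 2 + 1)) := by
  have hx : 0 < x := h ▸ zpow_pos hq n
  have w0 := del_ne hq h1 n h
  have hD : q ^ 2 - 1 ≠ 0 := by simpa using zpow_sq_ne hq h1 (k := 1) one_ne_zero
  have e0 : (x ^ 2 * q) ^ 2 - 1 = del q x := by unfold del; ring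
  rw [R, qn_eq hq h1 (k := 2 * n + 1) (x := x ^ 2 * q)
      (by rw [zpow_add₀ hq.ne', two_mul, zpow_add₀ hq.ne', h, zpow_one]; ring), e0,
    show -2 * n - 2 = -(n + n + 2) by ring, show -n - 1 = -(n + 1) by ring]
  simp only [zpow_neg, zpow_add₀ hq.ne', h, zpow_one, zpow_ofNat]
  generalize del q x = δ0 at *
  field_simp

/-! ### The order conditions as rational identities -/

theorem qn_zpow {q : ℝ} (hq : 0 < q) (h1 : q ≠ 1) (k : ℤ) :
    qn q k = ((q ^ k) ^ 2 - 1) / q ^ k / ((q ^ 2 - 1) / q) := qn_eq hq h1 rfl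

set_option maxHeartbeats 4000000 in
/-- The order-zero and the first-order condition for pairs of generators `B`, `B*` and `δ(n) = [n+1]`,
coefficient by coefficient: identities of rational functions in `q`, `x = q^n` and `y = q^μ`. -/
theorem intertwine_quantum {q : ℝ} (hq : 0 < q) (h1 : q ≠ 1) (a b : SphereGen)
    (hab : a = B ∧ b = B ∨ a = B ∧ b = Bstar ∨ a = Bstar ∧ b = Bstar) (s : Bool) (n μ : ℤ) :
    (rat q a).Intertwine (rat q b).refl (rat q b).refl s n μ ∧
    ((rat q a).comm fun n => qn q (n + 1)).Intertwine (rat q b).refl (rat q b).refl.exch s n μ := by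
  obtain ⟨x, hx⟩ : ∃ x, q ^ n = x := ⟨_, rfl⟩
  obtain ⟨y, hy⟩ : ∃ y, q ^ μ = y := ⟨_, rfl⟩
  have x0 : 0 < x := hx ▸ zpow_pos hq n
  have y0 : 0 < y := hy ▸ zpow_pos hq μ
  have hp : q ^ (n + 1) = x * q := by rw [zpow_add₀ hq.ne', hx, zpow_one]
  have hm : q ^ (n - 1) = x / q := by rw [zpow_sub₀ hq.ne', hx, zpow_one]
  have w0 := del_ne hq h1 n hx
  have w1 := del_ne hq h1 _ hp
  have w9 := del_ne hq h1 _ hm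
  have w2 := del_ne hq h1 (n + 1 + 1) (x := x * q * q) (by rw [zpow_add₀ hq.ne', hp, zpow_one])
  have hD : q ^ 2 - 1 ≠ 0 := by simpa using zpow_sq_ne hq h1 (k := 1) one_ne_zero
  have a0 := fun s => A0_eq hq h1 s hx
  have a1 := fun s => A0_eq hq h1 s hp
  have a9 := fun s => A0_eq hq h1 s hm
  have r0 := R_eq hq h1 hx
  have r1 := R_eq hq h1 hp
  have r9 := R_eq hq h1 hm
  rw [show x / q * q = x by field_simp] at a9
  have dd0 : del q x = x ^ 4 * q ^ 2 - 1 := rfl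
  have dd1 : del q (x * q) = x ^ 4 * q ^ 6 - 1 := by unfold del; ring
  have dd2 : del q (x * q * q) = x ^ 4 * q ^ 10 - 1 := by unfold del; ring
  have dd9 : del q (x / q) = x ^ 4 / q ^ 2 - 1 := by unfold del; field_simp
  generalize del q x = δ0 at *
  generalize del q (x * q) = δ1 at *
  generalize del q (x * q * q) = δ2 at *
  generalize del q (x / q) = δ9 at *
  rcases hab with ⟨rfl, rfl⟩ | ⟨rfl, rfl⟩ | ⟨rfl, rfl⟩ <;> constructor <;> constructor
  all_goals
    simp only [rat, Band.refl, Band.comm, Band.exch, a0, a1, a9, r0, r1, r9]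
    simp only [qn_zpow hq h1, kap, two_mul, zpow_add₀ hq.ne', zpow_sub₀ hq.ne', zpow_neg, hx, hy, zpow_one,
      zpow_ofNat, neg_neg]
    cases s <;> simp only [Bool.not_true, Bool.not_false, ↓reduceIte, Bool.false_eq_true] <;> field_simp <;>
      (try simp only [dd0, dd1, dd2, dd9]) <;> (try field_simp) <;> (try ring)

theorem two_mul_add_odd_ne (n : ℤ) {k : ℝ} (j : ℤ) (hk : k = 2 * n + (2 * j + 1)) : k ≠ 0 := by
  subst hk
  intro h
  have : 2 * n + (2 * j + 1) = 0 := by exact_mod_cast h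
  omega

set_option maxHeartbeats 4000000 in
/-- The same identities for `q = 1`. There `A` is not a polynomial in `B` and `B*`, so that the pairs
which contain `A` are needed too. -/
theorem intertwine_classical (a b : SphereGen) (s : Bool) (n μ : ℤ)
    (hab : a = A ∧ b = A ∨ a = A ∧ b = B ∨ a = A ∧ b = Bstar ∨ a = B ∧ b = B ∨ a = B ∧ b = Bstar ∨
      a = Bstar ∧ b = Bstar) :
    (rat 1 a).Intertwine (rat 1 b).refl (rat 1 b).refl s n μ ∧
    ((rat 1 a).comm fun n => qn 1 (n + 1)).Intertwine (rat 1 b).refl (rat 1 b).refl.exch s n μ := by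
  have hA : ∀ s k, A0 1 s k = (if s then 1 else -1) / ((2 * k + 1) * (2 * k + 3)) := fun s k => by
    simp only [A0, qn_classical]
    push_cast
    norm_num
  have hR : ∀ k, R 1 k = 1 / (2 * k + 1) ^ 2 / 4 := fun k => by
    simp only [R, qn_classical, one_zpow]
    push_cast
    norm_num
    ring
  obtain ⟨v, hv⟩ : ∃ v : ℝ, v = 2 * n - 1 := ⟨_, rfl⟩
  have w0 : v ≠ 0 := two_mul_add_odd_ne n (-1) (by rw [hv]; push_cast; ring)
  have w1 : v + 2 ≠ 0 := two_mul_add_odd_ne n 0 (by rw [hv]; push_cast; ring)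
  have w2 : v + 4 ≠ 0 := two_mul_add_odd_ne n 1 (by rw [hv]; push_cast; ring)
  have w3 : v + 6 ≠ 0 := two_mul_add_odd_ne n 2 (by rw [hv]; push_cast; ring)
  have hn : (n : ℝ) = (v + 1) / 2 := by rw [hv]; ring
  have d1 : 2 * ((v + 1) / 2) + 1 = v + 2 := by ring
  have d2 : 2 * ((v + 1) / 2) + 3 = v + 4 := by ring
  have d3 : 2 * ((v + 1) / 2 + 1) + 1 = v + 4 := by ring
  have d4 : 2 * ((v + 1) / 2 + 1) + 3 = v + 6 := by ring
  have d5 : 2 * ((v + 1) / 2 - 1) + 1 = v := by ring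
  have d6 : 2 * ((v + 1) / 2 - 1) + 3 = v + 2 := by ring
  rcases hab with ⟨rfl, rfl⟩ | ⟨rfl, rfl⟩ | ⟨rfl, rfl⟩ | ⟨rfl, rfl⟩ | ⟨rfl, rfl⟩ | ⟨rfl, rfl⟩ <;> 
    constructor <;> constructor
  all_goals
    simp only [rat, Band.refl, Band.comm, Band.exch, hA, hR, qn_classical, kap, one_zpow]
    push_cast
    try simp only [hn, d1, d2, d3, d4, d5, d6]
    cases s <;> simp only [Bool.not_true, Bool.not_false, ↓reduceIte, Bool.false_eq_true] <;> field_simp <;> ring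

/-- The component `n → n + 1` of the first-order condition for the pair `(B, B*)` and an arbitrary
diagonal `δ` is a nonzero multiple of `[n+1] δ_{n+1} - [n+2] δ_n`. -/
theorem recursion_component {q : ℝ} (hq : 0 < q) (δ : ℤ → ℝ) (n μ : ℤ) :
    (rat q Bstar).refl.P true n μ * ((rat q B).comm δ).Z true (n + 1) (μ + 1) +
      (rat q Bstar).refl.Z true n μ * ((rat q B).comm δ).P true n (μ + 1) -
      (((rat q B).comm δ).P true n μ * (rat q Bstar).refl.exch.Z true (n + 1) (μ + 1) +
        ((rat q B).comm δ).Z true n μ * (rat q Bstar).refl.exch.P true n (μ + 1)) =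
    -(q ^ n * qn q (n - μ) * (qn q 3 + qn q 5) /
      (qn q (2 * n + 1) * qn q (2 * n + 3) * qn q (2 * n + 5))) *
      (qn q (n + 1) * δ (n + 1) - qn q (n + 2) * δ n) := by
  by_cases h1 : q = 1
  · subst h1
    obtain ⟨v, hv⟩ : ∃ v : ℝ, v = 2 * n + 1 := ⟨_, rfl⟩
    have w1 : v ≠ 0 := two_mul_add_odd_ne n 0 (by rw [hv]; push_cast; ring)
    have w2 : v + 2 ≠ 0 := two_mul_add_odd_ne n 1 (by rw [hv]; push_cast; ring)
    have w3 : v + 4 ≠ 0 := two_mul_add_odd_ne n 2 (by rw [hv]; push_cast; ring)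
    have hn : (n : ℝ) = (v - 1) / 2 := by rw [hv]; ring
    have d1 : 2 * ((v - 1) / 2) + 1 = v := by ring
    have d2 : 2 * ((v - 1) / 2) + 3 = v + 2 := by ring
    have d3 : 2 * ((v - 1) / 2) + 5 = v + 4 := by ring
    have d4 : 2 * ((v - 1) / 2 + 1) + 1 = v + 2 := by ring
    have d5 : 2 * ((v - 1) / 2 + 1) + 3 = v + 4 := by ring
    simp only [rat, Band.refl, Band.comm, Band.exch, A0, qn_classical, kap, one_zpow]
    push_cast
    simp only [hn, d1, d2, d3, d4, d5, Bool.not_true, Bool.not_false, ↓reduceIte, Bool.false_eq_true]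
    norm_num
    field_simp
    ring
  obtain ⟨x, hx⟩ : ∃ x, q ^ n = x := ⟨_, rfl⟩
  obtain ⟨y, hy⟩ : ∃ y, q ^ μ = y := ⟨_, rfl⟩
  have x0 : 0 < x := hx ▸ zpow_pos hq n
  have y0 : 0 < y := hy ▸ zpow_pos hq μ
  have hp : q ^ (n + 1) = x * q := by rw [zpow_add₀ hq.ne', hx, zpow_one]
  have w0 := del_ne hq h1 n hx
  have w1 := del_ne hq h1 _ hp
  have w2 := del_ne hq h1 (n + 1 + 1) (x := x * q * q) (by rw [zpow_add₀ hq.ne', hp, zpow_one])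
  have hD : q ^ 2 - 1 ≠ 0 := by simpa using zpow_sq_ne hq h1 (k := 1) one_ne_zero
  have a0 := fun s => A0_eq hq h1 s hx
  have a1 := fun s => A0_eq hq h1 s hp
  have dd0 : del q x = x ^ 4 * q ^ 2 - 1 := rfl
  have dd1 : del q (x * q) = x ^ 4 * q ^ 6 - 1 := by unfold del; ring
  have dd2 : del q (x * q * q) = x ^ 4 * q ^ 10 - 1 := by unfold del; ring
  have c0 : qn q (2 * n + 1) = del q x / (x ^ 2 * q) / ((q ^ 2 - 1) / q) := by
    rw [qn_eq hq h1 (x := x ^ 2 * q), dd0, show (x ^ 2 * q) ^ 2 = x ^ 4 * q ^ 2 by ring]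
    rw [zpow_add₀ hq.ne', two_mul, zpow_add₀ hq.ne', hx, zpow_one]; ring
  have c1 : qn q (2 * n + 3) = del q (x * q) / (x ^ 2 * q ^ 3) / ((q ^ 2 - 1) / q) := by
    rw [qn_eq hq h1 (x := x ^ 2 * q ^ 3), dd1, show (x ^ 2 * q ^ 3) ^ 2 = x ^ 4 * q ^ 6 by ring]
    rw [zpow_add₀ hq.ne', two_mul, zpow_add₀ hq.ne', hx]; norm_cast; ring
  have c2 : qn q (2 * n + 5) = del q (x * q * q) / (x ^ 2 * q ^ 5) / ((q ^ 2 - 1) / q) := by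
    rw [qn_eq hq h1 (x := x ^ 2 * q ^ 5), dd2, show (x ^ 2 * q ^ 5) ^ 2 = x ^ 4 * q ^ 10 by ring]
    rw [zpow_add₀ hq.ne', two_mul, zpow_add₀ hq.ne', hx]; norm_cast; ring
  rw [c0, c1, c2]
  simp only [rat, Band.refl, Band.comm, Band.exch, a0, a1]
  simp only [qn_zpow hq h1, kap, two_mul, zpow_add₀ hq.ne', zpow_sub₀ hq.ne', zpow_neg, hx, hy, zpow_one,
    zpow_ofNat, neg_neg, Bool.not_true, Bool.not_false, ↓reduceIte, Bool.false_eq_true]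
  generalize del q x = δ0 at *
  generalize del q (x * q) = δ1 at *
  generalize del q (x * q * q) = δ2 at *
  generalize δ n = d0
  generalize δ (n + 1) = d1
  field_simp
  simp only [dd0, dd1, dd2]
  field_simp
  ring

/-! ### Band operators -/

namespace Band

/-- The operator on `V ⊕ V` with the coefficients `a`. -/
noncomputable def op (a : Band) : Module.End ℂ VV :=
  Finsupp.linearCombination ℂ fun i =>
    (a.P i.sgn i.n i.μ : ℂ) • ket i.sgn (i.n + 1) (i.μ + a.d) +
    (a.Z i.sgn i.n i.μ : ℂ) • ket i.sgn i.n (i.μ + a.d) +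
    (a.M i.sgn i.n i.μ : ℂ) • ket i.sgn (i.n - 1) (i.μ + a.d)

/-- The coefficients vanish whenever the label of the target vector is out of range. -/
structure Proper (a : Band) : Prop where
  d : -1 ≤ a.d ∧ a.d ≤ 1
  Z : ∀ s n μ, -(n + 1) ≤ μ → μ ≤ n → ¬(-(n + 1) ≤ μ + a.d ∧ μ + a.d ≤ n) → a.Z s n μ = 0
  M : ∀ s n μ, -(n + 1) ≤ μ → μ ≤ n → ¬(-(n - 1 + 1) ≤ μ + a.d ∧ μ + a.d ≤ n - 1) → a.M s n μ = 0

theorem op_ket (a : Band) (s : Bool) {n μ : ℤ} (h1 : -(n + 1) ≤ μ) (h2 : μ ≤ n) :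
    a.op (ket s n μ) = (a.P s n μ : ℂ) • ket s (n + 1) (μ + a.d) +
      (a.Z s n μ : ℂ) • ket s n (μ + a.d) + (a.M s n μ : ℂ) • ket s (n - 1) (μ + a.d) := by
  rw [ket_valid ⟨h1, h2⟩, op, Finsupp.linearCombination_single, one_smul]

theorem op_smul_ket (a : Band) (s : Bool) {n μ : ℤ} {c : ℝ}
    (h : ¬(-(n + 1) ≤ μ ∧ μ ≤ n) → c = 0) :
    a.op ((c : ℂ) • ket s n μ) = ((c * a.P s n μ : ℝ) : ℂ) • ket s (n + 1) (μ + a.d) +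
      ((c * a.Z s n μ : ℝ) : ℂ) • ket s n (μ + a.d) +
      ((c * a.M s n μ : ℝ) : ℂ) • ket s (n - 1) (μ + a.d) := by
  by_cases hv : -(n + 1) ≤ μ ∧ μ ≤ n
  · rw [map_smul, op_ket a s hv.1 hv.2]
    push_cast
    module
  · simp [h hv]

theorem op_mul_ket (a : Band) {b : Band} (hb : b.Proper) (s : Bool) {n μ : ℤ} (h1 : -(n + 1) ≤ μ)
    (h2 : μ ≤ n) :
    (a.op * b.op) (ket s n μ) =
      ((b.P s n μ * a.P s (n + 1) (μ + b.d) : ℝ) : ℂ) • ket s (n + 2) (μ + (a.d + b.d)) +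
      ((b.P s n μ * a.Z s (n + 1) (μ + b.d) + b.Z s n μ * a.P s n (μ + b.d) : ℝ) : ℂ) •
        ket s (n + 1) (μ + (a.d + b.d)) +
      ((b.P s n μ * a.M s (n + 1) (μ + b.d) + b.Z s n μ * a.Z s n (μ + b.d) +
        b.M s n μ * a.P s (n - 1) (μ + b.d) : ℝ) : ℂ) • ket s n (μ + (a.d + b.d)) +
      ((b.Z s n μ * a.M s n (μ + b.d) + b.M s n μ * a.Z s (n - 1) (μ + b.d) : ℝ) : ℂ) •
        ket s (n - 1) (μ + (a.d + b.d)) +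
      ((b.M s n μ * a.M s (n - 1) (μ + b.d) : ℝ) : ℂ) • ket s (n - 2) (μ + (a.d + b.d)) := by
  have hd := hb.d
  rw [Module.End.mul_apply, op_ket b s h1 h2, map_add, map_add,
    op_smul_ket a s (fun h => absurd (by omega) h), op_smul_ket a s (hb.Z s n μ h1 h2),
    op_smul_ket a s (hb.M s n μ h1 h2)]
  simp only [show n + 1 + 1 = n + 2 by ring, show n - 1 - 1 = n - 2 by ring, add_sub_cancel_right,
    sub_add_cancel, show μ + b.d + a.d = μ + (a.d + b.d) by ring]
  push_cast
  module

/-- Five identities between coefficients give an identity between operators. -/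
theorem op_mul_eq {a b b' : Band} (ha : a.Proper) (hb : b.Proper) (hd : b'.d = b.d)
    (h : ∀ s n μ, -(n + 1) ≤ μ → μ ≤ n → a.Intertwine b b' s n μ) : a.op * b.op = b'.op * a.op := by
  apply end_ext
  intro s n μ h1 h2
  obtain ⟨i1, i2, i3, i4, i5⟩ := h s n μ h1 h2
  rw [op_mul_ket a hb s h1 h2, op_mul_ket b' ha s h1 h2, i1, i2, i3, i4, i5, hd, add_comm a.d]

theorem Proper.refl {a : Band} (h : a.Proper) : a.refl.Proper where
  d := ⟨by have := h.d; simp only [Band.refl]; omega, by have := h.d; simp only [Band.refl]; omega⟩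
  Z s n μ h1 h2 h3 := h.Z _ _ _ (by omega) (by omega) (by simp only [Band.refl] at h3; omega)
  M s n μ h1 h2 h3 := h.M _ _ _ (by omega) (by omega) (by simp only [Band.refl] at h3; omega)

theorem Proper.exch {a : Band} (h : a.Proper) : a.exch.Proper where
  d := h.d
  Z s n μ h1 h2 h3 := h.Z _ _ _ h1 h2 h3
  M s n μ h1 h2 h3 := h.M _ _ _ h1 h2 h3

theorem Proper.comm {a : Band} (h : a.Proper) (δ : ℤ → ℝ) : (a.comm δ).Proper where
  d := h.d
  Z s n μ h1 h2 h3 := by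
    simp only [Band.comm]
    rw [h.Z s n μ h1 h2 h3, h.Z (!s) n μ h1 h2 h3, sub_zero, mul_zero]
  M s n μ h1 h2 h3 := by
    simp only [Band.comm]
    rw [h.M s n μ h1 h2 h3, h.M (!s) n μ h1 h2 h3, zero_mul, mul_zero, sub_zero]

/-! ### Change of normalization of the basis -/

/-- `a` and `r` are the coefficients of the same operator, with respect to the vectors `|l,m⟩` and
`w(n, μ) |l,m⟩`, respectively. -/
structure Rescale (w : ℤ → ℤ → ℝ) (a r : Band) : Prop where
  d : r.d = a.d
  P : ∀ s n μ, -(n + 1) ≤ μ → μ ≤ n → w n μ * a.P s n μ = r.P s n μ * w (n + 1) (μ + a.d)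
  Z : ∀ s n μ, -(n + 1) ≤ μ → μ ≤ n → -(n + 1) ≤ μ + a.d → μ + a.d ≤ n →
    w n μ * a.Z s n μ = r.Z s n μ * w n (μ + a.d)
  M : ∀ s n μ, -(n + 1) ≤ μ → μ ≤ n → -(n - 1 + 1) ≤ μ + a.d → μ + a.d ≤ n - 1 →
    w n μ * a.M s n μ = r.M s n μ * w (n - 1) (μ + a.d)

theorem Rescale.exch {w : ℤ → ℤ → ℝ} {a r : Band} (h : Rescale w a r) :
    Rescale w a.exch r.exch :=
  ⟨h.d, fun s => h.P (!s), fun s => h.Z (!s), fun s => h.M (!s)⟩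

theorem Rescale.comm {w : ℤ → ℤ → ℝ} {a r : Band} (h : Rescale w a r) (δ : ℤ → ℝ) :
    Rescale w (a.comm δ) (r.comm δ) where
  d := h.d
  P s n μ h1 h2 := by
    have e1 := h.P s n μ h1 h2
    have e2 := h.P (!s) n μ h1 h2
    simp only [Band.comm]
    linear_combination δ (n + 1) * e1 - δ n * e2
  Z s n μ h1 h2 h3 h4 := by
    have e1 := h.Z s n μ h1 h2 h3 h4
    have e2 := h.Z (!s) n μ h1 h2 h3 h4
    simp only [Band.comm]
    linear_combination δ n * e1 - δ n * e2
  M s n μ h1 h2 h3 h4 := by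
    have e1 := h.M s n μ h1 h2 h3 h4
    have e2 := h.M (!s) n μ h1 h2 h3 h4
    simp only [Band.comm]
    linear_combination δ (n - 1) * e1 - δ n * e2

theorem Rescale.refl {w : ℤ → ℤ → ℝ} (hw : ∀ n μ, w n (-μ - 1) = w n μ) {a r : Band}
    (h : Rescale w a r) : Rescale w a.refl r.refl where
  d := by simp only [Band.refl, h.d]
  P s n μ h1 h2 := by
    have e := h.P (!s) n (-μ - 1) (by omega) (by omega)
    rw [hw, ← hw _ (-μ - 1 + a.d), show -(-μ - 1 + a.d) - 1 = μ + -a.d by ring] at e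
    exact e
  Z s n μ h1 h2 h3 h4 := by
    simp only [Band.refl] at h3 h4
    have e := h.Z (!s) n (-μ - 1) (by omega) (by omega) (by omega) (by omega)
    rw [hw, ← hw _ (-μ - 1 + a.d), show -(-μ - 1 + a.d) - 1 = μ + -a.d by ring] at e
    exact e
  M s n μ h1 h2 h3 h4 := by
    simp only [Band.refl] at h3 h4
    have e := h.M (!s) n (-μ - 1) (by omega) (by omega) (by omega) (by omega)
    rw [hw, ← hw _ (-μ - 1 + a.d), show -(-μ - 1 + a.d) - 1 = μ + -a.d by ring] at e
    exact e

/-- The diagonal operator `|l,m⟩_s ↦ w(n, μ) |l,m⟩_s`. -/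
noncomputable def diagOp (w : ℤ → ℤ → ℝ) : Module.End ℂ VV :=
  Finsupp.linearCombination ℂ fun i => (w i.n i.μ : ℂ) • ket i.sgn i.n i.μ

theorem diagOp_ket (w : ℤ → ℤ → ℝ) (s : Bool) (n μ : ℤ) :
    diagOp w (ket s n μ) = (w n μ : ℂ) • ket s n μ := by
  by_cases hv : -(n + 1) ≤ μ ∧ μ ≤ n
  · rw [ket_valid hv, diagOp, Finsupp.linearCombination_single, one_smul, ← ket_valid hv]
  · simp [ket_eq_zero hv]

theorem Rescale.op {w : ℤ → ℤ → ℝ} {a r : Band} (h : Rescale w a r) :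
    a.op * diagOp w = diagOp w * r.op := by
  apply end_ext
  intro s n μ h1 h2
  rw [Module.End.mul_apply, Module.End.mul_apply, diagOp_ket, map_smul, op_ket a s h1 h2,
    op_ket r s h1 h2, map_add, map_add, map_smul, map_smul, map_smul, diagOp_ket, diagOp_ket,
    diagOp_ket, h.d]
  simp only [smul_add, smul_smul, ← Complex.ofReal_mul]
  rw [h.P s n μ h1 h2]
  congr 1
  · congr 1
    by_cases hv : -(n + 1) ≤ μ + a.d ∧ μ + a.d ≤ n
    · rw [h.Z s n μ h1 h2 hv.1 hv.2]
    · simp [ket_eq_zero hv]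
  · by_cases hv : -(n - 1 + 1) ≤ μ + a.d ∧ μ + a.d ≤ n - 1
    · rw [h.M s n μ h1 h2 hv.1 hv.2]
    · simp [ket_eq_zero hv]

/-- Identities between operators may be checked after a change of normalization. -/
theorem Rescale.mul_eq {w : ℤ → ℤ → ℝ} (hw : ∀ n μ, -(n + 1) ≤ μ → μ ≤ n → w n μ ≠ 0)
    {a b b' r t t' : Band} (ha : Rescale w a r) (hb : Rescale w b t) (hb' : Rescale w b' t')
    (h : r.op * t.op = t'.op * r.op) : a.op * b.op = b'.op * a.op := by
  have key : a.op * b.op * diagOp w = b'.op * a.op * diagOp w := by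
    rw [mul_assoc, hb.op, ← mul_assoc, ha.op, mul_assoc, h, ← mul_assoc, ← hb'.op, mul_assoc,
      ← ha.op, mul_assoc]
  apply end_ext
  intro s n μ h1 h2
  have := congrArg (fun T => T (ket s n μ)) key
  simp only [Module.End.mul_apply (M := VV) _ (diagOp w), diagOp_ket, map_smul] at this
  exact smul_right_injective _ (Complex.ofReal_ne_zero.2 (hw n μ h1 h2)) this

end Band

/-! ### The generators of `A(S²_q)` as band operators -/

/-- The generators of `A(S²_q)`, with their coefficients as functions of the integral labels. -/
noncomputable def gen (q : ℝ) : SphereGen → Band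
  | .A =>
    { d := 0
      P := fun s n μ => AP q s (n + 1 / 2) (μ + 1 / 2)
      Z := fun s n μ => AZ q s (n + 1 / 2) (μ + 1 / 2)
      M := fun s n μ => AM q s (n + 1 / 2) (μ + 1 / 2) }
  | .B =>
    { d := 1
      P := fun s n μ => BP q s (n + 1 / 2) (μ + 1 / 2)
      Z := fun s n μ => BZ q s (n + 1 / 2) (μ + 1 / 2)
      M := fun s n μ => BM q s (n + 1 / 2) (μ + 1 / 2) }
  | .Bstar =>
    { d := -1
      P := fun s n μ => BstarP q s (n + 1 / 2) (μ + 1 / 2)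
      Z := fun s n μ => BstarZ q s (n + 1 / 2) (μ + 1 / 2)
      M := fun s n μ => BstarM q s (n + 1 / 2) (μ + 1 / 2) }

theorem sphereGenOp_eq (q : ℝ) (g : SphereGen) : sphereGenOp q g = (gen q g).op := by
  cases g <;> rfl

theorem qn_zero (q : ℝ) : qn q 0 = 0 := by simp [qn, qnum_zero]

theorem rat_proper (q : ℝ) (g : SphereGen) : (rat q g).Proper := by
  cases g
  · refine ⟨by simp [rat], fun s n μ h1 h2 h => absurd (by simp only [rat]; omega) h,
      fun s n μ h1 h2 h => ?_⟩
    obtain rfl | rfl : μ = n ∨ μ = -(n + 1) := by simp only [rat] at h; omega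
    · simp [rat, qn_zero]
    · simp [rat, qn_zero]
  · refine ⟨by simp [rat], fun s n μ h1 h2 h => ?_, fun s n μ h1 h2 h => ?_⟩
    · obtain rfl : μ = n := by simp only [rat] at h; omega
      simp [rat, qn_zero]
    · obtain rfl | rfl : μ = n ∨ μ = n - 1 := by simp only [rat] at h; omega
      · simp [rat, qn_zero]
      · simp [rat, qn_zero]
  · refine ⟨by simp [rat], fun s n μ h1 h2 h => ?_, fun s n μ h1 h2 h => ?_⟩
    · obtain rfl : μ = -(n + 1) := by simp only [rat] at h; omega
      simp [rat, qn_zero]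
    · obtain rfl | rfl : μ = -(n + 1) ∨ μ = -n := by simp only [rat] at h; omega
      · simp [rat, qn_zero]
      · simp [rat, qn_zero]

theorem qn_nonneg {q : ℝ} (hq : 0 < q) {k : ℤ} (hk : 0 ≤ k) : 0 ≤ qn q k :=
  qnum_nonneg hq (by exact_mod_cast hk)

theorem qn_pos {q : ℝ} (hq : 0 < q) {k : ℤ} (hk : 0 < k) : 0 < qn q k :=
  qnum_pos hq (by exact_mod_cast hk)

/-- `α⁺_{n+1/2}` of the representation `π_+`. -/
noncomputable def aP (q : ℝ) (n : ℤ) : ℝ := alphaP q true (n + 1 / 2)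

theorem alphaP_eq {q : ℝ} (hq : 0 < q) (s : Bool) (n : ℤ) {l : ℝ} (hl : l = n + 1 / 2) :
    alphaP q s l = kap q s * aP q n := by
  subst hl
  cases s
  · have : q ^ (-((n : ℝ) + 1 / 2) - 1) = q * q ^ (-((n : ℝ) + 1 / 2) - 2) := by
      rw [show -((n : ℝ) + 1 / 2) - 1 = 1 + (-((n : ℝ) + 1 / 2) - 2) by ring, Real.rpow_add hq,
        Real.rpow_one]
    simp only [alphaP, aP, kap, this]
    simp [mul_assoc]
  · simp [aP, kap]

theorem alphaM_eq {q : ℝ} (hq : 0 < q) (s : Bool) (n : ℤ) {l : ℝ} (hl : l = n + 1 / 2) :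
    alphaM q s l = -(q ^ (2 * n + 1) * (kap q s * aP q (n - 1))) := by
  rw [alphaM, alphaP_eq hq s (n - 1) (by rw [hl]; push_cast; ring), hl,
    show 2 * ((n : ℝ) + 1 / 2) = ((2 * n + 1 : ℤ) : ℝ) by push_cast; ring, Real.rpow_intCast, neg_mul]

theorem alpha0_eq' (q : ℝ) (s : Bool) (n : ℤ) : alpha0 q s (n + 1 / 2) = 1 / √q * A0 q s n := by
  rw [alpha0, A0]
  simp only [qn]
  push_cast
  ring_nf

theorem aP_sq {q : ℝ} (hq : 0 < q) {n : ℤ} (hn : 0 ≤ n) : aP q (n - 1) ^ 2 * q = R q n := by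
  have h1 := qn_pos hq (k := 2 * n + 1) (by omega)
  have h4 : qnum q (4 * ((n - 1 : ℤ) + 1 / 2) + 4) + qnum q 2 * qnum q (2 * ((n - 1 : ℤ) + 1 / 2) + 2) =
      qn q (2 * n + 1) * ((q ^ (n + 1) + q ^ (-n - 1)) * (q ^ n + q ^ (-n))) := by
    have e1 : 4 * (((n - 1 : ℤ) : ℝ) + 1 / 2) + 4 = ((4 * n + 2 : ℤ) : ℝ) := by push_cast; ring
    have e2 : 2 * (((n - 1 : ℤ) : ℝ) + 1 / 2) + 2 = ((2 * n + 1 : ℤ) : ℝ) := by push_cast; ring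
    rw [e1, e2, show (2 : ℝ) = ((2 : ℤ) : ℝ) by norm_num]
    change qn q (4 * n + 2) + qn q 2 * qn q (2 * n + 1) = _
    by_cases hq1 : q = 1
    · subst hq1
      simp only [qn_classical, one_zpow]
      push_cast
      ring
    obtain ⟨x, hx⟩ : ∃ x, q ^ n = x := ⟨_, rfl⟩
    have x0 : 0 < x := hx ▸ zpow_pos hq n
    have hD : q ^ 2 - 1 ≠ 0 := by simpa using zpow_sq_ne hq hq1 (k := 1) one_ne_zero
    rw [qn_eq hq hq1 (k := 4 * n + 2) (x := x ^ 4 * q ^ 2), qn_eq hq hq1 (k := 2) (x := q ^ 2),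
      qn_eq hq hq1 (k := 2 * n + 1) (x := x ^ 2 * q), show -n - 1 = -(n + 1) by ring]
    · simp only [zpow_neg, zpow_add₀ hq.ne', hx, zpow_one]
      field_simp
      ring
    · rw [zpow_add₀ hq.ne', two_mul, zpow_add₀ hq.ne', hx, zpow_one]; ring
    · norm_cast
    · rw [zpow_add₀ hq.ne', show 4 * n = n + n + n + n by ring, zpow_add₀ hq.ne', zpow_add₀ hq.ne',
        zpow_add₀ hq.ne', hx]
      norm_cast
      ring
  have h3 : 0 ≤ q ^ (n + 1) + q ^ (-n - 1) :=
    add_nonneg (zpow_pos hq _).le (zpow_pos hq _).le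
  have h3' : 0 ≤ q ^ n + q ^ (-n) := add_nonneg (zpow_pos hq _).le (zpow_pos hq _).le
  have e2 : qnum q (2 * ((n - 1 : ℤ) + 1 / 2) + 2) = qn q (2 * n + 1) := by
    rw [qn]; congr 1; push_cast; ring
  have e5 : (q ^ (-((n - 1 : ℤ) + 1 / 2 : ℝ) - 2)) ^ 2 * q = q ^ (-2 * n - 2) := by
    rw [← Real.rpow_natCast, ← Real.rpow_mul hq.le]
    nth_rw 2 [← Real.rpow_one q]
    rw [← Real.rpow_add hq, ← Real.rpow_intCast]
    congr 1
    push_cast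
    ring
  rw [aP, alphaP, if_pos rfl, R, ← e5, h4, e2, mul_pow, div_pow, Real.sq_sqrt (by positivity)]
  field_simp

theorem aP_pos {q : ℝ} (hq : 0 < q) {n : ℤ} (hn : -1 ≤ n) : 0 < aP q n := by
  have hn' : (-1 : ℝ) ≤ n := by exact_mod_cast hn
  have h1 := qnum_pos hq (x := 2 * ((n : ℝ) + 1 / 2) + 2) (by linarith)
  have h2 := qnum_pos hq (x := 4 * ((n : ℝ) + 1 / 2) + 4) (by linarith)
  have h3 := qnum_pos hq (x := 2) (by norm_num)
  rw [aP, alphaP, if_pos rfl]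
  positivity

/-- The square root of the `q`-factorial. -/
noncomputable def sqrtFac (q : ℝ) (k : ℤ) : ℝ := ∏ i ∈ Finset.range k.toNat, √(qn q (i + 1))

theorem sqrtFac_pos {q : ℝ} (hq : 0 < q) (k : ℤ) : 0 < sqrtFac q k :=
  Finset.prod_pos fun i _ => Real.sqrt_pos.2 (qn_pos hq (by omega))

theorem sqrtFac_succ (q : ℝ) {j k : ℤ} (hk : 0 ≤ k) (hj : j = k + 1) :
    sqrtFac q j = sqrtFac q k * √(qn q j) := by
  subst hj
  rw [sqrtFac, show (k + 1).toNat = k.toNat + 1 by omega, Finset.prod_range_succ, sqrtFac,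
    Int.toNat_of_nonneg hk]

/-- The product of the `√q α⁺_{i+1/2}` over `0 ≤ i < n`. -/
noncomputable def alphaProd (q : ℝ) (n : ℤ) : ℝ := ∏ i ∈ Finset.range n.toNat, (aP q i * √q)

theorem alphaProd_pos {q : ℝ} (hq : 0 < q) (n : ℤ) : 0 < alphaProd q n :=
  Finset.prod_pos fun i _ => mul_pos (aP_pos hq (by omega)) (Real.sqrt_pos.2 hq)

theorem alphaProd_succ (q : ℝ) {n k : ℤ} (hn : 0 ≤ n) (hk : k = n + 1) :
    alphaProd q k = alphaProd q n * (aP q n * √q) := by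
  subst hk
  rw [alphaProd, show (n + 1).toNat = n.toNat + 1 by omega, Finset.prod_range_succ, alphaProd,
    Int.toNat_of_nonneg hn]

/-- The normalization factors of the basis in which the generators have rational coefficients. -/
noncomputable def wt (q : ℝ) (n μ : ℤ) : ℝ :=
  sqrtFac q (n + μ + 1) * sqrtFac q (n - μ) * alphaProd q n

theorem wt_pos {q : ℝ} (hq : 0 < q) (n μ : ℤ) : 0 < wt q n μ :=
  mul_pos (mul_pos (sqrtFac_pos hq _) (sqrtFac_pos hq _)) (alphaProd_pos hq _)

theorem wt_refl (q : ℝ) (n μ : ℤ) : wt q n (-μ - 1) = wt q n μ := by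
  rw [wt, wt, mul_comm (sqrtFac q (n + μ + 1)), show n + (-μ - 1) + 1 = n - μ by ring,
    show n - (-μ - 1) = n + μ + 1 by ring]

theorem sqrt_qnum_mul {q : ℝ} (hq : 0 < q) {x y : ℝ} (j k : ℤ) (hj : 0 ≤ j) (hx : x = j) (hy : y = k) :
    √(qnum q x * qnum q y) = √(qn q j) * √(qn q k) := by
  subst hx hy
  exact Real.sqrt_mul (qn_nonneg hq hj) _

theorem rpow_half_int {q : ℝ} (hq : 0 < q) (k : ℤ) {x : ℝ} (h : x = k + 1 / 2) :
    q ^ x = q ^ k * √q := by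
  rw [h, Real.rpow_add hq, Real.rpow_intCast, Real.sqrt_eq_rpow]

theorem gen_rescale {q : ℝ} (hq : 0 < q) (g : SphereGen) : Band.Rescale (wt q) (gen q g) (rat q g) := by
  have hs : √q * √q = q := Real.mul_self_sqrt hq.le
  have hs0 : 0 < √q := Real.sqrt_pos.2 hq
  have sq : ∀ {k : ℤ}, 0 ≤ k → √(qn q k) * √(qn q k) = qn q k := fun hk =>
    Real.mul_self_sqrt (qn_nonneg hq hk)
  cases g
  · refine ⟨rfl, fun s n μ h1 h2 => ?_, fun s n μ h1 h2 _ _ => ?_, fun s n μ h1 h2 h3 h4 => ?_⟩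
    · simp only [gen, rat, AP, wt, add_zero]
      rw [rpow_half_int hq (n + μ + 1) (by push_cast; ring),
        sqrt_qnum_mul hq (n - μ + 1) (n + μ + 2) (by omega) (by push_cast; ring) (by push_cast; ring),
        alphaP_eq hq s n rfl,
        sqrtFac_succ q (j := n + 1 + μ + 1) (k := n + μ + 1) (by omega) (by ring),
        sqrtFac_succ q (j := n + 1 - μ) (k := n - μ) (by omega) (by ring),
        alphaProd_succ q (by omega) rfl, show n + μ + 2 = n + 1 + μ + 1 by ring,
        show n - μ + 1 = n + 1 - μ by ring, show n + μ + 1 = μ + (n + 1) by ring,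
        zpow_add₀ hq.ne']
      ring
    · simp only [gen, rat, AZ, add_zero]
      rw [alpha0_eq', mul_comm (wt q n μ)]
      congr 2
      have e : ∀ a b : ℝ, 1 / √q * (1 / (1 + q ^ 2)) * a * (1 / √q * b) =
          1 / (q * (1 + q ^ 2)) * a * b := fun a b => by
        rw [show 1 / (q * (1 + q ^ 2)) = 1 / (√q * √q * (1 + q ^ 2)) by rw [hs]]
        field_simp
      rw [e]
      simp only [qn]
      push_cast
      ring_nf
    · simp only [gen, add_zero] at h3 h4
      simp only [gen, rat, AM, wt, add_zero]
      have e : q ^ ((μ : ℝ) + 1 / 2 - (n + 1 / 2) - 1 / 2) * q ^ (2 * n + 1) = q ^ μ * q ^ n * √q := by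
        rw [← Real.rpow_intCast q (2 * n + 1), ← Real.rpow_add hq, ← zpow_add₀ hq.ne']
        exact rpow_half_int hq _ (by push_cast; ring)
      rw [sqrt_qnum_mul hq (n - μ) (n + μ + 1) (by omega) (by push_cast; ring) (by push_cast; ring),
        alphaM_eq hq s n rfl, ← aP_sq hq (by omega),
        sqrtFac_succ q (j := n + μ + 1) (k := n - 1 + μ + 1) (by omega) (by ring),
        sqrtFac_succ q (j := n - μ) (k := n - 1 - μ) (by omega) (by ring),
        alphaProd_succ q (n := n - 1) (by omega) (by ring)]
      have s_u := sq (k := n - μ) (by omega)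
      generalize √(qn q (n - μ)) = u at *
      have s_v := sq (k := n + μ + 1) (by omega)
      generalize √(qn q (n + μ + 1)) = v at *
      rw [← s_u, ← s_v]
      linear_combination (-sqrtFac q (n - 1 + μ + 1) * sqrtFac q (n - 1 - μ) * alphaProd q (n - 1) *
        u ^ 2 * v ^ 2 * aP q (n - 1) ^ 2 * kap q s) * (√q * e + q ^ μ * q ^ n * hs)
  · refine ⟨rfl, fun s n μ h1 h2 => ?_, fun s n μ h1 h2 h3 h4 => ?_, fun s n μ h1 h2 h3 h4 => ?_⟩
    · simp only [gen, rat, BP, wt]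
      rw [rpow_half_int hq μ rfl,
        sqrt_qnum_mul hq (n + μ + 2) (n + μ + 3) (by omega) (by push_cast; ring) (by push_cast; ring),
        alphaP_eq hq s n rfl,
        sqrtFac_succ q (j := n + 1 + (μ + 1) + 1) (k := n + μ + 2) (by omega) (by ring),
        sqrtFac_succ q (j := n + μ + 2) (k := n + μ + 1) (by omega) (by ring),
        alphaProd_succ q (by omega) rfl, show n + μ + 3 = n + 1 + (μ + 1) + 1 by ring,
        show n + 1 - (μ + 1) = n - μ by ring]
      ring
    · simp only [gen] at h3 h4
      simp only [gen, rat, BZ, wt]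
      rw [rpow_half_int hq μ rfl,
        sqrt_qnum_mul hq (n + μ + 2) (n - μ) (by omega) (by push_cast; ring) (by push_cast; ring),
        alpha0_eq', sqrtFac_succ q (j := n + (μ + 1) + 1) (k := n + μ + 1) (by omega) (by ring),
        sqrtFac_succ q (j := n - μ) (k := n - (μ + 1)) (by omega) (by ring),
        show n + μ + 2 = n + (μ + 1) + 1 by ring]
      have s_u := sq (k := n - μ) (by omega)
      generalize √(qn q (n - μ)) = u at *
      rw [← s_u]
      field_simp
    · simp only [gen] at h3 h4
      simp only [gen, rat, BM, wt]
      rw [rpow_half_int hq μ rfl,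
        sqrt_qnum_mul hq (n - μ) (n - μ - 1) (by omega) (by push_cast; ring) (by push_cast; ring),
        alphaM_eq hq s n rfl, ← aP_sq hq (by omega),
        sqrtFac_succ q (j := n - μ) (k := n - μ - 1) (by omega) (by ring),
        sqrtFac_succ q (j := n - μ - 1) (k := n - 1 - (μ + 1)) (by omega) (by ring),
        alphaProd_succ q (n := n - 1) (by omega) (by ring), show n - 1 + (μ + 1) + 1 = n + μ + 1 by ring]
      have s_u := sq (k := n - μ) (by omega)
      generalize √(qn q (n - μ)) = u at *
      have s_v := sq (k := n - μ - 1) (by omega)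
      generalize √(qn q (n - μ - 1)) = v at *
      rw [← s_u, ← s_v]
      linear_combination (-sqrtFac q (n + μ + 1) * sqrtFac q (n - 1 - (μ + 1)) * alphaProd q (n - 1) *
        u ^ 2 * v ^ 2 * aP q (n - 1) ^ 2 * kap q s * q ^ μ * q ^ (2 * n + 1)) * hs
  · refine ⟨rfl, fun s n μ h1 h2 => ?_, fun s n μ h1 h2 h3 h4 => ?_, fun s n μ h1 h2 h3 h4 => ?_⟩
    · simp only [gen, rat, BstarP, wt]
      have e : q ^ (μ - 1) * q ^ (2 * (n + 1) + 1) = q ^ μ * q ^ (2 * n + 2) := by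
        rw [← zpow_add₀ hq.ne', ← zpow_add₀ hq.ne']
        congr 1
        ring
      rw [rpow_half_int hq (μ - 1) (by push_cast; ring),
        sqrt_qnum_mul hq (n - μ + 2) (n - μ + 1) (by omega) (by push_cast; ring) (by push_cast; ring),
        alphaM_eq hq s (n + 1) (by push_cast; ring), add_sub_cancel_right,
        sqrtFac_succ q (j := n + 1 - (μ + -1)) (k := n - μ + 1) (by omega) (by ring),
        sqrtFac_succ q (j := n - μ + 1) (k := n - μ) (by omega) (by ring),
        alphaProd_succ q (by omega) rfl, show n + 1 - (μ + -1) = n - μ + 2 by ring,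
        show n + 1 + (μ + -1) + 1 = n + μ + 1 by ring]
      linear_combination (-sqrtFac q (n + μ + 1) * sqrtFac q (n - μ) * alphaProd q n * √q *
        √(qn q (n - μ + 2)) * √(qn q (n - μ + 1)) * kap q s * aP q n) * e
    · simp only [gen] at h3 h4
      simp only [gen, rat, BstarZ, wt]
      rw [rpow_half_int hq (μ - 1) (by push_cast; ring),
        sqrt_qnum_mul hq (n + μ + 1) (n - μ + 1) (by omega) (by push_cast; ring) (by push_cast; ring),
        alpha0_eq', sqrtFac_succ q (j := n + μ + 1) (k := n + (μ + -1) + 1) (by omega) (by ring),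
        sqrtFac_succ q (j := n - (μ + -1)) (k := n - μ) (by omega) (by ring),
        show n - (μ + -1) = n - μ + 1 by ring]
      have s_u := sq (k := n + μ + 1) (by omega)
      generalize √(qn q (n + μ + 1)) = u at *
      rw [← s_u]
      field_simp
    · simp only [gen] at h3 h4
      simp only [gen, rat, BstarM, wt]
      rw [rpow_half_int hq (μ - 1) (by push_cast; ring),
        sqrt_qnum_mul hq (n + μ + 1) (n + μ) (by omega) (by push_cast; ring) (by push_cast; ring),
        alphaP_eq hq s (n - 1) (by push_cast; ring), ← aP_sq hq (by omega),
        sqrtFac_succ q (j := n + μ + 1) (k := n + μ) (by omega) (by ring),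
        sqrtFac_succ q (j := n + μ) (k := n - 1 + (μ + -1) + 1) (by omega) (by ring),
        alphaProd_succ q (n := n - 1) (by omega) (by ring), show n - 1 - (μ + -1) = n - μ by ring]
      have s_u := sq (k := n + μ + 1) (by omega)
      generalize √(qn q (n + μ + 1)) = u at *
      have s_v := sq (k := n + μ) (by omega)
      generalize √(qn q (n + μ)) = v at *
      rw [← s_u, ← s_v]
      linear_combination (sqrtFac q (n - 1 + (μ + -1) + 1) * sqrtFac q (n - μ) * alphaProd q (n - 1) *
        u ^ 2 * v ^ 2 * aP q (n - 1) ^ 2 * kap q s * q ^ (μ - 1)) * hs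

/-! ### The reality operator and order conditions -/

theorem J_ket (p : ℝ) (s : Bool) (n μ : ℤ) :
    J p (ket s n μ) = (Complex.I ^ (2 * μ + 1) * ((p ^ ((μ : ℝ) + 1 / 2) : ℝ) : ℂ)) •
      ket (!s) n (-μ - 1) := by
  by_cases hv : -(n + 1) ≤ μ ∧ μ ≤ n
  · rw [ket_valid hv]
    simp only [J, LinearMap.coe_mk, AddHom.coe_mk]
    rw [Finsupp.sum_single_index (by simp)]
    simp [Idx.m]
  · rw [ket_eq_zero hv, ket_eq_zero (by omega), map_zero, smul_zero]

theorem I_zpow_conj (k : ℤ) : (starRingEnd ℂ) (Complex.I ^ k) = (Complex.I ^ k)⁻¹ := by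
  rw [map_zpow₀, Complex.conj_I, ← Complex.inv_I, inv_zpow]

theorem I_zpow_two_mul (k : ℤ) : Complex.I ^ (2 * k) = (-1) ^ k := by
  rw [zpow_mul, zpow_ofNat, Complex.I_sq]

theorem J_J {p : ℝ} (hp : 0 < p) (v : VV) : J p (J p v) = -v := by
  induction v using ket_induction with
  | h0 => simp
  | hadd v w hv hw => rw [map_add, map_add, hv, hw, neg_add]
  | hket c s n μ h1 h2 =>
    rw [LinearMap.map_smulₛₗ, LinearMap.map_smulₛₗ, J_ket, LinearMap.map_smulₛₗ, J_ket, Complex.conj_conj,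
      map_mul, I_zpow_conj, Complex.conj_ofReal, Bool.not_not,
      show -(-μ - 1) - 1 = μ by ring, smul_smul, smul_smul, ← neg_smul]
    congr 1
    have e1 : Complex.I ^ (2 * (-μ - 1) + 1) = (Complex.I ^ (2 * μ + 1))⁻¹ := by
      rw [← zpow_neg]; congr 1; ring
    have e2 : p ^ (((-μ - 1 : ℤ) : ℝ) + 1 / 2) = (p ^ ((μ : ℝ) + 1 / 2))⁻¹ := by
      rw [← Real.rpow_neg hp.le]; congr 1; push_cast; ring
    have e3 : (Complex.I ^ (2 * μ + 1)) * (Complex.I ^ (2 * μ + 1)) = -1 := by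
      rw [← zpow_add₀ Complex.I_ne_zero, show 2 * μ + 1 + (2 * μ + 1) = 2 * (2 * μ + 1) by ring,
        I_zpow_two_mul, Odd.neg_one_zpow ⟨μ, rfl⟩]
    have hI : Complex.I ^ (2 * μ + 1) ≠ 0 := zpow_ne_zero _ Complex.I_ne_zero
    have hP : ((p ^ ((μ : ℝ) + 1 / 2) : ℝ) : ℂ) ≠ 0 := by
      exact_mod_cast (Real.rpow_pos_of_pos hp _).ne'
    rw [e1, e2]
    generalize Complex.I ^ (2 * μ + 1) = x at *
    push_cast
    generalize ((p ^ ((μ : ℝ) + 1 / 2) : ℝ) : ℂ) = y at *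
    have : x⁻¹ * x⁻¹ = -1 := by rw [← mul_inv, e3]; norm_num
    calc c * (x⁻¹ * y) * (x⁻¹ * y⁻¹) = c * ((x⁻¹ * x⁻¹) * (y * y⁻¹)) := by ring
      _ = -c := by rw [this, mul_inv_cancel₀ hP, mul_one, mul_neg_one]

/-- The conjugation `T ↦ J T J⁻¹ = -J T J`, a ring homomorphism which is antilinear. -/
noncomputable def conjJ {p : ℝ} (hp : 0 < p) : Module.End ℂ VV →+* Module.End ℂ VV where
  toFun T :=
    { toFun := fun v => -J p (T (J p v))
      map_add' := fun v w => by simp only [map_add, neg_add]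
      map_smul' := fun c v => by
        simp only [LinearMap.map_smulₛₗ, LinearMap.map_smul, Complex.conj_conj, RingHom.id_apply,
          smul_neg] }
  map_one' := LinearMap.ext fun v => by simp [J_J hp]
  map_mul' S T := LinearMap.ext fun v => by simp [J_J hp]
  map_zero' := LinearMap.ext fun v => by simp
  map_add' S T := LinearMap.ext fun v => by
    simp only [LinearMap.coe_mk, AddHom.coe_mk, LinearMap.add_apply, map_add]
    exact neg_add _ _

theorem conjJ_apply {p : ℝ} (hp : 0 < p) (T : Module.End ℂ VV) (v : VV) :
    conjJ hp T v = -J p (T (J p v)) := rfl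

theorem conjJ_algebraMap {p : ℝ} (hp : 0 < p) (r : ℂ) :
    conjJ hp (algebraMap ℂ _ r) = algebraMap ℂ _ (starRingEnd ℂ r) := by
  refine LinearMap.ext fun v => ?_
  simp [conjJ_apply, LinearMap.map_smulₛₗ, J_J hp]

theorem conjJ_conjJ {p : ℝ} (hp : 0 < p) (T : Module.End ℂ VV) : conjJ hp (conjJ hp T) = T := by
  refine LinearMap.ext fun v => ?_
  simp [conjJ_apply, J_J hp]

/-- Conjugation by `J` reflects the coefficients of a band operator, up to a scalar. -/
theorem conjJ_op {p : ℝ} (hp : 0 < p) (a : Band) :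
    conjJ hp a.op = ((-(p : ℂ)) ^ a.d) • a.refl.op := by
  apply end_ext
  intro s n μ h1 h2
  have hpc : (p : ℂ) ≠ 0 := by exact_mod_cast hp.ne'
  have key : ∀ k, starRingEnd ℂ (Complex.I ^ (2 * μ + 1) * ((p ^ ((μ : ℝ) + 1 / 2) : ℝ) : ℂ)) •
      -J p (ket (!s) k (-μ - 1 + a.d)) = ((-(p : ℂ)) ^ a.d) • ket s k (μ + -a.d) := by
    intro k
    rw [J_ket, Bool.not_not, show -(-μ - 1 + a.d) - 1 = μ + -a.d by ring, ← neg_smul, smul_smul]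
    congr 1
    have e1 : Complex.I ^ (2 * (-μ - 1 + a.d) + 1) = (Complex.I ^ (2 * μ + 1))⁻¹ * (-1) ^ a.d := by
      rw [← zpow_neg, ← I_zpow_two_mul, ← zpow_add₀ Complex.I_ne_zero]; congr 1; ring
    have e2 : p ^ (((-μ - 1 + a.d : ℤ) : ℝ) + 1 / 2) = (p ^ ((μ : ℝ) + 1 / 2))⁻¹ * p ^ a.d := by
      rw [← Real.rpow_neg hp.le, ← Real.rpow_intCast, ← Real.rpow_add hp]; congr 1; push_cast; ring
    have e3 : (Complex.I ^ (2 * μ + 1)) * (Complex.I ^ (2 * μ + 1)) = -1 := by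
      rw [← zpow_add₀ Complex.I_ne_zero, show 2 * μ + 1 + (2 * μ + 1) = 2 * (2 * μ + 1) by ring,
        I_zpow_two_mul, Odd.neg_one_zpow ⟨μ, rfl⟩]
    have hP : ((p ^ ((μ : ℝ) + 1 / 2) : ℝ) : ℂ) ≠ 0 := by
      exact_mod_cast (Real.rpow_pos_of_pos hp _).ne'
    have e4 : (-(p : ℂ)) ^ a.d = (-1) ^ a.d * (p : ℂ) ^ a.d := by
      rw [← mul_zpow, neg_one_mul]
    rw [map_mul, I_zpow_conj, Complex.conj_ofReal, e1, e2, e4]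
    push_cast
    generalize Complex.I ^ (2 * μ + 1) = x at *
    generalize ((p ^ ((μ : ℝ) + 1 / 2) : ℝ) : ℂ) = y at *
    have : x⁻¹ * x⁻¹ = -1 := by rw [← mul_inv, e3]; norm_num
    calc x⁻¹ * y * -(x⁻¹ * (-1) ^ a.d * (y⁻¹ * (p : ℂ) ^ a.d))
        = -(x⁻¹ * x⁻¹) * (y * y⁻¹) * ((-1) ^ a.d * (p : ℂ) ^ a.d) := by ring
      _ = _ := by rw [this, mul_inv_cancel₀ hP]; ring
  rw [LinearMap.smul_apply, Band.op_ket a.refl s h1 h2, conjJ_apply, J_ket, LinearMap.map_smul,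
    Band.op_ket a (!s) (by omega) (by omega), LinearMap.map_smulₛₗ]
  simp only [map_add, LinearMap.map_smulₛₗ, Complex.conj_ofReal, smul_add, Band.refl, neg_add, ← smul_neg]
  rw [smul_comm _ (a.P _ _ _ : ℂ), smul_comm _ (a.Z _ _ _ : ℂ), smul_comm _ (a.M _ _ _ : ℂ)]
  rw [smul_comm ((-(p : ℂ)) ^ a.d) (a.P _ _ _ : ℂ), smul_comm ((-(p : ℂ)) ^ a.d) (a.Z _ _ _ : ℂ),
    smul_comm ((-(p : ℂ)) ^ a.d) (a.M _ _ _ : ℂ), ← key, ← key, ← key]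

/-- The operator `|l,m⟩_+ ↦ z δ(n) |l,m⟩_-`, `|l,m⟩_- ↦ z̄ δ(n) |l,m⟩_+` on `V ⊕ V`. -/
noncomputable def diracV (δ : ℤ → ℝ) (z : ℂ) : Module.End ℂ VV :=
  Finsupp.linearCombination ℂ fun i =>
    ((if i.sgn then z else starRingEnd ℂ z) * (δ i.n : ℂ)) • ket (!i.sgn) i.n i.μ

theorem diracV_ket (δ : ℤ → ℝ) (z : ℂ) (s : Bool) (n μ : ℤ) :
    diracV δ z (ket s n μ) = ((if s then z else starRingEnd ℂ z) * (δ n : ℂ)) • ket (!s) n μ := by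
  by_cases hv : -(n + 1) ≤ μ ∧ μ ≤ n
  · rw [ket_valid hv, diracV, Finsupp.linearCombination_single, one_smul]
  · simp [ket_eq_zero hv]

theorem diracV_J (p : ℝ) (δ : ℤ → ℝ) (z : ℂ) (v : VV) :
    diracV δ z (J p v) = J p (diracV δ z v) := by
  induction v using ket_induction with
  | h0 => simp
  | hadd v w hv hw => simp only [map_add, hv, hw]
  | hket c s n μ h1 h2 =>
    rw [LinearMap.map_smulₛₗ, LinearMap.map_smul, LinearMap.map_smul, LinearMap.map_smulₛₗ, J_ket,
      LinearMap.map_smul, diracV_ket, diracV_ket, LinearMap.map_smulₛₗ, J_ket, smul_smul _ _ (ket _ _ _),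
      smul_smul _ _ (ket _ _ _), map_mul, Complex.conj_ofReal,
      mul_comm (Complex.I ^ (2 * μ + 1) * _)]
    cases s <;> simp [smul_smul]

theorem conjJ_diracV {p : ℝ} (hp : 0 < p) (δ : ℤ → ℝ) (z : ℂ) :
    conjJ hp (diracV δ z) = diracV δ z := by
  refine LinearMap.ext fun v => ?_
  rw [conjJ_apply, ← diracV_J, J_J hp, map_neg, neg_neg]

theorem diracV_one_mul_op (z : ℂ) (a : Band) :
    diracV 1 z * a.op = a.exch.op * diracV 1 z := by
  apply end_ext
  intro s n μ h1 h2
  rw [Module.End.mul_apply, Module.End.mul_apply, a.op_ket s h1 h2, diracV_ket, LinearMap.map_smul,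
    a.exch.op_ket (!s) h1 h2]
  simp only [map_add, LinearMap.map_smul, diracV_ket, Band.exch, Bool.not_not, Pi.one_apply,
    Complex.ofReal_one, mul_one, smul_add]
  rw [smul_comm (a.P s n μ : ℂ), smul_comm (a.Z s n μ : ℂ), smul_comm (a.M s n μ : ℂ)]

theorem diracV_commutator (δ : ℤ → ℝ) (z : ℂ) (a : Band) :
    diracV δ z * a.op - a.op * diracV δ z = diracV 1 z * (a.comm δ).op := by
  apply end_ext
  intro s n μ h1 h2
  rw [LinearMap.sub_apply, Module.End.mul_apply, Module.End.mul_apply, Module.End.mul_apply,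
    a.op_ket s h1 h2, diracV_ket, LinearMap.map_smul, a.op_ket (!s) h1 h2, (a.comm δ).op_ket s h1 h2]
  simp only [map_add, LinearMap.map_smul, diracV_ket, Band.comm, Pi.one_apply,
    Complex.ofReal_one, mul_one, smul_add]
  push_cast
  module

/-- The first-order condition, in terms of coefficients. -/
theorem commute_commutator {δ : ℤ → ℝ} {z : ℂ} {a b : Band}
    (h : (a.comm δ).op * b.op = b.exch.op * (a.comm δ).op) :
    Commute (diracV δ z * a.op - a.op * diracV δ z) b.op := by
  rw [diracV_commutator, Commute, SemiconjBy, mul_assoc, h, ← mul_assoc, diracV_one_mul_op, ← mul_assoc]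
  congr 2
  simp only [Band.exch, Bool.not_not]

theorem commutator_commute_iff {D a b : Module.End ℂ VV} : Commute (D * a - a * D) b ↔
    ∀ v, D (a (b v)) - a (D (b v)) = b (D (a v)) - b (a (D v)) := by
  constructor
  · intro h v
    have := LinearMap.congr_fun h.eq v
    simpa using this
  · intro h
    refine LinearMap.ext fun v => ?_
    simpa using h v

/-- The first-order condition is symmetric in the two elements of the algebra. -/
theorem firstOrder_symm {p : ℝ} (hp : 0 < p) {D a b : Module.End ℂ VV}
    (hD : conjJ hp D = D) (h0 : Commute b (conjJ hp a))
    (h : Commute (D * a - a * D) (conjJ hp b)) :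
    Commute (D * b - b * D) (conjJ hp a) := by
  rw [commutator_commute_iff] at h ⊢
  have e1 := congrArg (conjJ hp) (LinearMap.ext h : D * (a * conjJ hp b) - a * (D * conjJ hp b) =
    conjJ hp b * (D * a) - conjJ hp b * (a * D))
  have hsub : ∀ S T : Module.End ℂ VV, conjJ hp (S - T) = conjJ hp S - conjJ hp T := by
    intro S T
    refine LinearMap.ext fun v => ?_
    simp only [conjJ_apply, LinearMap.sub_apply, map_sub, neg_sub']
  rw [hsub, hsub, map_mul, map_mul, map_mul, map_mul, map_mul, map_mul, map_mul, map_mul, conjJ_conjJ,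
    hD] at e1
  intro v
  have e1 := LinearMap.congr_fun e1 v
  have e2 := LinearMap.congr_fun h0.eq
  simp only [LinearMap.sub_apply, Module.End.mul_apply] at e1 e2
  generalize conjJ hp a = a' at *
  rw [e2 v, ← e2 (D v), ← sub_eq_zero, ← sub_eq_zero.2 e1]
  abel

/-- The operators whose conjugates by `J` commute with a given operator. -/
noncomputable def conjCommutant {p : ℝ} (hp : 0 < p) (T : Module.End ℂ VV) :
    Subalgebra ℂ (Module.End ℂ VV) where
  carrier := {b | Commute T (conjJ hp b)}
  mul_mem' hb hc := by
    simp only [Set.mem_ofPred_eq, map_mul] at *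
    exact hb.mul_right hc
  add_mem' hb hc := by
    simp only [Set.mem_ofPred_eq, map_add] at *
    exact hb.add_right hc
  algebraMap_mem' r := by
    simp only [Set.mem_ofPred_eq, conjJ_algebraMap]
    exact Algebra.commute_algebraMap_right _ T

/-- The operators which satisfy, with a given `b`, both the order-zero and the first-order
condition; they form an algebra because `[D, ·]` is a derivation. -/
noncomputable def orderSubalgebra (D b : Module.End ℂ VV) : Subalgebra ℂ (Module.End ℂ VV) where
  carrier := {a | Commute a b ∧ Commute (D * a - a * D) b}
  mul_mem' := by
    rintro a c ⟨ha, ha'⟩ ⟨hc, hc'⟩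
    refine ⟨ha.mul_left hc, ?_⟩
    rw [commutator_commute_iff] at *
    intro v
    have a0 := LinearMap.congr_fun ha.eq
    have c0 := LinearMap.congr_fun hc.eq
    have c1 := congrArg a (hc' v)
    have a1 := ha' (c v)
    simp only [Module.End.mul_apply, map_sub] at *
    rw [c0 v] at *
    rw [a0, a0] at c1
    rw [← sub_eq_zero] at a1 c1 ⊢
    rw [← add_zero (0 : VV)]
    nth_rewrite 1 [← a1]
    rw [← c1]
    abel
  add_mem' := by
    rintro a c ⟨ha, ha'⟩ ⟨hc, hc'⟩
    refine ⟨ha.add_left hc, ?_⟩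
    rw [commutator_commute_iff] at *
    intro v
    have a1 := ha' v
    have c1 := hc' v
    simp only [LinearMap.add_apply, map_add] at *
    rw [add_sub_add_comm, a1, c1]
    abel
  algebraMap_mem' r := by
    refine ⟨Algebra.commute_algebraMap_left r _, ?_⟩
    rw [commutator_commute_iff]
    intro v
    simp [Module.algebraMap_end_apply]

/-! ### The first-order condition on `V ⊕ V` -/

theorem piV_mem {q : ℝ} (hq : 0 < q) {S : Subalgebra ℂ (Module.End ℂ VV)}
    (h : ∀ g, sphereGenOp q g ∈ S) (α : Sphere q) : piV q hq α ∈ S := by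
  obtain ⟨x, rfl⟩ := RingQuot.mkAlgHom_surjective ℂ _ α
  simp only [piV, RingQuot.liftAlgHom_mkAlgHom_apply]
  induction x using FreeAlgebra.induction with
  | grade0 r => rw [AlgHom.commutes]; exact S.algebraMap_mem r
  | grade1 x => rw [FreeAlgebra.lift_ι_apply]; exact h x
  | mul a b ha hb => rw [map_mul]; exact S.mul_mem ha hb
  | add a b ha hb => rw [map_add]; exact S.add_mem ha hb

theorem rho_mem {q : ℝ} (hq : 0 < q) {S : Subalgebra ℂ (Module.End ℂ VV)}
    (h : ∀ g, uqGenOp q g ∈ S) (α : Uq q) : rho q hq α ∈ S := by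
  obtain ⟨x, rfl⟩ := RingQuot.mkAlgHom_surjective ℂ _ α
  simp only [rho, RingQuot.liftAlgHom_mkAlgHom_apply]
  induction x using FreeAlgebra.induction with
  | grade0 r => rw [AlgHom.commutes]; exact S.algebraMap_mem r
  | grade1 x => rw [FreeAlgebra.lift_ι_apply]; exact h x
  | mul a b ha hb => rw [map_mul]; exact S.mul_mem ha hb
  | add a b ha hb => rw [map_add]; exact S.add_mem ha hb

/-- The eigenvalues `[l + 1/2]` of the Dirac operator, as a function of `n = l - 1/2`. -/
noncomputable def diracEig (q : ℝ) (n : ℤ) : ℝ := qn q (n + 1)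

/-- Both order conditions for a pair of generators, and for the pair in the opposite order. -/
def OrderConditions {p : ℝ} (hp : 0 < p) (D a b : Module.End ℂ VV) : Prop :=
  (Commute a (conjJ hp b) ∧ Commute (D * a - a * D) (conjJ hp b)) ∧
    Commute b (conjJ hp a) ∧ Commute (D * b - b * D) (conjJ hp a)

theorem orderConditions_of_intertwine {q : ℝ} (hq : 0 < q) {p : ℝ} (hp : 0 < p) (z : ℂ)
    {a b : SphereGen} (h : ∀ s n μ,
      (rat q a).Intertwine (rat q b).refl (rat q b).refl s n μ ∧
      ((rat q a).comm fun n => qn q (n + 1)).Intertwine (rat q b).refl (rat q b).refl.exch s n μ) :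
    OrderConditions hp (diracV (diracEig q) z) (sphereGenOp q a) (sphereGenOp q b) := by
  have hw : ∀ n μ : ℤ, -(n + 1) ≤ μ → μ ≤ n → wt q n μ ≠ 0 := fun n μ _ _ => (wt_pos hq n μ).ne'
  have ra := gen_rescale hq a
  have rb := (gen_rescale hq b).refl (wt_refl q)
  have c0 : Commute (sphereGenOp q a) (conjJ hp (sphereGenOp q b)) := by
    rw [sphereGenOp_eq, sphereGenOp_eq, conjJ_op]
    refine Commute.smul_right ?_ _
    exact ra.mul_eq hw rb rb (Band.op_mul_eq (rat_proper q a) (rat_proper q b).refl rfl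
      fun s n μ _ _ => (h s n μ).1)
  have c1 : Commute (diracV (diracEig q) z * sphereGenOp q a - sphereGenOp q a * diracV (diracEig q) z)
      (conjJ hp (sphereGenOp q b)) := by
    rw [sphereGenOp_eq, sphereGenOp_eq, conjJ_op]
    refine Commute.smul_right (commute_commutator ?_) _
    exact (ra.comm _).mul_eq hw rb rb.exch (Band.op_mul_eq ((rat_proper q a).comm _)
      (rat_proper q b).refl rfl fun s n μ _ _ => (h s n μ).2)
  have c2 : Commute (sphereGenOp q b) (conjJ hp (sphereGenOp q a)) := by
    have := c0.map (conjJ hp)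
    rw [conjJ_conjJ] at this
    exact this.symm
  exact ⟨⟨c0, c1⟩, c2, firstOrder_symm hp (conjJ_diracV hp _ z) c2 c1⟩

/-- For `q ≠ 1` the generator `A` is a combination of `B B*` and `B* B`. -/
theorem A_mem {q : ℝ} (hq : 0 < q) (h1 : q ≠ 1) {S : Subalgebra ℂ (Module.End ℂ VV)}
    (hB : sphereGenOp q B ∈ S) (hC : sphereGenOp q Bstar ∈ S) : sphereGenOp q A ∈ S := by
  have hD : q ^ 2 - 1 ≠ 0 := by simpa using zpow_sq_ne hq h1 (k := 1) one_ne_zero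
  have key : sphereGenOp q A = ((q ^ 2 - 1 : ℝ) : ℂ)⁻¹ •
      (((q ^ 4 : ℝ) : ℂ) • (sphereGenOp q B * sphereGenOp q Bstar) +
        (-1 : ℂ) • (sphereGenOp q Bstar * sphereGenOp q B)) := by
    have hDc : ((q ^ 2 - 1 : ℝ) : ℂ) ≠ 0 := by exact_mod_cast hD
    have hqc : ((q : ℝ) : ℂ) ≠ 0 := by exact_mod_cast hq.ne'
    rw [eq_inv_smul_iff₀ hDc, B_Bstar_rel hq, Bstar_B_rel hq]
    refine LinearMap.ext fun v => ?_
    simp only [LinearMap.smul_apply, LinearMap.add_apply, Module.End.mul_apply, LinearMap.sub_apply,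
      Module.End.one_apply, map_sub, LinearMap.map_smul]
    generalize sphereGenOp q A (sphereGenOp q A v) = w
    generalize sphereGenOp q A v = u
    have e : ((q ^ 4 : ℝ) : ℂ) * ((q ^ 2 : ℝ) : ℂ)⁻¹ = ((q ^ 2 : ℝ) : ℂ) := by
      push_cast
      field_simp
    rw [smul_smul, e]
    push_cast
    module
  rw [key]
  exact Subalgebra.smul_mem _ (add_mem (Subalgebra.smul_mem _ (mul_mem hB hC) _)
    (Subalgebra.smul_mem _ (mul_mem hC hB) _)) _

/-- The first-order condition needs to be checked on generators only. -/
theorem firstOrder_of_gens {q : ℝ} (hq : 0 < q) {p : ℝ} (hp : 0 < p) {D : Module.End ℂ VV}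
    {G : Set SphereGen} (hG : ∀ S : Subalgebra ℂ (Module.End ℂ VV),
      (∀ g ∈ G, sphereGenOp q g ∈ S) → ∀ g, sphereGenOp q g ∈ S)
    (h : ∀ a ∈ G, ∀ b ∈ G, Commute (sphereGenOp q a) (conjJ hp (sphereGenOp q b)) ∧
      Commute (D * sphereGenOp q a - sphereGenOp q a * D) (conjJ hp (sphereGenOp q b)))
    (α β : Sphere q) :
    Commute (D * piV q hq α - piV q hq α * D) (conjJ hp (piV q hq β)) := by
  have hb : ∀ b ∈ G, Commute (D * piV q hq α - piV q hq α * D) (conjJ hp (sphereGenOp q b)) :=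
    fun b hb => (piV_mem hq (S := orderSubalgebra D (conjJ hp (sphereGenOp q b)))
      (hG _ fun a ha => h a ha b hb) α).2
  exact piV_mem hq (S := conjCommutant hp _) (hG _ hb) β

/-- The first-order condition for the operator with eigenvalues `[l + 1/2]`. -/
theorem firstOrder_diracV {q : ℝ} (hq : 0 < q) {p : ℝ} (hp : 0 < p) (z : ℂ) (α β : Sphere q) :
    Commute (diracV (diracEig q) z * piV q hq α - piV q hq α * diracV (diracEig q) z)
      (conjJ hp (piV q hq β)) := by
  by_cases h1 : q = 1
  · subst h1
    have h : ∀ a b : SphereGen, OrderConditions hp (diracV (diracEig 1) z) (sphereGenOp 1 a)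
        (sphereGenOp 1 b) := by
      intro a b
      cases a <;> cases b
      · exact orderConditions_of_intertwine hq hp z (intertwine_classical A A · · · (by simp))
      · exact orderConditions_of_intertwine hq hp z (intertwine_classical A B · · · (by simp))
      · exact orderConditions_of_intertwine hq hp z (intertwine_classical A Bstar · · · (by simp))
      · exact (orderConditions_of_intertwine hq hp z (intertwine_classical A B · · · (by simp))).symm
      · exact orderConditions_of_intertwine hq hp z (intertwine_classical B B · · · (by simp))
      · exact orderConditions_of_intertwine hq hp z (intertwine_classical B Bstar · · · (by simp))
      · exact (orderConditions_of_intertwine hq hp z (intertwine_classical A Bstar · · · (by simp))).symm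
      · exact (orderConditions_of_intertwine hq hp z (intertwine_classical B Bstar · · · (by simp))).symm
      · exact orderConditions_of_intertwine hq hp z
          (intertwine_classical Bstar Bstar · · · (by simp))
    exact firstOrder_of_gens hq hp (G := Set.univ) (fun S hS g => hS g trivial)
      (fun a _ b _ => (h a b).1) α β
  · have hBB := orderConditions_of_intertwine hq hp z (intertwine_quantum hq h1 B B (by simp))
    have hBC := orderConditions_of_intertwine hq hp z (intertwine_quantum hq h1 B Bstar (by simp))
    have hCC := orderConditions_of_intertwine hq hp z (intertwine_quantum hq h1 Bstar Bstar (by simp))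
    refine firstOrder_of_gens hq hp (G := {B, Bstar}) (fun S hS g => ?_) ?_ α β
    · have hB := hS B (by simp)
      have hC := hS Bstar (by simp)
      cases g
      exacts [A_mem hq h1 hB hC, hB, hC]
    · rintro _ (rfl | rfl) _ (rfl | rfl)
      exacts [hBB.1, hBC.1, hBC.2, hCC.1]

/-! ### Operators on families of coordinates -/

/-- The coordinate of a family `x` at `|n + 1/2, μ + 1/2⟩_s`, zero if the label is out of range. -/
noncomputable def coord (s : Bool) (n μ : ℤ) (x : Idx → ℂ) : ℂ :=
  if h : -(n + 1) ≤ μ ∧ μ ≤ n then x ⟨s, n, μ, h.1, h.2⟩ else 0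

theorem coord_add (s : Bool) (n μ : ℤ) (x y : Idx → ℂ) :
    coord s n μ (x + y) = coord s n μ x + coord s n μ y := by
  unfold coord
  split_ifs
  · rfl
  · simp

theorem coord_smul (s : Bool) (n μ : ℤ) (c : ℂ) (x : Idx → ℂ) :
    coord s n μ (c • x) = c * coord s n μ x := by
  unfold coord
  split_ifs
  · rfl
  · simp

theorem continuous_coord (s : Bool) (n μ : ℤ) : Continuous (coord s n μ) := by
  unfold coord
  split_ifs
  · exact continuous_apply _
  · exact continuous_const

theorem coord_self (x : Idx → ℂ) (j : Idx) : coord j.sgn j.n j.μ x = x j :=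
  dif_pos ⟨j.lower, j.upper⟩

theorem ket_apply (s : Bool) (n μ : ℤ) (j : Idx) :
    ket s n μ j = if s = j.sgn ∧ n = j.n ∧ μ = j.μ then 1 else 0 := by
  by_cases hv : -(n + 1) ≤ μ ∧ μ ≤ n
  · rw [ket_valid hv, Finsupp.single_apply]
    simp [Idx.ext_iff]
  · rw [ket_eq_zero hv, if_neg]
    · rfl
    · rintro ⟨-, rfl, rfl⟩
      exact hv ⟨j.lower, j.upper⟩

theorem coord_ket {s' : Bool} {n' μ' : ℤ} (h : -(n' + 1) ≤ μ' ∧ μ' ≤ n') (s : Bool) (n μ : ℤ) :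
    coord s n μ (ket s' n' μ') = if s' = s ∧ n' = n ∧ μ' = μ then 1 else 0 := by
  by_cases hv : -(n + 1) ≤ μ ∧ μ ≤ n
  · rw [coord, dif_pos hv, ket_apply]
  · rw [coord, dif_neg hv, if_neg]
    rintro ⟨-, rfl, rfl⟩
    exact hv h

/-- A map of `V ⊕ V` is *coordinate-continuous* if it is induced by a map of families of coordinates that
is continuous for the topology of pointwise convergence. Such a map has a closed extension. -/
def CoordContinuous (S : VV → VV) : Prop :=
  ∃ G : (Idx → ℂ) → Idx → ℂ, Continuous G ∧ ∀ v, ⇑(S v) = G v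

theorem CoordContinuous.comp {S T : VV → VV} (hS : CoordContinuous S) (hT : CoordContinuous T) :
    CoordContinuous fun v => S (T v) := by
  obtain ⟨F, hF, hF'⟩ := hS
  obtain ⟨G, hG, hG'⟩ := hT
  exact ⟨fun x => F (G x), hF.comp hG, fun v => by rw [hF', hG']⟩

theorem coe_incl (v : VV) : (⇑(incl v) : Idx → ℂ) = v := funext (incl_apply v)

theorem continuous_coe_HH : Continuous fun x : HH => (x : Idx → ℂ) :=
  continuous_pi fun i => (lp.evalCLM ℂ (fun _ : Idx => ℂ) 2 i).continuous

/-- A point of the closure of the graph of `S` is given by the coordinatewise extension of `S`. -/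
theorem CoordContinuous.eq_of_mem_closure {S : VV → VV} {G : (Idx → ℂ) → Idx → ℂ}
    (hG : Continuous G) (hS : ∀ v, ⇑(S v) = G v) {x y : HH}
    (h : (x, y) ∈ closure (Set.range fun w : VV => (incl w, incl (S w)))) : ⇑y = G x := by
  have hc : IsClosed {z : HH × HH | (⇑z.2 : Idx → ℂ) = G z.1} :=
    isClosed_eq (continuous_coe_HH.comp continuous_snd)
      (hG.comp (continuous_coe_HH.comp continuous_fst))
  refine closure_minimal ?_ hc h
  rintro _ ⟨w, rfl⟩
  exact (coe_incl _).trans ((hS w).trans (congrArg G (coe_incl w).symm))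

/-- Where `T` takes values in `V ⊕ V`, the closures in `Intertwines` play no role. -/
theorem Intertwines.eq {S : VV → VV} (hS : CoordContinuous S) {T : VV → HH} (h : Intertwines S T)
    {v w : VV} (hv : T v = incl w) : T (S v) = incl (S w) := by
  obtain ⟨G, hG, hG'⟩ := hS
  have := CoordContinuous.eq_of_mem_closure hG hG' (h v)
  apply lp.ext
  rw [this, hv, coe_incl, coe_incl, hG']

theorem Intertwines.of_eq {S S' : VV → VV} {T : VV → HH} (hT : ∀ v, T v = incl (S' v))
    (h : ∀ v, S' (S v) = S (S' v)) : Intertwines S T := by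
  intro v
  apply subset_closure
  exact ⟨S' v, by rw [hT, hT, h]⟩

namespace Band

/-- The action of a band operator on families of coordinates. -/
noncomputable def act (a : Band) (x : Idx → ℂ) (j : Idx) : ℂ :=
  a.P j.sgn (j.n - 1) (j.μ - a.d) * coord j.sgn (j.n - 1) (j.μ - a.d) x +
  a.Z j.sgn j.n (j.μ - a.d) * coord j.sgn j.n (j.μ - a.d) x +
  a.M j.sgn (j.n + 1) (j.μ - a.d) * coord j.sgn (j.n + 1) (j.μ - a.d) x

theorem continuous_act (a : Band) : Continuous a.act :=
  continuous_pi fun j =>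
    ((continuous_const.mul (continuous_coord _ _ _)).add
      (continuous_const.mul (continuous_coord _ _ _))).add
      (continuous_const.mul (continuous_coord _ _ _))

theorem op_apply (a : Band) (v : VV) : ⇑(a.op v) = a.act v := by
  induction v using ket_induction with
  | h0 =>
    funext j
    simp [act, coord]
  | hadd v w hv hw =>
    funext j
    have hv := congrFun hv j
    have hw := congrFun hw j
    rw [map_add, Finsupp.add_apply, hv, hw]
    simp only [act, Finsupp.coe_add, coord_add]
    ring
  | hket c s n μ h1 h2 =>
    funext j
    rw [map_smul, op_ket a s h1 h2]
    simp only [act, Finsupp.coe_smul, coord_smul, Finsupp.smul_apply, Finsupp.add_apply, ket_apply,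
      coord_ket ⟨h1, h2⟩, smul_eq_mul]
    have key : ∀ (F : Bool → ℤ → ℤ → ℝ) (k : ℤ),
        (F s n μ : ℂ) * (if s = j.sgn ∧ n + k = j.n ∧ μ + a.d = j.μ then 1 else 0) =
        F j.sgn (j.n - k) (j.μ - a.d) *
          (if s = j.sgn ∧ n = j.n - k ∧ μ = j.μ - a.d then 1 else 0) := by
      intro F k
      by_cases hj : s = j.sgn ∧ n = j.n - k ∧ μ = j.μ - a.d
      · rw [if_pos hj, if_pos ⟨hj.1, by omega, by omega⟩, hj.1, hj.2.1, hj.2.2]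
      · rw [if_neg hj, if_neg fun h => hj ⟨h.1, by omega, by omega⟩, mul_zero, mul_zero]
    have k1 := key a.P 1
    have k0 := key a.Z 0
    have km := key a.M (-1)
    simp only [add_zero, sub_zero, sub_neg_eq_add, ← sub_eq_add_neg] at k1 k0 km
    rw [k1, k0, km]
    ring

theorem coordContinuous_op (a : Band) : CoordContinuous a.op := ⟨a.act, a.continuous_act, a.op_apply⟩

end Band

theorem coordContinuous_J (p : ℝ) : CoordContinuous (J p) := by
  refine ⟨fun x j => starRingEnd ℂ (coord (!j.sgn) j.n (-j.μ - 1) x) *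
    (Complex.I ^ (2 * (-j.μ - 1) + 1) * ((p ^ (((-j.μ - 1 : ℤ) : ℝ) + 1 / 2) : ℝ) : ℂ)), ?_, fun v => ?_⟩
  · exact continuous_pi fun j => (Complex.continuous_conj.comp (continuous_coord _ _ _)).mul
      continuous_const
  · induction v using ket_induction with
    | h0 =>
      funext j
      simp [coord]
    | hadd v w hv hw =>
      funext j
      have hv := congrFun hv j
      have hw := congrFun hw j
      rw [map_add, Finsupp.add_apply, hv, hw]
      simp only [Finsupp.coe_add, coord_add, map_add]
      ring
    | hket c s n μ h1 h2 =>
      funext j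
      rw [LinearMap.map_smulₛₗ, J_ket]
      simp only [Finsupp.coe_smul, coord_smul, Finsupp.smul_apply, ket_apply,
        coord_ket ⟨h1, h2⟩, smul_eq_mul, map_mul]
      by_cases hj : s = !j.sgn ∧ n = j.n ∧ μ = -j.μ - 1
      · rw [if_pos hj, if_pos ⟨by rw [hj.1, Bool.not_not], by omega, by omega⟩, ← hj.2.2]
        simp
      · rw [if_neg hj, if_neg]
        · simp
        · rintro ⟨h3, h4, h5⟩
          exact hj ⟨by rw [← h3, Bool.not_not], by omega, by omega⟩

theorem coordContinuous_shiftOp (d : ℤ) (P Z M : Bool → ℝ → ℝ → ℝ) :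
    CoordContinuous (shiftOp d P Z M) :=
  Band.coordContinuous_op
    { d := d
      P := fun s n μ => P s (n + 1 / 2) (μ + 1 / 2)
      Z := fun s n μ => Z s (n + 1 / 2) (μ + 1 / 2)
      M := fun s n μ => M s (n + 1 / 2) (μ + 1 / 2) }

/-! ### Monotonicity of the q-integers and the spectrum of the Casimir elements -/

theorem qn_succ_sub {q : ℝ} (hq : 0 < q) (k : ℤ) :
    (q + 1) * (qn q (k + 1) - qn q k) = q * (q ^ k + q ^ (-k - 1)) := by
  by_cases h1 : q = 1
  · subst h1
    simp only [qn_classical, one_zpow]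
    push_cast
    ring
  have hx : 0 < q ^ k := zpow_pos hq k
  have hD : q ^ 2 - 1 ≠ 0 := by simpa using zpow_sq_ne hq h1 (k := 1) one_ne_zero
  rw [qn_eq hq h1 (k := k) rfl, qn_eq hq h1 (zpow_add_one₀ hq.ne' k), show -k - 1 = -(k + 1) by ring, zpow_neg,
    zpow_add_one₀ hq.ne']
  generalize q ^ k = x at *
  field_simp
  ring

theorem qn_strictMono {q : ℝ} (hq : 0 < q) : StrictMono (qn q) := by
  refine strictMono_int_of_lt_succ fun k => ?_
  have h := qn_succ_sub hq k
  have h1 : 0 < q * (q ^ k + q ^ (-k - 1)) :=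
    mul_pos hq (add_pos (zpow_pos hq _) (zpow_pos hq _))
  rw [← h] at h1
  have := pos_of_mul_pos_right h1 (by linarith)
  linarith

theorem qn_casimir_sub {q : ℝ} (hq : 0 < q) (n μ : ℤ) :
    qn q (n - μ + 1) * qn q (n + μ + 1) - qn q (n - μ) * qn q (n + μ + 2) = qn q (2 * μ + 1) := by
  by_cases h1 : q = 1
  · subst h1
    simp only [qn_classical]
    push_cast
    ring
  have hx : 0 < q ^ n := zpow_pos hq n
  have hy : 0 < q ^ μ := zpow_pos hq μ
  have hD : q ^ 2 - 1 ≠ 0 := by simpa using zpow_sq_ne hq h1 (k := 1) one_ne_zero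
  have e (a b c : ℤ) : q ^ (a * n + b * μ + c) = (q ^ n) ^ a * (q ^ μ) ^ b * q ^ c := by
    rw [zpow_add₀ hq.ne', zpow_add₀ hq.ne', mul_comm a, mul_comm b, zpow_mul, zpow_mul]
  rw [qn_eq hq h1 (k := n - μ + 1) (x := q ^ n / q ^ μ * q)
      (by rw [zpow_add_one₀ hq.ne', zpow_sub₀ hq.ne']),
    qn_eq hq h1 (k := n + μ + 1) (x := q ^ n * q ^ μ * q)
      (by rw [zpow_add_one₀ hq.ne', zpow_add₀ hq.ne']),
    qn_eq hq h1 (zpow_sub₀ hq.ne' n μ),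
    qn_eq hq h1 (k := n + μ + 2) (x := q ^ n * q ^ μ * q ^ 2)
      (by rw [zpow_add₀ hq.ne', zpow_add₀ hq.ne']; norm_cast),
    qn_eq hq h1 (k := 2 * μ + 1) (x := (q ^ μ) ^ 2 * q)
      (by rw [zpow_add_one₀ hq.ne', two_mul, zpow_add₀ hq.ne']; ring)]
  generalize q ^ n = x at *
  generalize q ^ μ = y at *
  field_simp
  ring

/-- The eigenvalues of `f e` and `e f` separate the labels `(n, μ)`. -/
theorem labels_eq_of_casimir {q : ℝ} (hq : 0 < q) {n μ n' μ' : ℤ} (h1 : -(n + 1) ≤ μ) (h2 : μ ≤ n)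
    (h1' : -(n' + 1) ≤ μ') (h2' : μ' ≤ n')
    (hfe : qn q (n - μ + 1) * qn q (n + μ + 1) = qn q (n' - μ' + 1) * qn q (n' + μ' + 1))
    (hef : qn q (n - μ) * qn q (n + μ + 2) = qn q (n' - μ') * qn q (n' + μ' + 2)) :
    n = n' ∧ μ = μ' := by
  have hμ : μ = μ' := by
    have := (qn_strictMono hq).injective
      (((qn_casimir_sub hq n μ).symm.trans (by rw [hfe, hef])).trans (qn_casimir_sub hq n' μ'))
    omega
  subst hμ
  refine ⟨?_, rfl⟩
  have lt : ∀ {a b : ℤ}, -(a + 1) ≤ μ → μ ≤ a → a < b →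
      qn q (a - μ + 1) * qn q (a + μ + 1) < qn q (b - μ + 1) * qn q (b + μ + 1) :=
    fun ha hb hab => mul_lt_mul'' (qn_strictMono hq (by omega)) (qn_strictMono hq (by omega))
      (qn_nonneg hq (by omega)) (qn_nonneg hq (by omega))
  rcases lt_trichotomy n n' with h | h | h
  · exact absurd hfe (lt h1 h2 h).ne
  · exact h
  · exact absurd hfe (lt h1' h2' h).ne'

theorem coordContinuous_uqGenOp (q : ℝ) (g : UqGen) : CoordContinuous (uqGenOp q g) := by
  cases g <;> rw [uqGenOp] <;> exact coordContinuous_shiftOp _ _ _ _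

theorem f_ket {q : ℝ} (hq : 0 < q) (s : Bool) {n μ : ℤ} (h1 : -(n + 1) ≤ μ) (h2 : μ ≤ n) :
    uqGenOp q .f (ket s n μ) = (√(qn q (n - μ) * qn q (n + μ + 2)) : ℂ) • ket s n (μ + 1) := by
  rw [uqGenOp, shiftOp_ket' _ _ _ _ s n μ _ _ rfl rfl h1 h2,
    show (n : ℝ) + 1 / 2 - (μ + 1 / 2) = ((n - μ : ℤ) : ℝ) by push_cast; ring,
    show (n : ℝ) + 1 / 2 + (μ + 1 / 2) + 1 = ((n + μ + 2 : ℤ) : ℝ) by push_cast; ring]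
  simp [qn]

theorem e_ket {q : ℝ} (hq : 0 < q) (s : Bool) {n μ : ℤ} (h1 : -(n + 1) ≤ μ) (h2 : μ ≤ n) :
    uqGenOp q .e (ket s n μ) = (√(qn q (n - μ + 1) * qn q (n + μ + 1)) : ℂ) • ket s n (μ - 1) := by
  rw [uqGenOp, shiftOp_ket' _ _ _ _ s n μ _ _ rfl rfl h1 h2,
    show (n : ℝ) + 1 / 2 - (μ + 1 / 2) + 1 = ((n - μ + 1 : ℤ) : ℝ) by push_cast; ring,
    show (n : ℝ) + 1 / 2 + (μ + 1 / 2) = ((n + μ + 1 : ℤ) : ℝ) by push_cast; ring]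
  simp [qn, sub_eq_add_neg]

theorem fe_eq {q : ℝ} (hq : 0 < q) :
    uqGenOp q .f * uqGenOp q .e = Band.diagOp fun n μ => qn q (n - μ + 1) * qn q (n + μ + 1) := by
  apply end_ext
  intro s n μ h1 h2
  have hn := mul_nonneg (qn_nonneg hq (k := n - μ + 1) (by omega)) (qn_nonneg hq (k := n + μ + 1) (by omega))
  rw [Module.End.mul_apply, e_ket hq s h1 h2, Band.diagOp_ket, map_smul]
  by_cases hv : -(n + 1) ≤ μ - 1
  · rw [f_ket hq s hv (by omega), smul_smul, show n - (μ - 1) = n - μ + 1 by ring,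
      show n + (μ - 1) + 2 = n + μ + 1 by ring, sub_add_cancel, ← Complex.ofReal_mul,
      Real.mul_self_sqrt hn]
  · rw [show n + μ + 1 = 0 by omega, qn_zero, ket_eq_zero (μ := μ - 1) (by omega)]
    simp

theorem ef_eq {q : ℝ} (hq : 0 < q) :
    uqGenOp q .e * uqGenOp q .f = Band.diagOp fun n μ => qn q (n - μ) * qn q (n + μ + 2) := by
  apply end_ext
  intro s n μ h1 h2
  have hn := mul_nonneg (qn_nonneg hq (k := n - μ) (by omega)) (qn_nonneg hq (k := n + μ + 2) (by omega))
  rw [Module.End.mul_apply, f_ket hq s h1 h2, Band.diagOp_ket, map_smul]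
  by_cases hv : μ + 1 ≤ n
  · rw [e_ket hq s (by omega) hv, smul_smul, show n - (μ + 1) + 1 = n - μ by ring,
      show n + (μ + 1) + 1 = n + μ + 2 by ring, add_sub_cancel_right, ← Complex.ofReal_mul,
      Real.mul_self_sqrt hn]
  · rw [show n - μ = 0 by omega, qn_zero, ket_eq_zero (μ := μ + 1) (by omega)]
    simp

theorem rho_gen {q : ℝ} (hq : 0 < q) (g : UqGen) :
    rho q hq (RingQuot.mkAlgHom ℂ (UqRel q) (FreeAlgebra.ι ℂ g)) = uqGenOp q g := by
  rw [rho, RingQuot.liftAlgHom_mkAlgHom_apply, FreeAlgebra.lift_ι_apply]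

theorem piV_gen {q : ℝ} (hq : 0 < q) (g : SphereGen) :
    piV q hq (RingQuot.mkAlgHom ℂ (SphereRel q) (FreeAlgebra.ι ℂ g)) = sphereGenOp q g := by
  rw [piV, RingQuot.liftAlgHom_mkAlgHom_apply, FreeAlgebra.lift_ι_apply]

theorem diagOp_apply (w : ℤ → ℤ → ℝ) (v : VV) : ⇑(Band.diagOp w v) = fun j => (w j.n j.μ : ℂ) * v j := by
  funext j
  induction v using ket_induction with
  | h0 => simp
  | hadd v w hv hw => rw [map_add, Finsupp.add_apply, hv, hw, Finsupp.add_apply, mul_add]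
  | hket c s n μ h1 h2 =>
    rw [map_smul, Band.diagOp_ket]
    simp only [Finsupp.smul_apply, ket_apply, smul_eq_mul]
    split_ifs with h
    · rw [h.2.1, h.2.2]; ring
    · simp

/-! ### The commutation relations determine the operator on `V ⊕ V` -/

/-- The restriction to `V ⊕ V` of an operator whose domain contains `V ⊕ V`. -/
noncomputable def onV {D : HH →ₗ.[ℂ] HH} (h : ∀ v : VV, incl v ∈ D.domain) : VV →ₗ[ℂ] HH :=
  D.toFun ∘ₗ incl.codRestrict D.domain h

/-- An equivariant odd operator maps `|l,m⟩_s` to a multiple of `|l,m⟩_{-s}`. -/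
theorem onV_ket_of_equivariant {q : ℝ} (hq : 0 < q) {D : HH →ₗ.[ℂ] HH}
    (hdom : ∀ v : VV, incl v ∈ D.domain)
    (heq : ∀ h : Uq q, Intertwines (rho q hq h) (onV hdom))
    (hodd : ∀ x : D.domain, ∃ h : gamma x ∈ D.domain, D ⟨gamma x, h⟩ = -gamma (D x))
    (s : Bool) (n μ : ℤ) :
    onV hdom (ket s n μ) = incl (coord (!s) n μ (onV hdom (ket s n μ)) • ket (!s) n μ) := by
  by_cases hv : -(n + 1) ≤ μ ∧ μ ≤ n
  swap
  · simp [ket_eq_zero hv]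
  obtain ⟨h1, h2⟩ := hv
  have diag : ∀ (w : ℤ → ℤ → ℝ) (u : Uq q), rho q hq u = Band.diagOp w → ∀ j : Idx,
      (w n μ : ℂ) * onV hdom (ket s n μ) j = w j.n j.μ * onV hdom (ket s n μ) j := by
    intro w u hu j
    have hc : Continuous fun (x : Idx → ℂ) (j : Idx) => (w j.n j.μ : ℂ) * x j :=
      continuous_pi fun j => continuous_const.mul (continuous_apply j)
    have h := heq u (ket s n μ)
    rw [hu] at h
    have := congrFun (CoordContinuous.eq_of_mem_closure hc (diagOp_apply w) h) j
    rw [← this, Band.diagOp_ket, map_smul]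
    rfl
  have hfe := diag _ (RingQuot.mkAlgHom ℂ (UqRel q) (FreeAlgebra.ι ℂ .f) *
    RingQuot.mkAlgHom ℂ (UqRel q) (FreeAlgebra.ι ℂ .e)) (by rw [map_mul, rho_gen, rho_gen, fe_eq hq])
  have hef := diag _ (RingQuot.mkAlgHom ℂ (UqRel q) (FreeAlgebra.ι ℂ .e) *
    RingQuot.mkAlgHom ℂ (UqRel q) (FreeAlgebra.ι ℂ .f)) (by rw [map_mul, rho_gen, rho_gen, ef_eq hq])
  have hγ : ∀ j : Idx, j.sgn = s → onV hdom (ket s n μ) j = 0 := by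
    intro j hj
    obtain ⟨hm, e⟩ := hodd ⟨incl (ket s n μ), hdom _⟩
    have e1 : gamma (incl (ket s n μ)) = (if s then 1 else -1 : ℂ) • incl (ket s n μ) := by
      apply lp.ext
      funext i
      change (if i.sgn then 1 else -1 : ℂ) * incl (ket s n μ) i =
        (if s then 1 else -1 : ℂ) * incl (ket s n μ) i
      rw [incl_apply, ket_apply]
      by_cases h : s = i.sgn ∧ n = i.n ∧ μ = i.μ
      · rw [h.1]
      · rw [if_neg h, mul_zero, mul_zero]
    have e2 : D ⟨gamma (incl (ket s n μ)), hm⟩ =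
        (if s then 1 else -1 : ℂ) • D ⟨incl (ket s n μ), hdom _⟩ := by
      rw [← LinearPMap.map_smul]
      congr 1
      exact Subtype.ext e1
    rw [e2] at e
    have e3 : (if s then 1 else -1 : ℂ) * onV hdom (ket s n μ) j =
        -((if j.sgn then 1 else -1 : ℂ) * onV hdom (ket s n μ) j) :=
      congrArg (fun x : HH => x j) e
    rw [hj] at e3
    have hε : (if s then 1 else -1 : ℂ) ≠ 0 := by split_ifs <;> simp
    exact (mul_eq_zero.1 (by linear_combination e3 / 2)).resolve_left hε
  apply lp.ext
  funext j
  rw [incl_apply, Finsupp.smul_apply, ket_apply, smul_eq_mul]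
  split_ifs with hj
  · obtain ⟨ha, rfl, rfl⟩ := hj
    rw [mul_one, ha, coord_self]
  · rw [mul_zero]
    by_contra hne
    obtain ⟨rfl, rfl⟩ := labels_eq_of_casimir hq h1 h2 j.lower j.upper
      (by exact_mod_cast mul_right_cancel₀ hne (hfe j)) (by exact_mod_cast mul_right_cancel₀ hne (hef j))
    refine hj ⟨?_, rfl, rfl⟩
    by_contra hs
    exact hne (hγ j (by revert hs; cases s <;> cases j.sgn <;> simp))

/-- The coefficient in `onV_ket_of_equivariant` depends on `s` and `l` only. -/
theorem coord_onV_eq_of_equivariant {q : ℝ} (hq : 0 < q) {D : HH →ₗ.[ℂ] HH}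
    (hdom : ∀ v : VV, incl v ∈ D.domain)
    (heq : ∀ h : Uq q, Intertwines (rho q hq h) (onV hdom))
    {d : Bool → ℤ → ℤ → ℂ}
    (hd : ∀ s n μ, onV hdom (ket s n μ) = incl (d s n μ • ket (!s) n μ))
    (s : Bool) {n μ : ℤ} (h1 : -(n + 1) ≤ μ) (h2 : μ ≤ n) :
    d s n μ = d s n (-(n + 1)) := by
  induction μ, h1 using Int.leInduction with
  | base => rfl
  | succ μ h1 ih =>
    rw [← ih (by omega)]
    have hs : (√(qn q (n - μ) * qn q (n + μ + 2)) : ℂ) ≠ 0 := by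
      have := Real.sqrt_pos.2 (mul_pos (qn_pos hq (k := n - μ) (by omega))
        (qn_pos hq (k := n + μ + 2) (by omega)))
      exact_mod_cast this.ne'
    have h := heq (RingQuot.mkAlgHom ℂ (UqRel q) (FreeAlgebra.ι ℂ .f))
    rw [rho_gen] at h
    have h := h.eq (coordContinuous_uqGenOp q .f) (hd s n μ)
    rw [map_smul, f_ket hq s h1 (by omega), f_ket hq (!s) h1 (by omega), map_smul, hd, ← map_smul] at h
    have h := congrArg (coord (!s) n (μ + 1)) (congrArg DFunLike.coe (incl_injective h))
    simp only [Finsupp.coe_smul, coord_smul, coord_ket (s' := !s) (n' := n) (μ' := μ + 1) (by omega)] at h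
    simp only [and_self, if_true, mul_one] at h
    rw [mul_comm] at h
    exact mul_right_cancel₀ hs h

/-- Commutation with `J` makes the two off-diagonal blocks adjoint to each other. -/
theorem coeff_conj_of_real {p : ℝ} (hp : 0 < p) {D : HH →ₗ.[ℂ] HH}
    (hdom : ∀ v : VV, incl v ∈ D.domain) (hJ : Intertwines (J p) (onV hdom))
    {d : Bool → ℤ → ℤ → ℂ}
    (hd : ∀ s n μ, onV hdom (ket s n μ) = incl (d s n μ • ket (!s) n μ))
    (s : Bool) {n μ : ℤ} (h1 : -(n + 1) ≤ μ) (h2 : μ ≤ n) :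
    d (!s) n (-μ - 1) = starRingEnd ℂ (d s n μ) := by
  have h := hJ.eq (coordContinuous_J p) (hd s n μ)
  rw [LinearMap.map_smulₛₗ, J_ket, J_ket, map_smul, hd, ← map_smul] at h
  have h := congrArg (coord (!!s) n (-μ - 1)) (congrArg DFunLike.coe (incl_injective h))
  simp only [Finsupp.coe_smul, coord_smul, coord_ket (s' := !!s) (n' := n) (μ' := -μ - 1) (by omega)] at h
  simp only [and_self, if_true, mul_one] at h
  rw [mul_comm] at h
  refine mul_right_cancel₀ (mul_ne_zero (zpow_ne_zero _ Complex.I_ne_zero) ?_) h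
  exact_mod_cast (Real.rpow_pos_of_pos hp _).ne'

theorem diracV_add_ket (δ δ' : ℤ → ℝ) (s : Bool) (n μ : ℤ) :
    (diracV δ 1 + diracV δ' Complex.I) (ket s n μ) =
      (if s then (δ n + δ' n * Complex.I) else starRingEnd ℂ (δ n + δ' n * Complex.I)) •
        ket (!s) n μ := by
  rw [LinearMap.add_apply, diracV_ket, diracV_ket, ← add_smul]
  congr 1
  cases s <;> simp <;> ring

/-- The restriction to `V ⊕ V` of an operator that satisfies the symmetry conditions. -/
theorem exists_onV_eq_diracV {q : ℝ} (hq : 0 < q) {p : ℝ} (hp : 0 < p) {D : HH →ₗ.[ℂ] HH}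
    (h : IsDirac q hq p D) : ∃ δ δ' : ℤ → ℝ,
      ∀ v, onV h.domain v = incl ((diracV δ 1 + diracV δ' Complex.I) v) := by
  obtain ⟨d, hd⟩ : ∃ d : Bool → ℤ → ℤ → ℂ,
      ∀ s n μ, onV h.domain (ket s n μ) = incl (d s n μ • ket (!s) n μ) :=
    ⟨_, onV_ket_of_equivariant hq h.domain h.equivariant h.odd⟩
  refine ⟨fun n => (d true n (-(n + 1))).re, fun n => (d true n (-(n + 1))).im, fun v => ?_⟩
  induction v using ket_induction with
  | h0 => simp
  | hadd v w hv hw => simp only [map_add, hv, hw]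
  | hket c s n μ h1 h2 =>
    rw [map_smul, map_smul, map_smul, diracV_add_ket, hd, Complex.re_add_im]
    congr 3
    cases s
    · have := coeff_conj_of_real hp h.domain h.real hd true h1 h2
      rw [coord_onV_eq_of_equivariant hq h.domain h.equivariant hd true h1 h2, Bool.not_true,
        coord_onV_eq_of_equivariant hq h.domain h.equivariant hd false (by omega) (by omega),
        ← coord_onV_eq_of_equivariant hq h.domain h.equivariant hd false h1 h2] at this
      exact this
    · exact coord_onV_eq_of_equivariant hq h.domain h.equivariant hd true h1 h2

/-! ### The first-order condition determines the eigenvalues -/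

theorem coord_ket_of_target {s : Bool} {n μ : ℤ} (h : -(n + 1) ≤ μ ∧ μ ≤ n) (s' : Bool) (n' μ' : ℤ) :
    coord s n μ (ket s' n' μ') = if s' = s ∧ n' = n ∧ μ' = μ then 1 else 0 := by
  rw [coord, dif_pos h, ket_apply]

theorem diracV_apply (δ : ℤ → ℝ) (z : ℂ) (v : VV) (j : Idx) :
    diracV δ z v j = (if j.sgn then starRingEnd ℂ z else z) * δ j.n * v j.swap := by
  induction v using ket_induction with
  | h0 => simp
  | hadd v w hv hw => rw [map_add, Finsupp.add_apply, hv, hw, Finsupp.add_apply, mul_add]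
  | hket c s n μ h1 h2 =>
    rw [map_smul, diracV_ket]
    simp only [Finsupp.smul_apply, ket_apply, smul_eq_mul, Idx.swap]
    by_cases hj : n = j.n ∧ μ = j.μ
    · obtain ⟨rfl, rfl⟩ := hj
      cases s <;> cases j.sgn <;> simp <;> ring
    · rw [if_neg (show ¬((!s) = j.sgn ∧ n = j.n ∧ μ = j.μ) from fun h => hj h.2),
        if_neg (show ¬(s = (!j.sgn) ∧ n = j.n ∧ μ = j.μ) from fun h => hj h.2)]
      ring

theorem diracV_mul_diagOp (δ : ℤ → ℝ) (z : ℂ) (w : ℤ → ℤ → ℝ) (v : VV) :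
    diracV δ z (Band.diagOp w v) = Band.diagOp w (diracV δ z v) := by
  ext j
  simp only [diracV_apply, diagOp_apply, Idx.swap]
  ring

theorem diagOp_injective {w : ℤ → ℤ → ℝ} (hw : ∀ n μ, w n μ ≠ 0) :
    Function.Injective (Band.diagOp w) := by
  intro u v h
  ext j
  have := congrArg (fun f : VV => f j) h
  simp only [diagOp_apply] at this
  exact mul_left_cancel₀ (Complex.ofReal_ne_zero.2 (hw _ _)) this

/-- The failure of the first-order condition for `δ` and the pair `(B, B*)`, in the rational model. -/
noncomputable def firstOrderDefect (q : ℝ) (δ : ℤ → ℝ) : Module.End ℂ VV :=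
  ((rat q B).comm δ).op * (rat q Bstar).refl.op -
    (rat q Bstar).refl.exch.op * ((rat q B).comm δ).op

theorem coord_firstOrderDefect {q : ℝ} (hq : 0 < q) (δ : ℤ → ℝ) {n : ℤ} (hn : 0 ≤ n) :
    coord true (n + 1) (n + 1) (firstOrderDefect q δ (ket true n (n - 1))) =
      ((-(q ^ n * (qn q 3 + qn q 5) / (qn q (2 * n + 1) * qn q (2 * n + 3) * qn q (2 * n + 5))) *
      (qn q (n + 1) * δ (n + 1) - qn q (n + 2) * δ n) : ℝ) : ℂ) := by
  have h1 : qn q (n - (n - 1)) = 1 := by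
    rw [show n - (n - 1) = 1 by ring, qn_one hq]
  have key := recursion_component hq δ n (n - 1)
  rw [h1, mul_one] at key
  rw [← key, firstOrderDefect, LinearMap.sub_apply,
    Band.op_mul_ket _ (rat_proper q Bstar).refl true (by omega) (by omega),
    Band.op_mul_ket _ ((rat_proper q B).comm δ) true (by omega) (by omega)]
  have d1 : (rat q Bstar).refl.d = 1 := rfl
  have d2 : ((rat q B).comm δ).d = 1 := rfl
  have d3 : (rat q Bstar).refl.exch.d = 1 := rfl
  have hv : -(n + 1 + 1) ≤ n + 1 ∧ n + 1 ≤ n + 1 := by omega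
  simp only [d1, d2, d3, sub_eq_add_neg, ← neg_one_smul ℂ (_ + _ : VV), Finsupp.coe_add, Finsupp.coe_smul,
    coord_add, coord_smul, coord_ket_of_target hv]
  have e1 : n + 2 ≠ n + 1 := by omega
  have e2 : n ≠ n + 1 := by omega
  have e3 : n + -1 ≠ n + 1 := by omega
  have e4 : n + -2 ≠ n + 1 := by omega
  have e5 : n + -1 + (1 + 1) = n + 1 := by omega
  simp only [e1, e2, e3, e4, e5, false_and, and_false, if_false, and_self, if_true, mul_zero, mul_one,
    add_zero, zero_add]
  push_cast
  ring

/-- The recursion `[n+1] δ(n+1) = [n+2] δ(n)` for the coefficients of an operator that satisfies the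
first-order condition. -/
theorem recursion_of_firstOrder {q : ℝ} (hq : 0 < q) {p : ℝ} (hp : 0 < p) {δ δ' : ℤ → ℝ}
    {D : Module.End ℂ VV} (hD : D = diracV δ 1 + diracV δ' Complex.I)
    (h : ∀ v, D (sphereGenOp q B (conjJ hp (sphereGenOp q Bstar) v)) -
        sphereGenOp q B (D (conjJ hp (sphereGenOp q Bstar) v)) =
      conjJ hp (sphereGenOp q Bstar) (D (sphereGenOp q B v) - sphereGenOp q B (D v)))
    {n : ℤ} (hn : 0 ≤ n) :
    qn q (n + 1) * δ (n + 1) = qn q (n + 2) * δ n ∧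
      qn q (n + 1) * δ' (n + 1) = qn q (n + 2) * δ' n := by
  set b := (gen q Bstar).refl with hb
  have ra := gen_rescale hq B
  have rb := (gen_rescale hq Bstar).refl (wt_refl q)
  have hpc : (-(p : ℂ)) ^ (gen q Bstar).d ≠ 0 :=
    zpow_ne_zero _ (neg_ne_zero.2 (by exact_mod_cast hp.ne'))
  have hC : ∀ v, D (sphereGenOp q B v) - sphereGenOp q B (D v) =
      diracV 1 1 (((gen q B).comm δ).op v) + diracV 1 Complex.I (((gen q B).comm δ').op v) := by
    intro v
    have e1 := LinearMap.congr_fun (diracV_commutator δ 1 (gen q B)) v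
    have e2 := LinearMap.congr_fun (diracV_commutator δ' Complex.I (gen q B)) v
    simp only [LinearMap.sub_apply, Module.End.mul_apply] at e1 e2
    rw [← e1, ← e2, hD, sphereGenOp_eq, LinearMap.add_apply, LinearMap.add_apply, map_add]
    abel
  have h2 : ∀ v, diracV 1 1 (((gen q B).comm δ).op (b.op v)) +
        diracV 1 Complex.I (((gen q B).comm δ').op (b.op v)) =
      b.op (diracV 1 1 (((gen q B).comm δ).op v) + diracV 1 Complex.I (((gen q B).comm δ').op v)) := by
    intro v
    have := h v
    rw [hC, hC, sphereGenOp_eq, conjJ_op] at this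
    simp only [LinearMap.smul_apply, LinearMap.map_smul, ← smul_add] at this
    exact smul_right_injective VV hpc this
  -- passage to the rational model
  have h3 : ∀ v, diracV 1 1 (firstOrderDefect q δ v) + diracV 1 Complex.I (firstOrderDefect q δ' v) = 0 := by
    intro v
    have := h2 (Band.diagOp (wt q) v)
    have eb := fun v => LinearMap.congr_fun rb.op v
    have ea := fun v => LinearMap.congr_fun (ra.comm δ).op v
    have ea' := fun v => LinearMap.congr_fun (ra.comm δ').op v
    have ex := fun z v => LinearMap.congr_fun (diracV_one_mul_op z (rat q Bstar).refl.exch) v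
    simp only [Module.End.mul_apply] at eb ea ea' ex
    have ex' : ∀ z v, (rat q Bstar).refl.op (diracV 1 z v) = diracV 1 z ((rat q Bstar).refl.exch.op v) := by
      intro z v
      rw [ex]
      simp only [Band.exch, Bool.not_not]
    rw [eb, ea, ea', ea, ea', diracV_mul_diagOp, diracV_mul_diagOp, diracV_mul_diagOp, diracV_mul_diagOp,
      ← map_add, ← map_add, eb] at this
    have := diagOp_injective (fun n μ => (wt_pos hq n μ).ne') this
    rw [map_add, ex', ex'] at this
    simp only [firstOrderDefect, LinearMap.sub_apply, Module.End.mul_apply, map_sub]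
    rw [← sub_eq_zero] at this
    rw [← this]
    abel
  have h4 := congrArg (fun f : VV => coord false (n + 1) (n + 1) f) (h3 (ket true n (n - 1)))
  have hv : -(n + 1 + 1) ≤ n + 1 ∧ n + 1 ≤ n + 1 := by omega
  have hc : ∀ (z : ℂ) (v : VV), coord false (n + 1) (n + 1) (diracV 1 z v) =
      z * coord true (n + 1) (n + 1) v := by
    intro z v
    rw [coord, dif_pos hv, coord, dif_pos hv, diracV_apply]
    simp [Idx.swap]
  simp only [Finsupp.coe_add, coord_add, hc, coord_firstOrderDefect hq _ hn] at h4
  rw [coord, dif_pos hv, Finsupp.coe_zero, Pi.zero_apply, one_mul] at h4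
  have hre := congrArg Complex.re h4
  have him := congrArg Complex.im h4
  simp only [Complex.add_re, Complex.add_im, Complex.mul_re, Complex.mul_im, Complex.I_re, Complex.I_im,
    Complex.ofReal_re, Complex.ofReal_im, zero_mul, mul_zero, one_mul, sub_zero, add_zero, zero_add,
    Complex.zero_re, Complex.zero_im] at hre him
  have hk : -(q ^ n * (qn q 3 + qn q 5) / (qn q (2 * n + 1) * qn q (2 * n + 3) * qn q (2 * n + 5))) ≠ 0 := by
    have := qn_pos hq (k := 3) (by norm_num)
    have := qn_pos hq (k := 5) (by norm_num)
    have := qn_pos hq (k := 2 * n + 1) (by omega)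
    have := qn_pos hq (k := 2 * n + 3) (by omega)
    have := qn_pos hq (k := 2 * n + 5) (by omega)
    have := zpow_pos hq n
    exact neg_ne_zero.2 (by positivity)
  exact ⟨sub_eq_zero.1 ((mul_eq_zero.1 hre).resolve_left hk),
    sub_eq_zero.1 ((mul_eq_zero.1 him).resolve_left hk)⟩

theorem eq_qn_mul_of_recursion {q : ℝ} (hq : 0 < q) {δ : ℤ → ℝ}
    (h : ∀ n, 0 ≤ n → qn q (n + 1) * δ (n + 1) = qn q (n + 2) * δ n) {n : ℤ} (hn : 0 ≤ n) :
    δ n = qn q (n + 1) * δ 0 := by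
  induction n, hn using Int.leInduction with
  | base => rw [zero_add, qn_one hq, one_mul]
  | succ n hn ih =>
    have h1 := qn_pos hq (k := n + 1) (by omega)
    have h2 := h n hn
    rw [ih] at h2
    rw [show n + 1 + 1 = n + 2 by ring]
    apply mul_left_cancel₀ h1.ne'
    rw [h2]
    ring

/-- On `V ⊕ V`, a Dirac operator has the eigenvalue pattern `[l + 1/2]`. -/
theorem exists_onV_eq_diracEig {q : ℝ} (hq : 0 < q) {p : ℝ} (hp : 0 < p) {D : HH →ₗ.[ℂ] HH}
    (h : IsDirac q hq p D) : ∃ z : ℂ, ∀ v, onV h.domain v = incl (diracV (diracEig q) z v) := by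
  obtain ⟨δ, δ', hD⟩ := exists_onV_eq_diracV hq hp h
  have hT : ∀ v, D ⟨incl (sphereGenOp q B v), h.domain _⟩ -
      piH q hq (RingQuot.mkAlgHom ℂ (SphereRel q) (FreeAlgebra.ι ℂ B)) (D ⟨incl v, h.domain v⟩) =
      incl ((diracV δ 1 + diracV δ' Complex.I) (sphereGenOp q B v) -
        sphereGenOp q B ((diracV δ 1 + diracV δ' Complex.I) v)) := by
    intro v
    change onV h.domain (sphereGenOp q B v) - piH q hq _ (onV h.domain v) = _
    rw [hD, hD, piH_incl, piV_gen, map_sub]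
  have hFO := h.firstOrder (RingQuot.mkAlgHom ℂ (SphereRel q) (FreeAlgebra.ι ℂ B))
    (RingQuot.mkAlgHom ℂ (SphereRel q) (FreeAlgebra.ι ℂ Bstar))
  simp only [piV_gen] at hFO
  have hcc : CoordContinuous fun v => J p (sphereGenOp q Bstar (J p v)) := by
    rw [sphereGenOp_eq]
    exact (coordContinuous_J p).comp ((Band.coordContinuous_op _).comp (coordContinuous_J p))
  have hrec := fun (n : ℤ) (hn : 0 ≤ n) => recursion_of_firstOrder hq hp (δ := δ) (δ' := δ') rfl (by
    intro v
    have := hFO.eq hcc (hT v)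
    rw [hT] at this
    have := incl_injective this
    rw [conjJ_apply, conjJ_apply]
    simp only [map_neg] at this ⊢
    rw [← this]
    abel) hn
  refine ⟨δ 0 + δ' 0 * Complex.I, fun v => ?_⟩
  rw [hD]
  congr 1
  induction v using ket_induction with
  | h0 => simp
  | hadd v w hv hw => simp only [map_add, hv, hw]
  | hket c s n μ h1 h2 =>
    have hn : 0 ≤ n := by omega
    rw [map_smul, map_smul, diracV_add_ket, diracV_ket, eq_qn_mul_of_recursion hq (fun n hn => (hrec n hn).1) hn,
      eq_qn_mul_of_recursion hq (fun n hn => (hrec n hn).2) hn, diracEig]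
    congr 2
    cases s <;> simp <;> ring

/-! ### The operators `diracOp q z` -/

theorem Idx.swap_swap (i : Idx) : i.swap.swap = i := by
  simp [Idx.swap]

theorem diracEntry_eq (q : ℝ) (z : ℂ) (i : Idx) :
    diracEntry q z i = (if i.sgn then starRingEnd ℂ z else z) * diracEig q i.n := by
  rw [diracEntry, diracEig, qn, Idx.l]
  congr 3
  push_cast
  ring

theorem diracEntry_swap (q : ℝ) (z : ℂ) (i : Idx) :
    diracEntry q z i.swap = starRingEnd ℂ (diracEntry q z i) := by
  rw [diracEntry_eq, diracEntry_eq]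
  cases h : i.sgn <;> simp [Idx.swap, h]

theorem diracOp_apply (q : ℝ) (z : ℂ) (x : (diracOp q z).domain) (i : Idx) :
    diracOp q z x i = diracEntry q z i * (x : HH) i.swap := rfl

theorem mem_diracOp {q : ℝ} {z : ℂ} {x y : HH} (h : ∀ i, y i = diracEntry q z i * x i.swap) :
    x ∈ (diracOp q z).domain := by
  have : (fun i : Idx => diracEntry q z i * x i.swap) = ⇑y := funext fun i => (h i).symm
  change Memℓp (fun i : Idx => diracEntry q z i * x i.swap) 2
  rw [this]
  exact lp.memℓp y

theorem incl_diracV_apply (q : ℝ) (z : ℂ) (v : VV) (i : Idx) :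
    incl (diracV (diracEig q) z v) i = diracEntry q z i * incl v i.swap := by
  rw [incl_apply, incl_apply, diracV_apply, diracEntry_eq]

theorem incl_mem_diracOp (q : ℝ) (z : ℂ) (v : VV) : incl v ∈ (diracOp q z).domain :=
  mem_diracOp (incl_diracV_apply q z v)

theorem diracOp_incl (q : ℝ) (z : ℂ) (v : VV) :
    diracOp q z ⟨incl v, incl_mem_diracOp q z v⟩ = incl (diracV (diracEig q) z v) := by
  apply lp.ext
  funext i
  rw [diracOp_apply, incl_diracV_apply]

theorem dense_diracOp (q : ℝ) (z : ℂ) : Dense ((diracOp q z).domain : Set HH) :=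
  incl_dense.mono (by rintro _ ⟨v, rfl⟩; exact incl_mem_diracOp q z v)

theorem diracOp_symmetric (q : ℝ) (z : ℂ) : (diracOp q z).IsFormalAdjoint (diracOp q z) := by
  intro x y
  rw [lp.inner_eq_tsum, lp.inner_eq_tsum,
    ← (Function.Involutive.toPerm Idx.swap Idx.swap_swap).tsum_eq]
  refine tsum_congr fun i => ?_
  change inner ℂ (diracOp q z x i.swap) ((y : HH) i.swap) = inner ℂ ((x : HH) i) (diracOp q z y i)
  rw [diracOp_apply, diracOp_apply, Idx.swap_swap, diracEntry_swap]
  simp only [RCLike.inner_apply, map_mul, Complex.conj_conj]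
  ring

/-- `diracOp q z` is the largest operator with a given behaviour against `V ⊕ V`. -/
theorem le_diracOp {q : ℝ} {z : ℂ} {T : HH →ₗ.[ℂ] HH}
    (h : ∀ (x : T.domain) (v : VV), inner ℂ (T x) (incl v) = inner ℂ (x : HH) (incl (diracV (diracEig q) z v))) :
    T ≤ diracOp q z := by
  have key : ∀ (x : T.domain) (i : Idx), T x i = diracEntry q z i * (x : HH) i.swap := by
    intro x i
    have e := h x (ket i.sgn i.n i.μ)
    have hi : ket i.sgn i.n i.μ = Finsupp.single i 1 := ket_valid ⟨i.lower, i.upper⟩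
    have hs : ket (!i.sgn) i.n i.μ = Finsupp.single i.swap 1 := ket_valid ⟨i.lower, i.upper⟩
    rw [diracV_ket, hi, hs, map_smul, incl_single, incl_single, inner_smul_right, lp.inner_single_right,
      lp.inner_single_right] at e
    simp only [RCLike.inner_apply, one_mul] at e
    have e := congrArg (starRingEnd ℂ) e
    rw [map_mul, Complex.conj_conj, Complex.conj_conj] at e
    rw [e, diracEntry_eq]
    cases i.sgn <;> simp
  refine ⟨fun x hx => mem_diracOp (key ⟨x, hx⟩), fun x y hxy => ?_⟩
  apply lp.ext
  funext i
  rw [key, diracOp_apply, hxy]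

theorem diracOp_selfAdjoint (q : ℝ) (z : ℂ) : IsSelfAdjoint (diracOp q z) := by
  rw [LinearPMap.isSelfAdjoint_def]
  refine le_antisymm (le_diracOp fun x v => ?_) ((diracOp_symmetric q z).le_adjoint (dense_diracOp q z))
  rw [← diracOp_incl]
  exact LinearPMap.adjoint_isFormalAdjoint (dense_diracOp q z) x ⟨incl v, incl_mem_diracOp q z v⟩

/-- A self-adjoint operator is determined by its values on `V ⊕ V` if these are the ones of
`diracOp q z`. -/
theorem eq_diracOp_of_selfAdjoint {q : ℝ} {z : ℂ} {D : HH →ₗ.[ℂ] HH} (hD : IsSelfAdjoint D)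
    (hdom : ∀ v : VV, incl v ∈ D.domain)
    (h : ∀ v, D ⟨incl v, hdom v⟩ = incl (diracV (diracEig q) z v)) : D = diracOp q z := by
  have hA : LinearPMap.adjoint D = D := hD
  have hsymm : D.IsFormalAdjoint D := by
    have := LinearPMap.adjoint_isFormalAdjoint hD.dense_domain
    rwa [hA] at this
  have hle : D ≤ diracOp q z := le_diracOp fun x v => by
    rw [← h]
    exact hsymm x ⟨incl v, hdom v⟩
  refine le_antisymm hle ?_
  have : D.IsFormalAdjoint (diracOp q z) := by
    intro x y
    have hx : D x = diracOp q z ⟨x, hle.1 x.2⟩ := hle.2 rfl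
    rw [hx]
    exact diracOp_symmetric q z ⟨x, hle.1 x.2⟩ y
  have := this.le_adjoint hD.dense_domain
  rwa [hA] at this

theorem not_finiteDimensional_HH : ¬FiniteDimensional ℂ HH := by
  intro h
  have h1 : FiniteDimensional ℂ VV := FiniteDimensional.of_injective incl incl_injective
  have h2 : Finite Idx := by
    have := Module.finite_finsupp_self_iff (R := ℂ) (ι := Idx) |>.1 h1
    simpa [not_subsingleton] using this
  have : Function.Injective fun n : ℕ => (⟨true, n, 0, by omega, by omega⟩ : Idx) := by
    intro a b hab
    simpa using congrArg Idx.n hab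
  exact not_injective_infinite_finite _ this

theorem not_compactResolvent_diracOp_zero (q : ℝ) : ¬HasCompactResolvent (diracOp q 0) := by
  rintro ⟨c, R, hR, h1, -⟩
  apply not_finiteDimensional_HH
  have h0 : ∀ x : (diracOp q 0).domain, diracOp q 0 x = 0 := by
    intro x
    apply lp.ext
    funext i
    rw [diracOp_apply, diracEntry_eq]
    simp
  apply FiniteDimensional.of_isCompactOperator_id (𝕜 := ℂ)
  have : (id : HH → HH) = ⇑((-c) • R) := by
    funext x
    obtain ⟨h, hx⟩ := h1 x
    rw [h0, zero_sub, ← neg_smul] at hx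
    exact hx.symm
  rw [this]
  exact hR.smul (-c)

theorem eq_diracOp_of_isDirac {q : ℝ} (hq : 0 < q) {p : ℝ} (hp : 0 < p) {D : HH →ₗ.[ℂ] HH}
    (h : IsDirac q hq p D) : ∃ z : ℂ, z ≠ 0 ∧ D = diracOp q z := by
  obtain ⟨z, hz⟩ := exists_onV_eq_diracEig hq hp h
  have hD := eq_diracOp_of_selfAdjoint h.selfAdjoint h.domain hz
  refine ⟨z, ?_, hD⟩
  rintro rfl
  exact not_compactResolvent_diracOp_zero q (hD ▸ h.compactResolvent)

/-! ### Weighted translations and the compact resolvent -/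

/-- Weighted composition with a partially defined injective map of labels is bounded. -/
theorem exists_weighted (x : HH) {s : Set Idx} {e : Idx → Idx} (he : Set.InjOn e s) {c : Idx → ℂ} {K : ℝ}
    (hK : 0 ≤ K) (hc : ∀ j ∈ s, ‖c j‖ ≤ K) (hc' : ∀ j ∉ s, c j = 0) :
    ∃ y : HH, (∀ j, y j = c j * x (e j)) ∧ ‖y‖ ≤ K * ‖x‖ := by
  classical
  have two : (2 : ENNReal).toReal = 2 := by norm_num
  have key : ∀ t : Finset Idx, ∑ j ∈ t, ‖c j * x (e j)‖ ^ (2 : ENNReal).toReal ≤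
      (K * ‖x‖) ^ (2 : ENNReal).toReal := by
    intro t
    calc ∑ j ∈ t, ‖c j * x (e j)‖ ^ (2 : ENNReal).toReal
        = ∑ j ∈ t with j ∈ s, ‖c j * x (e j)‖ ^ (2 : ENNReal).toReal := by
          refine (Finset.sum_filter_of_ne fun j _ hj => ?_).symm
          by_contra h
          rw [hc' j h] at hj
          simp at hj
      _ ≤ ∑ j ∈ t with j ∈ s, K ^ (2 : ENNReal).toReal * ‖x (e j)‖ ^ (2 : ENNReal).toReal := by
          refine Finset.sum_le_sum fun j hj => ?_
          rw [norm_mul, Real.mul_rpow (norm_nonneg _) (norm_nonneg _)]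
          gcongr
          exact hc j (Finset.mem_filter.1 hj).2
      _ = K ^ (2 : ENNReal).toReal * ∑ i ∈ (t.filter (· ∈ s)).image e, ‖x i‖ ^ (2 : ENNReal).toReal := by
          rw [Finset.sum_image, Finset.mul_sum]
          intro a ha b hb hab
          simp only [Finset.coe_filter, Set.mem_ofPred_eq] at ha hb
          exact he ha.2 hb.2 hab
      _ ≤ K ^ (2 : ENNReal).toReal * ‖x‖ ^ (2 : ENNReal).toReal := by
          gcongr
          exact lp.sum_rpow_le_norm_rpow (by norm_num) x _
      _ = _ := (Real.mul_rpow hK (norm_nonneg _)).symm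
  exact ⟨⟨fun j => c j * x (e j), memℓp_gen' key⟩, fun j => rfl,
    lp.norm_le_of_forall_sum_le (by norm_num) (by positivity) key⟩

/-- The operator `x ↦ (c_j x_{swap j})_j` for a bounded family `c`. -/
noncomputable def mulSwap (c : Idx → ℂ) (K : ℝ) (hK : 0 ≤ K) (hc : ∀ j, ‖c j‖ ≤ K) : HH →L[ℂ] HH :=
  LinearMap.mkContinuous
    { toFun := fun x => ⟨fun j => c j * x j.swap, by
        obtain ⟨y, hy, -⟩ := exists_weighted x (s := Set.univ) (e := Idx.swap)
          (Function.Involutive.injective Idx.swap_swap).injOn hK (fun j _ => hc j)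
          (fun j hj => absurd (Set.mem_univ j) hj)
        rw [← funext hy]
        exact lp.memℓp y⟩
      map_add' := fun x y => by ext i; exact mul_add _ _ _
      map_smul' := fun a x => by ext i; exact mul_left_comm _ _ _ } K (by
    intro x
    obtain ⟨y, hy, hy'⟩ := exists_weighted x (s := Set.univ) (e := Idx.swap)
      (Function.Involutive.injective Idx.swap_swap).injOn hK (fun j _ => hc j)
      (fun j hj => absurd (Set.mem_univ j) hj)
    refine le_of_eq_of_le (congrArg norm (lp.ext (funext fun j => ?_))) hy'
    exact (hy j).symm)

theorem mulSwap_apply (c : Idx → ℂ) (K : ℝ) (hK : 0 ≤ K) (hc : ∀ j, ‖c j‖ ≤ K) (x : HH) (j : Idx) :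
    mulSwap c K hK hc x j = c j * x j.swap := rfl

theorem isCompactOperator_mulSwap (c : Idx → ℂ) (K : ℝ) (hK : 0 ≤ K) (hc : ∀ j, ‖c j‖ ≤ K)
    (h0 : Filter.Tendsto c Filter.cofinite (nhds 0)) : IsCompactOperator (mulSwap c K hK hc) := by
  classical
  let F : Finset Idx → HH →L[ℂ] HH := fun S => ∑ i ∈ S,
    (lp.singleContinuousLinearMap ℂ (fun _ : Idx => ℂ) 2 i).comp
      (c i • lp.evalCLM ℂ (fun _ : Idx => ℂ) 2 i.swap)
  have hF : ∀ S, IsCompactOperator (F S) := by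
    intro S
    have : F S ∈ compactOperator (RingHom.id ℂ) HH HH := by
      refine Submodule.sum_mem _ fun i _ => ?_
      exact (isCompactOperator_of_locallyCompactSpace_rng
        (lp.singleContinuousLinearMap ℂ (fun _ : Idx => ℂ) 2 i)).comp_clm _
    exact this
  have hFa : ∀ S x j, F S x j = if j ∈ S then c j * x j.swap else 0 := by
    intro S x j
    simp only [F, _root_.sum_apply, lp.coeFn_sum, Finset.sum_apply]
    rw [← Finset.sum_ite_eq S j fun i => c i * x i.swap]
    refine Finset.sum_congr rfl fun i _ => ?_
    change lp.single (E := fun _ : Idx => ℂ) 2 i (c i * x i.swap) j = _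
    rw [lp.single_apply, Pi.single_apply]
  refine isCompactOperator_of_tendsto (F := F) (l := Filter.atTop) ?_ (Filter.Eventually.of_forall hF)
  rw [Metric.tendsto_nhds]
  intro ε hε
  have hfin : {j : Idx | ¬ ‖c j‖ < ε / 2}.Finite := by
    have h0' := h0.norm
    rw [norm_zero] at h0'
    exact h0'.eventually_lt_const (half_pos hε)
  filter_upwards [Filter.eventually_ge_atTop hfin.toFinset] with S hS
  refine lt_of_le_of_lt ?_ (half_lt_self hε)
  rw [dist_eq_norm]
  refine ContinuousLinearMap.opNorm_le_bound _ (half_pos hε).le fun x => ?_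
  obtain ⟨y, hy, hy'⟩ := exists_weighted x (s := Set.univ) (e := Idx.swap)
    (c := fun j => if j ∈ S then 0 else -c j) (K := ε / 2)
    (Function.Involutive.injective Idx.swap_swap).injOn (half_pos hε).le (fun j _ => by
      split_ifs with hj
      · simpa using (half_pos hε).le
      · rw [norm_neg]
        by_contra hlt
        exact hj (hS (by simpa using (not_le.1 hlt).le)))
    (fun j hj => absurd (Set.mem_univ j) hj)
  refine le_of_eq_of_le (congrArg norm (lp.ext (funext fun j => ?_))) hy'
  rw [hy, _root_.sub_apply, lp.coeFn_sub, Pi.sub_apply, hFa, mulSwap_apply]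
  split_ifs <;> ring

theorem qn_ge {q : ℝ} (hq : 0 < q) (hq1 : q ≤ 1) {n : ℤ} (hn : 0 ≤ n) : (n : ℝ) ≤ qn q n := by
  induction n, hn using Int.leInduction with
  | base => simp [qn_zero]
  | succ k hk ih =>
    have h := qn_succ_sub hq k
    have hx : 0 < q ^ k := zpow_pos hq k
    have hx1 : q ^ k ≤ 1 := zpow_le_one₀ hq hq1 hk
    have e : q ^ (-k - 1) = (q ^ k)⁻¹ * q⁻¹ := by
      rw [show -k - 1 = -(k + 1) by ring, zpow_neg, zpow_add_one₀ hq.ne', mul_inv]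
    rw [e] at h
    generalize q ^ k = x at *
    have hy : 1 ≤ x⁻¹ := (one_le_inv₀ hx).2 hx1
    have hxy : x * x⁻¹ = 1 := mul_inv_cancel₀ hx.ne'
    have hqq : q * q⁻¹ = 1 := mul_inv_cancel₀ hq.ne'
    -- `q x + x⁻¹ - q - 1 = (1 - x) (x⁻¹ - q)`
    have h2 : 0 ≤ (1 - x) * (x⁻¹ - q) := mul_nonneg (by linarith) (by linarith)
    have h3 : (q + 1) * 1 ≤ (q + 1) * (qn q (k + 1) - qn q k) := by
      rw [h]
      linear_combination h2 - hxy - x⁻¹ * hqq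
    have := le_of_mul_le_mul_left h3 (by linarith)
    push_cast
    linarith

theorem tendsto_label : Filter.Tendsto (fun j : Idx => (j.n : ℝ)) Filter.cofinite Filter.atTop := by
  rw [Filter.tendsto_atTop]
  intro b
  obtain ⟨N, hN⟩ := exists_int_gt b
  have hinj : Function.Injective fun j : Idx => (j.sgn, j.n, j.μ) := by
    intro i j h
    simp only [Prod.mk.injEq] at h
    exact Idx.ext h.1 h.2.1 h.2.2
  have hfin : ((Set.univ : Set Bool) ×ˢ Set.Icc (0 : ℤ) N ×ˢ Set.Icc (-(N + 1)) N).Finite :=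
    Set.finite_univ.prod ((Set.finite_Icc _ _).prod (Set.finite_Icc _ _))
  refine (hfin.preimage hinj.injOn).subset fun j hj => ?_
  have hj' : (j.n : ℝ) < N := (not_le.1 (show ¬b ≤ j.n from hj)).trans hN
  have hjN : j.n < N := by exact_mod_cast hj'
  have h1 := j.lower
  have h2 := j.upper
  simp only [Set.mem_preimage, Set.mem_prod, Set.mem_univ, Set.mem_Icc, true_and]
  omega

theorem norm_diracEntry_ge {q : ℝ} (hq : 0 < q) (hq1 : q ≤ 1) (z : ℂ) (i : Idx) :
    ‖z‖ * (i.n + 1) ≤ ‖diracEntry q z i‖ := by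
  have hn : 0 ≤ i.n := by have := i.lower; have := i.upper; omega
  rw [diracEntry_eq, diracEig, norm_mul, Complex.norm_real, Real.norm_of_nonneg (qn_nonneg hq (by omega))]
  have : ‖(if i.sgn then starRingEnd ℂ z else z)‖ = ‖z‖ := by split_ifs <;> simp
  rw [this]
  have := qn_ge hq hq1 (n := i.n + 1) (by omega)
  push_cast at this
  gcongr

theorem diracOp_compactResolvent {q : ℝ} (hq : 0 < q) (hq1 : q ≤ 1) {z : ℂ} (hz : z ≠ 0) :
    HasCompactResolvent (diracOp q z) := by
  have hz' : 0 < ‖z‖ := norm_pos_iff.2 hz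
  have hn : ∀ j : Idx, (0 : ℝ) ≤ j.n := by
    intro j
    have : 0 ≤ j.n := by have := j.lower; have := j.upper; omega
    exact_mod_cast this
  have hb : ∀ j : Idx, ‖(diracEntry q z j.swap)⁻¹‖ ≤ ‖z‖⁻¹ * ((j.n : ℝ) + 1)⁻¹ := by
    intro j
    rw [norm_inv, ← mul_inv]
    exact inv_anti₀ (mul_pos hz' (by linarith [hn j])) (norm_diracEntry_ge hq hq1 z j.swap)
  have hb' : ∀ j : Idx, ‖(diracEntry q z j.swap)⁻¹‖ ≤ ‖z‖⁻¹ := fun j =>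
    (hb j).trans (mul_le_of_le_one_right (by positivity) (inv_le_one_of_one_le₀ (by linarith [hn j])))
  have h0 : ∀ j : Idx, diracEntry q z j ≠ 0 := by
    intro j
    rw [← norm_pos_iff]
    exact (mul_pos hz' (by linarith [hn j])).trans_le (norm_diracEntry_ge hq hq1 z j)
  have hlim : Filter.Tendsto (fun j : Idx => (diracEntry q z j.swap)⁻¹) Filter.cofinite (nhds 0) := by
    refine squeeze_zero_norm hb ?_
    have := (tendsto_inv_atTop_zero.comp
      (Filter.tendsto_atTop_add_const_right _ 1 tendsto_label)).const_mul ‖z‖⁻¹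
    simpa using this
  have hR : ∀ x i, x i = diracEntry q z i * mulSwap _ _ (by positivity) hb' x i.swap := by
    intro x i
    rw [mulSwap_apply, Idx.swap_swap, mul_inv_cancel_left₀ (h0 i)]
  refine ⟨0, mulSwap _ _ (by positivity) hb', isCompactOperator_mulSwap _ _ _ _ hlim,
    fun x => ⟨mem_diracOp (hR x), ?_⟩, fun x => ?_⟩
  · rw [zero_smul, sub_zero]
    apply lp.ext
    funext i
    rw [diracOp_apply]
    exact (hR x i).symm
  · rw [zero_smul, sub_zero]
    apply lp.ext
    funext i
    rw [mulSwap_apply, diracOp_apply, Idx.swap_swap, inv_mul_cancel_left₀ (h0 _)]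

/-! ### Symmetry, reality and first-order condition for `diracOp q z` -/

theorem diracV_mul_shiftOp (δ : ℤ → ℝ) (z : ℂ) (d : ℤ) (F : ℝ → ℝ → ℝ) :
    shiftOp d 0 (fun _ => F) 0 * diracV δ z = diracV δ z * shiftOp d 0 (fun _ => F) 0 := by
  apply end_ext
  intro s n μ h1 h2
  rw [Module.End.mul_apply, Module.End.mul_apply, diracV_ket, map_smul,
    shiftOp_ket' _ _ _ _ (!s) n μ _ _ rfl rfl h1 h2, shiftOp_ket' _ _ _ _ s n μ _ _ rfl rfl h1 h2]
  simp only [Pi.zero_apply, Complex.ofReal_zero, zero_smul, zero_add, add_zero, map_smul, diracV_ket]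
  rw [smul_comm]

theorem diracOp_equivariant {q : ℝ} (hq : 0 < q) (z : ℂ) (h : Uq q) :
    Intertwines (rho q hq h) fun v => diracOp q z ⟨incl v, incl_mem_diracOp q z v⟩ := by
  refine Intertwines.of_eq (S' := diracV (diracEig q) z) (diracOp_incl q z) fun v => ?_
  have hg : ∀ g, uqGenOp q g ∈ Subalgebra.centralizer ℂ {diracV (diracEig q) z} := by
    intro g
    rw [Subalgebra.mem_centralizer_iff]
    rintro _ rfl
    cases g <;> rw [uqGenOp] <;> exact (diracV_mul_shiftOp _ _ _ _).symm
  have := (Subalgebra.mem_centralizer_iff ℂ).1 (rho_mem hq hg h) _ rfl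
  exact LinearMap.congr_fun this v

theorem diracOp_odd (q : ℝ) (z : ℂ) (x : (diracOp q z).domain) :
    ∃ h : gamma x ∈ (diracOp q z).domain, diracOp q z ⟨gamma x, h⟩ = -gamma (diracOp q z x) := by
  have key : ∀ i, (-gamma (diracOp q z x) : HH) i = diracEntry q z i * gamma (x : HH) i.swap := by
    intro i
    change -((if i.sgn then 1 else -1 : ℂ) * diracOp q z x i) =
      diracEntry q z i * ((if !i.sgn then 1 else -1 : ℂ) * (x : HH) i.swap)
    rw [diracOp_apply]
    cases i.sgn <;> simp
  refine ⟨mem_diracOp key, ?_⟩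
  apply lp.ext
  funext i
  rw [diracOp_apply, key]

theorem diracOp_real (q : ℝ) (p : ℝ) (z : ℂ) :
    Intertwines (J p) fun v => diracOp q z ⟨incl v, incl_mem_diracOp q z v⟩ :=
  Intertwines.of_eq (S' := diracV (diracEig q) z) (diracOp_incl q z) (diracV_J p _ z)

theorem diracOp_firstOrder {q : ℝ} (hq : 0 < q) {p : ℝ} (hp : 0 < p) (z : ℂ) (α β : Sphere q) :
    Intertwines (fun v => J p (piV q hq β (J p v))) fun v =>
      diracOp q z ⟨incl (piV q hq α v), incl_mem_diracOp q z _⟩ -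
        piH q hq α (diracOp q z ⟨incl v, incl_mem_diracOp q z v⟩) := by
  refine Intertwines.of_eq
    (S' := ⇑(diracV (diracEig q) z * piV q hq α - piV q hq α * diracV (diracEig q) z))
    (fun v => ?_) fun v => ?_
  · rw [diracOp_incl, diracOp_incl, piH_incl, ← map_sub]
    rfl
  · have := LinearMap.congr_fun (firstOrder_diracV hq hp z α β).eq v
    rw [Module.End.mul_apply, Module.End.mul_apply, conjJ_apply, conjJ_apply, map_neg, neg_inj] at this
    exact this

/-! ### Estimates of q-integers -/

theorem qn_add {q : ℝ} (hq : 0 < q) (a b : ℤ) : qn q (a + b) = q ^ (-b) * qn q a + q ^ a * qn q b := by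
  by_cases h1 : q = 1
  · subst h1
    simp only [qn_classical, one_zpow]
    push_cast
    ring
  have hx : 0 < q ^ a := zpow_pos hq a
  have hy : 0 < q ^ b := zpow_pos hq b
  have hD : q ^ 2 - 1 ≠ 0 := by simpa using zpow_sq_ne hq h1 (k := 1) one_ne_zero
  rw [qn_eq hq h1 (zpow_add₀ hq.ne' a b), qn_eq hq h1 (k := a) rfl, qn_eq hq h1 (k := b) rfl, zpow_neg]
  generalize q ^ a = x at *
  generalize q ^ b = y at *
  field_simp
  ring

theorem zpow_neg_mul_qn_le {q : ℝ} (hq : 0 < q) {a b : ℤ} (hb : 0 ≤ b) :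
    q ^ (-b) * qn q a ≤ qn q (a + b) := by
  rw [qn_add hq]
  have := mul_nonneg (zpow_pos hq a).le (qn_nonneg hq hb)
  linarith

theorem zpow_mul_qn_le {q : ℝ} (hq : 0 < q) {a b : ℤ} (ha : 0 ≤ a) : q ^ a * qn q b ≤ qn q (a + b) := by
  rw [qn_add hq]
  have := mul_nonneg (zpow_pos hq (-b)).le (qn_nonneg hq ha)
  linarith

theorem zpow_mul_sqrt_le {q : ℝ} (hq : 0 < q) (hq1 : q ≤ 1) {a b c : ℤ} (ha : 0 ≤ a) (hb : 0 ≤ b)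
    (hc : a - b ≤ 2 * c) : q ^ c * √(qn q a * qn q b) ≤ qn q (a + b) := by
  have h1 := zpow_neg_mul_qn_le hq (a := a) hb
  have h2 := zpow_mul_qn_le hq (b := b) ha
  have na := qn_nonneg hq ha
  have nb := qn_nonneg hq hb
  have h3 := mul_le_mul h1 h2 (mul_nonneg (zpow_pos hq a).le nb) (qn_nonneg hq (k := a + b) (by omega))
  have h4 : q ^ (2 * c) ≤ q ^ (a - b) := zpow_le_zpow_right_of_le_one₀ hq hq1 hc
  rw [← pow_le_pow_iff_left₀ (mul_nonneg (zpow_pos hq c).le (Real.sqrt_nonneg _))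
    (qn_nonneg hq (k := a + b) (by omega)) two_ne_zero, mul_pow, Real.sq_sqrt (mul_nonneg na nb)]
  calc (q ^ c) ^ 2 * (qn q a * qn q b) = q ^ (2 * c) * (qn q a * qn q b) := by
        rw [mul_comm 2 c, zpow_mul]; norm_cast
    _ ≤ q ^ (a - b) * (qn q a * qn q b) := by gcongr
    _ = q ^ (-b) * qn q a * (q ^ a * qn q b) := by
        rw [sub_eq_add_neg, zpow_add₀ hq.ne']; ring
    _ ≤ qn q (a + b) ^ 2 := by rw [sq]; exact h3

theorem sqrt_mul_le {x y : ℝ} (hx : 0 ≤ x) (hy : 0 ≤ y) (h : x ≤ y) : √(x * y) ≤ y := by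
  rw [Real.sqrt_le_left hy, sq]
  gcongr

theorem aP_le {q : ℝ} (hq : 0 < q) {n : ℤ} (hn : -1 ≤ n) : aP q n ≤ q⁻¹ / qn q (2 * n + 3) := by
  have h := aP_sq hq (n := n + 1) (by omega)
  rw [add_sub_cancel_right, R] at h
  have hc := qn_pos hq (k := 2 * n + 3) (by omega)
  rw [show 2 * (n + 1) + 1 = 2 * n + 3 by ring] at h
  have hx : 0 < q ^ (n + 1 + 1) := zpow_pos hq _
  have hy : 0 < q ^ (n + 1) := zpow_pos hq _
  rw [show -2 * (n + 1) - 2 = -(n + 1 + 1) + (-(n + 1) + -1) by ring, zpow_add₀ hq.ne', zpow_add₀ hq.ne',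
    show -(n + 1) - 1 = -(n + 1 + 1) by ring, zpow_neg, zpow_neg, zpow_neg_one] at h
  rw [← pow_le_pow_iff_left₀ (aP_pos hq hn).le (by positivity) two_ne_zero,
    ← mul_le_mul_iff_of_pos_right hq, h]
  generalize q ^ (n + 1 + 1) = x at *
  generalize q ^ (n + 1) = y at *
  generalize qn q (2 * n + 3) = c at *
  have : c ^ 2 * (x + x⁻¹) * (y + y⁻¹) ≥ c ^ 2 * x⁻¹ * y⁻¹ := by gcongr <;> linarith
  calc x⁻¹ * (y⁻¹ * q⁻¹) / (c ^ 2 * (x + x⁻¹) * (y + y⁻¹))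
      ≤ x⁻¹ * (y⁻¹ * q⁻¹) / (c ^ 2 * x⁻¹ * y⁻¹) := by gcongr
    _ = (q⁻¹ / c) ^ 2 * q := by field_simp

/-- The identities `[n+2] - q [n+1] = q^{-n-1}` and `q [n+2] - [n+1] = q^{n+2}` make the commutators
bounded. -/
theorem kap_up {q : ℝ} (hq : 0 < q) (hq1 : q ≤ 1) (s : Bool) {n : ℤ} (hn : 0 ≤ n) :
    |qn q (n + 2) * kap q s - kap q (!s) * qn q (n + 1)| ≤ q ^ (-n - 1) := by
  have h1 := qn_add hq (n + 1) 1
  have h2 := qn_add hq 1 (n + 1)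
  rw [add_comm 1 (n + 1)] at h2
  rw [show n + 1 + 1 = n + 2 by ring, qn_one hq] at h1 h2
  rw [zpow_neg_one] at h1
  rw [show -(n + 1) = -n - 1 by ring, zpow_one] at h2
  have hx := zpow_pos hq (-n - 1)
  cases s
  · have e : qn q (n + 2) * kap q false - kap q (!false) * qn q (n + 1) = q ^ (n + 2) := by
      simp only [kap, Bool.not_false, if_true, Bool.false_eq_true, if_false]
      rw [h1, show n + 2 = n + 1 + 1 by ring, zpow_add_one₀ hq.ne' (n + 1)]
      field_simp
      ring
    rw [e, abs_of_pos (zpow_pos hq _)]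
    exact zpow_le_zpow_right_of_le_one₀ hq hq1 (by omega)
  · have e : qn q (n + 2) * kap q true - kap q (!true) * qn q (n + 1) = q ^ (-n - 1) := by
      simp only [kap, Bool.not_true, if_true, Bool.false_eq_true, if_false]
      rw [h2]
      ring
    rw [e, abs_of_pos hx]

theorem kap_down {q : ℝ} (hq : 0 < q) (hq1 : q ≤ 1) (s : Bool) {n : ℤ} (hn : 0 ≤ n) :
    |qn q n * kap q s - kap q (!s) * qn q (n + 1)| ≤ q ^ (-n) := by
  rcases hn.eq_or_lt with rfl | hn
  · rw [qn_zero, zero_add, qn_one hq]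
    cases s <;> simp [kap, abs_of_pos hq, hq1]
  · have h := kap_up hq hq1 (!s) (n := n - 1) (by omega)
    rw [show n - 1 + 2 = n + 1 by ring, sub_add_cancel, Bool.not_not, show -(n - 1) - 1 = -n by ring,
      abs_sub_comm] at h
    convert h using 2
    ring

theorem A0_sub {q : ℝ} (s : Bool) (n : ℤ) (hq : 0 < q) (hn : 0 ≤ n) :
    |A0 q s n - A0 q (!s) n| = (q + q⁻¹) / (qn q (2 * n + 1) * qn q (2 * n + 3)) := by
  have h1 := qn_pos hq (k := 2 * n + 1) (by omega)
  have h3 := qn_pos hq (k := 2 * n + 3) (by omega)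
  have e : A0 q true n - A0 q false n = (q + q⁻¹) / (qn q (2 * n + 1) * qn q (2 * n + 3)) := by
    simp only [A0, if_true, Bool.false_eq_true, if_false]
    rw [← sub_div]
    congr 1
    ring
  have hpos : 0 < (q + q⁻¹) / (qn q (2 * n + 1) * qn q (2 * n + 3)) := by positivity
  cases s
  · rw [Bool.not_false, abs_sub_comm, e, abs_of_pos hpos]
  · rw [Bool.not_true, e, abs_of_pos hpos]

/-! ### Matrix elements of the generators in terms of q-integers -/

theorem gen_B_P {q : ℝ} (hq : 0 < q) (s : Bool) (n μ : ℤ) : (gen q B).P s n μ =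
    kap q s * (q ^ μ * √q * √(qn q (n + μ + 2) * qn q (n + μ + 3)) * aP q n) := by
  simp only [gen, BP]
  rw [rpow_half_int hq μ rfl, alphaP_eq hq s n rfl, qn, qn]
  push_cast
  ring_nf

theorem gen_B_Z {q : ℝ} (hq : 0 < q) (s : Bool) (n μ : ℤ) : (gen q B).Z s n μ =
    q ^ μ * √(qn q (n + μ + 2) * qn q (n - μ)) * A0 q s n := by
  have hs : √q ≠ 0 := (Real.sqrt_pos.2 hq).ne'
  simp only [gen, BZ]
  rw [rpow_half_int hq μ rfl, alpha0_eq', qn, qn,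
    show (n : ℝ) + 1 / 2 + (μ + 1 / 2) + 1 = ((n + μ + 2 : ℤ) : ℝ) by push_cast; ring,
    show (n : ℝ) + 1 / 2 - (μ + 1 / 2) = ((n - μ : ℤ) : ℝ) by push_cast; ring]
  field_simp

theorem gen_B_M {q : ℝ} (hq : 0 < q) (s : Bool) (n μ : ℤ) : (gen q B).M s n μ =
    kap q s * -(q ^ μ * √q * √(qn q (n - μ) * qn q (n - μ - 1)) * (q ^ (2 * n + 1) * aP q (n - 1))) := by
  simp only [gen, BM]
  rw [rpow_half_int hq μ rfl, alphaM_eq hq s n rfl, qn, qn,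
    show (n : ℝ) + 1 / 2 - (μ + 1 / 2) - 1 = ((n - μ - 1 : ℤ) : ℝ) by push_cast; ring,
    show (n : ℝ) + 1 / 2 - (μ + 1 / 2) = ((n - μ : ℤ) : ℝ) by push_cast; ring]
  ring

theorem gen_A_P {q : ℝ} (hq : 0 < q) (s : Bool) (n μ : ℤ) : (gen q A).P s n μ =
    kap q s * -(q ^ (μ + n + 1) * √q * √(qn q (n + μ + 2) * qn q (n - μ + 1)) * aP q n) := by
  simp only [gen, AP]
  rw [rpow_half_int hq (μ + n + 1) (x := μ + 1 / 2 + (n + 1 / 2) + 1 / 2) (by push_cast; ring),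
    alphaP_eq hq s n rfl, qn, qn,
    show (n : ℝ) + 1 / 2 - (μ + 1 / 2) + 1 = ((n - μ + 1 : ℤ) : ℝ) by push_cast; ring,
    show (n : ℝ) + 1 / 2 + (μ + 1 / 2) + 1 = ((n + μ + 2 : ℤ) : ℝ) by push_cast; ring,
    mul_comm (qnum q ((n + μ + 2 : ℤ) : ℝ))]
  ring

theorem gen_A_Z {q : ℝ} (hq : 0 < q) (s : Bool) (n μ : ℤ) : (gen q A).Z s n μ =
    q⁻¹ * (1 / (1 + q ^ 2)) * (q ^ (-(n - μ)) * qn q (n + μ + 1) - q ^ (n + μ + 1 + 2) * qn q (n - μ)) *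
      A0 q s n + 1 / (1 + q ^ 2) := by
  have hs : √q * √q = q := Real.mul_self_sqrt hq.le
  have hs' : 1 / √q * (1 / √q) = q⁻¹ := by rw [one_div, ← mul_inv, hs]
  have e1 := qn_add hq 1 (n - μ)
  have e2 := qn_add hq (n + μ + 1) 1
  rw [qn_one hq, zpow_one, mul_one, add_comm 1 (n - μ)] at e1
  rw [qn_one hq, zpow_neg_one, mul_one, show n + μ + 1 + 1 = n + μ + 2 by ring] at e2
  have e3 : q ^ (n + μ + 1 + 2) = q ^ (n + μ + 1) * q ^ 2 := by
    rw [zpow_add₀ hq.ne' (n + μ + 1) 2]; norm_cast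
  simp only [gen, AZ]
  rw [alpha0_eq', show (n : ℝ) + 1 / 2 - (μ + 1 / 2) + 1 = ((n - μ + 1 : ℤ) : ℝ) by push_cast; ring,
    show (n : ℝ) + 1 / 2 + (μ + 1 / 2) + 1 = ((n + μ + 2 : ℤ) : ℝ) by push_cast; ring,
    show (n : ℝ) + 1 / 2 + (μ + 1 / 2) = ((n + μ + 1 : ℤ) : ℝ) by push_cast; ring,
    show (n : ℝ) + 1 / 2 - (μ + 1 / 2) = ((n - μ : ℤ) : ℝ) by push_cast; ring,
    ← qn, ← qn, ← qn, ← qn, e1, e2, e3]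
  have : q * q⁻¹ = 1 := mul_inv_cancel₀ hq.ne'
  linear_combination (1 / (1 + q ^ 2) * A0 q s n * ((q ^ (-(n - μ)) + q * qn q (n - μ)) * qn q (n + μ + 1) -
    q ^ 2 * qn q (n - μ) * (q⁻¹ * qn q (n + μ + 1) + q ^ (n + μ + 1)))) * hs' -
    q⁻¹ * (1 / (1 + q ^ 2)) * A0 q s n * q * qn q (n - μ) * qn q (n + μ + 1) * this

/-! ### Bounds for the coefficients of the commutators -/

namespace Band

/-- All matrix elements between vectors whose labels are in range are bounded by `K`. -/
structure Bounded (a : Band) (K : ℝ) : Prop where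
  P : ∀ s n μ, -(n + 1) ≤ μ → μ ≤ n → -(n + 1 + 1) ≤ μ + a.d → μ + a.d ≤ n + 1 → |a.P s n μ| ≤ K
  Z : ∀ s n μ, -(n + 1) ≤ μ → μ ≤ n → -(n + 1) ≤ μ + a.d → μ + a.d ≤ n → |a.Z s n μ| ≤ K
  M : ∀ s n μ, -(n + 1) ≤ μ → μ ≤ n → -(n - 1 + 1) ≤ μ + a.d → μ + a.d ≤ n - 1 → |a.M s n μ| ≤ K

/-- The coefficients of the adjoint operator. -/
def adj (a : Band) : Band where
  d := -a.d
  P s n μ := a.M s (n + 1) (μ - a.d)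
  Z s n μ := a.Z s n (μ - a.d)
  M s n μ := a.P s (n - 1) (μ - a.d)

theorem Bounded.adj_comm {a : Band} {δ : ℤ → ℝ} {K : ℝ} (h : (a.comm δ).Bounded K) :
    (a.adj.comm δ).Bounded K where
  P s n μ h1 h2 h3 h4 := by
    simp only [comm, adj] at h3 h4
    have := h.M (!s) (n + 1) (μ - a.d) (by omega) (by omega) (by simp only [comm]; omega)
      (by simp only [comm]; omega)
    rw [← abs_neg] at this
    convert this using 2
    simp only [comm, adj, Bool.not_not, add_sub_cancel_right]
    ring
  Z s n μ h1 h2 h3 h4 := by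
    simp only [comm, adj] at h3 h4
    have := h.Z (!s) n (μ - a.d) (by omega) (by omega) (by simp only [comm]; omega)
      (by simp only [comm]; omega)
    rw [← abs_neg] at this
    convert this using 2
    simp only [comm, adj, Bool.not_not]
    ring
  M s n μ h1 h2 h3 h4 := by
    simp only [comm, adj] at h3 h4
    have := h.P (!s) (n - 1) (μ - a.d) (by omega) (by omega) (by simp only [comm]; omega)
      (by simp only [comm]; omega)
    rw [← abs_neg] at this
    convert this using 2
    simp only [comm, adj, Bool.not_not, sub_add_cancel]
    ring

/-- Weighted translations of the labels are bounded. -/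
theorem exists_translate (x : HH) (k d : ℤ) (F : Bool → ℤ → ℤ → ℝ) {K : ℝ} (hK : 0 ≤ K)
    (hF : ∀ j : Idx, -(j.n + k + 1) ≤ j.μ - d → j.μ - d ≤ j.n + k → |F j.sgn (j.n + k) (j.μ - d)| ≤ K) :
    ∃ y : HH, (∀ j, y j = F j.sgn (j.n + k) (j.μ - d) * coord j.sgn (j.n + k) (j.μ - d) x) ∧
      ‖y‖ ≤ K * ‖x‖ := by
  classical
  let e : Idx → Idx := fun j => if h : -(j.n + k + 1) ≤ j.μ - d ∧ j.μ - d ≤ j.n + k then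
    ⟨j.sgn, j.n + k, j.μ - d, h.1, h.2⟩ else j
  let s : Set Idx := {j | -(j.n + k + 1) ≤ j.μ - d ∧ j.μ - d ≤ j.n + k}
  have he : Set.InjOn e s := by
    intro i hi j hj hij
    have hi' : _ ∧ _ := hi
    have hj' : _ ∧ _ := hj
    simp only [e, dif_pos hi', dif_pos hj', Idx.mk.injEq] at hij
    exact Idx.ext hij.1 (by omega) (by omega)
  obtain ⟨y, hy, hy'⟩ := exists_weighted x he hK
    (c := fun j => if j ∈ s then (F j.sgn (j.n + k) (j.μ - d) : ℂ) else 0)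
    (fun j hj => by
      rw [if_pos hj, Complex.norm_real, Real.norm_eq_abs]
      exact hF j hj.1 hj.2) (fun j hj => if_neg hj)
  refine ⟨y, fun j => ?_, hy'⟩
  rw [hy]
  by_cases hj : j ∈ s
  · have hj' : _ ∧ _ := hj
    simp only [if_pos hj, coord, e, dif_pos hj']
  · have hj' : ¬(_ ∧ _) := hj
    simp only [if_neg hj, coord, dif_neg hj', zero_mul, mul_zero]

/-- A band operator with bounded coefficients is bounded in the norm of `ℋ`. -/
theorem Bounded.exists_act {a : Band} {K : ℝ} (hK : 0 ≤ K) (h : a.Bounded K) (x : HH) :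
    ∃ y : HH, (∀ j, y j = a.act x j) ∧ ‖y‖ ≤ 3 * K * ‖x‖ := by
  obtain ⟨y₁, h₁, k₁⟩ := exists_translate x (-1) a.d a.P hK fun j h1 h2 =>
    h.P _ _ _ h1 h2 (by have := j.lower; omega) (by have := j.upper; omega)
  obtain ⟨y₂, h₂, k₂⟩ := exists_translate x 0 a.d a.Z hK fun j h1 h2 =>
    h.Z _ _ _ h1 h2 (by have := j.lower; omega) (by have := j.upper; omega)
  obtain ⟨y₃, h₃, k₃⟩ := exists_translate x 1 a.d a.M hK fun j h1 h2 =>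
    h.M _ _ _ h1 h2 (by have := j.lower; omega) (by have := j.upper; omega)
  refine ⟨y₁ + y₂ + y₃, fun j => ?_, ?_⟩
  · rw [lp.coeFn_add, lp.coeFn_add, Pi.add_apply, Pi.add_apply, h₁, h₂, h₃, act]
    simp only [add_zero, sub_eq_add_neg]
  · calc ‖y₁ + y₂ + y₃‖ ≤ ‖y₁‖ + ‖y₂‖ + ‖y₃‖ := norm_add₃_le
      _ ≤ 3 * K * ‖x‖ := by linarith

end Band

theorem gen_Bstar (q : ℝ) : gen q Bstar = (gen q B).adj := by
  simp only [gen, Band.adj, Band.mk.injEq, true_and]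
  refine ⟨?_, ?_, ?_⟩ <;> funext s n μ <;> simp only [BP, BZ, BM, BstarP, BstarZ, BstarM] <;> push_cast
  · ring_nf
  · ring_nf
  · rw [mul_comm (qnum q ((n : ℝ) + 1 / 2 + (μ + 1 / 2)))]
    ring_nf

theorem gen_A_M {q : ℝ} (hq : 0 < q) (s : Bool) (n μ : ℤ) : (gen q A).M s n μ = (gen q A).P s (n - 1) μ := by
  have : q ^ ((μ : ℝ) + 1 / 2 - (n + 1 / 2) - 1 / 2) * q ^ (2 * ((n : ℝ) + 1 / 2)) =
      q ^ ((μ : ℝ) + 1 / 2 + ((n - 1 : ℤ) + 1 / 2) + 1 / 2) := by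
    rw [← Real.rpow_add hq]
    congr 1
    push_cast
    ring
  simp only [gen, AP, AM, alphaM, ← this]
  rw [mul_comm (qnum q ((n : ℝ) + 1 / 2 - (μ + 1 / 2)))]
  push_cast
  ring_nf

theorem qn_le_of_le {q : ℝ} (hq : 0 < q) {a b : ℤ} (h : a ≤ b) : qn q a ≤ qn q b :=
  (qn_strictMono hq).monotone h

theorem comm_B_bounded {q : ℝ} (hq : 0 < q) (hq1 : q ≤ 1) :
    ((gen q B).comm (diracEig q)).Bounded (2 * q⁻¹ ^ 2) := by
  have hs0 := Real.sqrt_nonneg q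
  have hs1 : √q ≤ 1 := Real.sqrt_le_one.2 hq1
  have hqi : 1 ≤ q⁻¹ := (one_le_inv₀ hq).2 hq1
  have hd : ((gen q B).comm (diracEig q)).d = 1 := rfl
  have hK : q⁻¹ ^ 2 ≤ 2 * q⁻¹ ^ 2 := by nlinarith
  refine ⟨fun s n μ h1 h2 h3 h4 => ?_, fun s n μ h1 h2 h3 h4 => ?_, fun s n μ h1 h2 h3 h4 => ?_⟩ <;>
    rw [hd] at h3 h4
  · refine le_trans ?_ hK
    have hn : 0 ≤ n := by omega
    have hc := qn_pos hq (k := 2 * n + 3) (by omega)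
    have e : ((gen q B).comm (diracEig q)).P s n μ =
        q ^ μ * √q * √(qn q (n + μ + 2) * qn q (n + μ + 3)) * aP q n *
          (qn q (n + 2) * kap q s - kap q (!s) * qn q (n + 1)) := by
      simp only [Band.comm, gen_B_P hq, diracEig, show n + 1 + 1 = n + 2 by ring]
      ring
    have hX := sqrt_mul_le (qn_nonneg hq (k := n + μ + 2) (by omega))
      (qn_nonneg hq (k := n + μ + 3) (by omega)) (qn_le_of_le hq (by omega))
    have h5 := zpow_neg_mul_qn_le hq (a := n + μ + 3) (b := n - μ) (by omega)
    rw [show n + μ + 3 + (n - μ) = 2 * n + 3 by ring] at h5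
    have ha := (aP_pos hq (n := n) (by omega)).le
    have hz := zpow_pos hq μ
    have hY := qn_nonneg hq (k := n + μ + 3) (by omega)
    rw [e, abs_mul, abs_of_nonneg (by positivity)]
    calc q ^ μ * √q * √(qn q (n + μ + 2) * qn q (n + μ + 3)) * aP q n * _
        ≤ q ^ μ * 1 * qn q (n + μ + 3) * (q⁻¹ / qn q (2 * n + 3)) * q ^ (-n - 1) := by
          gcongr
          · exact aP_le hq (by omega)
          · exact kap_up hq hq1 s hn
      _ = q⁻¹ ^ 2 * (q ^ (-(n - μ)) * qn q (n + μ + 3)) / qn q (2 * n + 3) := by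
          rw [show -(n - μ) = μ + (-n - 1) + 1 by ring, zpow_add₀ hq.ne', zpow_add₀ hq.ne', zpow_one]
          field_simp
      _ ≤ q⁻¹ ^ 2 * qn q (2 * n + 3) / qn q (2 * n + 3) := by gcongr
      _ = q⁻¹ ^ 2 := by field_simp
  · have hn : 0 ≤ n := by omega
    have hc1 := qn_pos hq (k := 2 * n + 1) (by omega)
    have hc3 := qn_pos hq (k := 2 * n + 3) (by omega)
    have e : ((gen q B).comm (diracEig q)).Z s n μ =
        qn q (n + 1) * (q ^ μ * √(qn q (n + μ + 2) * qn q (n - μ))) * (A0 q s n - A0 q (!s) n) := by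
      simp only [Band.comm, gen_B_Z hq, diracEig]
      ring
    have h5 := zpow_mul_sqrt_le hq hq1 (a := n + μ + 2) (b := n - μ) (c := μ + 1) (by omega) (by omega)
      (by omega)
    rw [show n + μ + 2 + (n - μ) = 2 * n + 2 by ring, zpow_add_one₀ hq.ne'] at h5
    have h6 : q ^ μ * √(qn q (n + μ + 2) * qn q (n - μ)) ≤ q⁻¹ * qn q (2 * n + 3) := by
      rw [le_inv_mul_iff₀ hq]
      calc _ = q ^ μ * q * √(qn q (n + μ + 2) * qn q (n - μ)) := by ring
        _ ≤ _ := h5.trans (qn_le_of_le hq (by omega))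
    have h7 : qn q (n + 1) ≤ qn q (2 * n + 1) := qn_le_of_le hq (by omega)
    have hm := qn_nonneg hq (k := n + 1) (by omega)
    have hz := zpow_pos hq μ
    rw [e, abs_mul, abs_of_nonneg (mul_nonneg hm (by positivity)), A0_sub s n hq hn]
    calc qn q (n + 1) * (q ^ μ * √(qn q (n + μ + 2) * qn q (n - μ))) *
          ((q + q⁻¹) / (qn q (2 * n + 1) * qn q (2 * n + 3)))
        ≤ qn q (2 * n + 1) * (q⁻¹ * qn q (2 * n + 3)) *
          ((q⁻¹ + q⁻¹) / (qn q (2 * n + 1) * qn q (2 * n + 3))) := by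
          gcongr
          linarith
      _ = 2 * q⁻¹ ^ 2 := by field_simp; ring
  · refine le_trans ?_ hK
    have hn : 0 ≤ n := by omega
    have hc := qn_pos hq (k := 2 * n + 1) (by omega)
    have e : ((gen q B).comm (diracEig q)).M s n μ =
        -(q ^ μ * √q * √(qn q (n - μ - 1) * qn q (n - μ)) * (q ^ (2 * n + 1) * aP q (n - 1)) *
          (qn q n * kap q s - kap q (!s) * qn q (n + 1))) := by
      simp only [Band.comm, gen_B_M hq, diracEig, sub_add_cancel]
      rw [mul_comm (qn q (n - μ))]
      ring
    have hX := sqrt_mul_le (qn_nonneg hq (k := n - μ - 1) (by omega))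
      (qn_nonneg hq (k := n - μ) (by omega)) (qn_le_of_le hq (by omega))
    have h5 := zpow_mul_qn_le hq (a := n + μ + 1) (b := n - μ) (by omega)
    rw [show n + μ + 1 + (n - μ) = 2 * n + 1 by ring] at h5
    have ha := (aP_pos hq (n := n - 1) (by omega)).le
    have ha' := aP_le hq (n := n - 1) (by omega)
    rw [show 2 * (n - 1) + 3 = 2 * n + 1 by ring] at ha'
    have hz := zpow_pos hq μ
    have hz' := zpow_pos hq (2 * n + 1)
    have hY := qn_nonneg hq (k := n - μ) (by omega)
    rw [e, abs_neg, abs_mul, abs_of_nonneg (by positivity)]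
    calc q ^ μ * √q * √(qn q (n - μ - 1) * qn q (n - μ)) * (q ^ (2 * n + 1) * aP q (n - 1)) * _
        ≤ q ^ μ * 1 * qn q (n - μ) * (q ^ (2 * n + 1) * (q⁻¹ / qn q (2 * n + 1))) * q ^ (-n) := by
          gcongr
          · exact kap_down hq hq1 s hn
      _ = q⁻¹ * (q ^ (n + μ + 1) * qn q (n - μ)) / qn q (2 * n + 1) := by
          rw [show n + μ + 1 = μ + (2 * n + 1) + -n by ring, zpow_add₀ hq.ne' (μ + (2 * n + 1)),
            zpow_add₀ hq.ne' μ (2 * n + 1)]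
          ring
      _ ≤ q⁻¹ * qn q (2 * n + 1) / qn q (2 * n + 1) := by gcongr
      _ = q⁻¹ := by field_simp
      _ ≤ q⁻¹ ^ 2 := by nlinarith

theorem comm_A_bounded {q : ℝ} (hq : 0 < q) (hq1 : q ≤ 1) :
    ((gen q A).comm (diracEig q)).Bounded (2 * q⁻¹ ^ 2) := by
  have hs0 := Real.sqrt_nonneg q
  have hs1 : √q ≤ 1 := Real.sqrt_le_one.2 hq1
  have hqi : 1 ≤ q⁻¹ := (one_le_inv₀ hq).2 hq1
  have hd : ((gen q A).comm (diracEig q)).d = 0 := rfl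
  have hK : q⁻¹ ^ 2 ≤ 2 * q⁻¹ ^ 2 := by nlinarith
  have hP : ∀ s n μ, -(n + 1) ≤ μ → μ ≤ n → |((gen q A).comm (diracEig q)).P s n μ| ≤ 2 * q⁻¹ ^ 2 := by
    intro s n μ h1 h2
    refine le_trans ?_ hK
    have hn : 0 ≤ n := by omega
    have hc := qn_pos hq (k := 2 * n + 3) (by omega)
    have e : ((gen q A).comm (diracEig q)).P s n μ =
        -(q ^ (μ + n + 1) * √q * √(qn q (n + μ + 2) * qn q (n - μ + 1)) * aP q n *
          (qn q (n + 2) * kap q s - kap q (!s) * qn q (n + 1))) := by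
      simp only [Band.comm, gen_A_P hq, diracEig, show n + 1 + 1 = n + 2 by ring]
      ring
    have h5 := zpow_mul_sqrt_le hq hq1 (a := n + μ + 2) (b := n - μ + 1) (c := μ + 1) (by omega)
      (by omega) (by omega)
    rw [show n + μ + 2 + (n - μ + 1) = 2 * n + 3 by ring] at h5
    have ha := (aP_pos hq (n := n) (by omega)).le
    have hz := zpow_pos hq (μ + n + 1)
    rw [e, abs_neg, abs_mul, abs_of_nonneg (by positivity)]
    calc q ^ (μ + n + 1) * √q * √(qn q (n + μ + 2) * qn q (n - μ + 1)) * aP q n * _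
        ≤ q ^ (μ + n + 1) * 1 * √(qn q (n + μ + 2) * qn q (n - μ + 1)) * (q⁻¹ / qn q (2 * n + 3)) *
          q ^ (-n - 1) := by
          gcongr
          · exact aP_le hq (by omega)
          · exact kap_up hq hq1 s hn
      _ = q⁻¹ ^ 2 * (q ^ (μ + 1) * √(qn q (n + μ + 2) * qn q (n - μ + 1))) / qn q (2 * n + 3) := by
          rw [show μ + 1 = μ + n + 1 + (-n - 1) + 1 by ring, zpow_add₀ hq.ne' (μ + n + 1 + (-n - 1)),
            zpow_add₀ hq.ne' (μ + n + 1), zpow_one]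
          field_simp
      _ ≤ q⁻¹ ^ 2 * qn q (2 * n + 3) / qn q (2 * n + 3) := by gcongr
      _ = q⁻¹ ^ 2 := by field_simp
  refine ⟨fun s n μ h1 h2 _ _ => hP s n μ h1 h2, fun s n μ h1 h2 _ _ => ?_, fun s n μ h1 h2 h3 h4 => ?_⟩
  · refine le_trans ?_ hK
    have hn : 0 ≤ n := by omega
    have hc1 := qn_pos hq (k := 2 * n + 1) (by omega)
    have hc3 := qn_pos hq (k := 2 * n + 3) (by omega)
    have e : ((gen q A).comm (diracEig q)).Z s n μ =
        qn q (n + 1) * (q⁻¹ * (1 / (1 + q ^ 2))) *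
          (q ^ (-(n - μ)) * qn q (n + μ + 1) - q ^ (n + μ + 1 + 2) * qn q (n - μ)) *
          (A0 q s n - A0 q (!s) n) := by
      simp only [Band.comm, gen_A_Z hq, diracEig]
      ring
    have h5 := zpow_neg_mul_qn_le hq (a := n + μ + 1) (b := n - μ) (by omega)
    have h6 := zpow_mul_qn_le hq (a := n + μ + 1) (b := n - μ) (by omega)
    rw [show n + μ + 1 + (n - μ) = 2 * n + 1 by ring] at h5 h6
    have h7 : q ^ (n + μ + 1 + 2) * qn q (n - μ) ≤ q ^ (n + μ + 1) * qn q (n - μ) := by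
      have := qn_nonneg hq (k := n - μ) (by omega)
      exact mul_le_mul_of_nonneg_right (zpow_le_zpow_right_of_le_one₀ hq hq1 (by omega)) this
    have h8 : |q ^ (-(n - μ)) * qn q (n + μ + 1) - q ^ (n + μ + 1 + 2) * qn q (n - μ)| ≤ qn q (2 * n + 1) := by
      have p1 := mul_nonneg (zpow_pos hq (-(n - μ))).le (qn_nonneg hq (k := n + μ + 1) (by omega))
      have p2 := mul_nonneg (zpow_pos hq (n + μ + 1 + 2)).le (qn_nonneg hq (k := n - μ) (by omega))
      rw [abs_le]
      constructor <;> linarith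
    have h9 : qn q (n + 1) ≤ qn q (2 * n + 3) := qn_le_of_le hq (by omega)
    have hm := qn_nonneg hq (k := n + 1) (by omega)
    rw [e, abs_mul, abs_mul, abs_of_nonneg (mul_nonneg hm (by positivity)), A0_sub s n hq hn]
    calc qn q (n + 1) * (q⁻¹ * (1 / (1 + q ^ 2))) * _ *
          ((q + q⁻¹) / (qn q (2 * n + 1) * qn q (2 * n + 3)))
        ≤ qn q (2 * n + 3) * (q⁻¹ * (1 / (1 + q ^ 2))) * qn q (2 * n + 1) *
          ((q + q⁻¹) / (qn q (2 * n + 1) * qn q (2 * n + 3))) := by gcongr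
      _ = q⁻¹ ^ 2 := by field_simp; ring
  · rw [hd, add_zero] at h3 h4
    have := hP (!s) (n - 1) μ (by omega) (by omega)
    rw [← abs_neg] at this
    convert this using 2
    simp only [Band.comm, gen_A_M hq, Bool.not_not, sub_add_cancel]
    ring

theorem comm_gen_bounded {q : ℝ} (hq : 0 < q) (hq1 : q ≤ 1) (g : SphereGen) :
    ((gen q g).comm (diracEig q)).Bounded (2 * q⁻¹ ^ 2) := by
  cases g
  · exact comm_A_bounded hq hq1
  · exact comm_B_bounded hq hq1
  · rw [gen_Bstar]
    exact (comm_B_bounded hq hq1).adj_comm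

/-! ### Bounded commutators of `diracOp q z` -/

theorem coord_diracEntry (q : ℝ) (z : ℂ) (s : Bool) (n μ : ℤ) (x : Idx → ℂ) :
    coord s n μ (fun i => diracEntry q z i * x i.swap) =
      (if s then starRingEnd ℂ z else z) * diracEig q n * coord (!s) n μ x := by
  by_cases hv : -(n + 1) ≤ μ ∧ μ ≤ n
  · simp only [coord, dif_pos hv, diracEntry_eq]
    rfl
  · simp only [coord, dif_neg hv, mul_zero]

/-- The commutator of the maximal operator with a band operator, in coordinates. -/
theorem diracEntry_mul_act (q : ℝ) (z : ℂ) (a : Band) (x : Idx → ℂ) (j : Idx) :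
    diracEntry q z j * a.act x j.swap = a.act (fun i => diracEntry q z i * x i.swap) j +
      (if j.sgn then starRingEnd ℂ z else z) * (a.comm (diracEig q)).act x j.swap := by
  rw [diracEntry_eq]
  simp only [Band.act, coord_diracEntry]
  simp only [Band.comm, Idx.swap, Bool.not_not, sub_add_cancel,
    add_sub_cancel_right]
  push_cast
  ring

theorem piH_gen_apply {q : ℝ} (hq : 0 < q) (g : SphereGen) (x : HH) :
    ⇑(piH q hq (RingQuot.mkAlgHom ℂ (SphereRel q) (FreeAlgebra.ι ℂ g)) x) = (gen q g).act x := by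
  refine congrFun (DenseRange.equalizer incl_dense (continuous_coe_HH.comp (ContinuousLinearMap.continuous _))
    ((gen q g).continuous_act.comp continuous_coe_HH) (funext fun v => ?_)) x
  simp only [Function.comp_apply]
  rw [piH_incl, coe_incl, coe_incl, piV_gen, sphereGenOp_eq, Band.op_apply]

/-- `T` preserves the domain of `D`, and the commutator `[D, T]` is bounded. -/
def HasBoundedCommutator (D : HH →ₗ.[ℂ] HH) (T : HH →L[ℂ] HH) : Prop :=
  ∃ C : ℝ, ∀ x : D.domain, ∃ h : T x ∈ D.domain, ‖D ⟨T x, h⟩ - T (D x)‖ ≤ C * ‖(x : HH)‖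

theorem HasBoundedCommutator.smul_one (D : HH →ₗ.[ℂ] HH) (r : ℂ) :
    HasBoundedCommutator D (r • 1) := by
  refine ⟨0, fun x => ⟨D.domain.smul_mem r x.2, ?_⟩⟩
  have : D ⟨(r • 1 : HH →L[ℂ] HH) x, D.domain.smul_mem r x.2⟩ = r • D x := by
    rw [← LinearPMap.map_smul]
    rfl
  rw [this]
  change ‖r • D x - r • D x‖ ≤ _
  simp

theorem HasBoundedCommutator.add {D : HH →ₗ.[ℂ] HH} {S T : HH →L[ℂ] HH} (hS : HasBoundedCommutator D S)
    (hT : HasBoundedCommutator D T) : HasBoundedCommutator D (S + T) := by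
  obtain ⟨C, hC⟩ := hS
  obtain ⟨C', hC'⟩ := hT
  refine ⟨C + C', fun x => ?_⟩
  obtain ⟨h, hx⟩ := hC x
  obtain ⟨h', hx'⟩ := hC' x
  refine ⟨D.domain.add_mem h h', ?_⟩
  have : D ⟨(S + T) x, D.domain.add_mem h h'⟩ = D ⟨S x, h⟩ + D ⟨T x, h'⟩ := by
    rw [← LinearPMap.map_add]
    rfl
  rw [this, _root_.add_apply, add_sub_add_comm, add_mul]
  exact (norm_add_le _ _).trans (add_le_add hx hx')

theorem HasBoundedCommutator.mul {D : HH →ₗ.[ℂ] HH} {S T : HH →L[ℂ] HH} (hS : HasBoundedCommutator D S)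
    (hT : HasBoundedCommutator D T) : HasBoundedCommutator D (S * T) := by
  obtain ⟨C, hC⟩ := hS
  obtain ⟨C', hC'⟩ := hT
  refine ⟨|C| * ‖T‖ + ‖S‖ * C', fun x => ?_⟩
  obtain ⟨h', hx'⟩ := hC' x
  obtain ⟨h, hx⟩ := hC ⟨T x, h'⟩
  refine ⟨h, ?_⟩
  calc ‖D ⟨(S * T) x, h⟩ - (S * T) (D x)‖
      = ‖(D ⟨S (T x), h⟩ - S (D ⟨T x, h'⟩)) + S (D ⟨T x, h'⟩ - T (D x))‖ := by
        rw [map_sub, sub_add_sub_cancel]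
        rfl
    _ ≤ ‖D ⟨S (T x), h⟩ - S (D ⟨T x, h'⟩)‖ + ‖S (D ⟨T x, h'⟩ - T (D x))‖ := norm_add_le _ _
    _ ≤ |C| * (‖T‖ * ‖(x : HH)‖) + ‖S‖ * (C' * ‖(x : HH)‖) := by
        refine add_le_add (hx.trans ?_) ((S.le_opNorm _).trans (by gcongr))
        exact mul_le_mul (le_abs_self C) (T.le_opNorm _) (norm_nonneg _) (abs_nonneg C)
    _ = _ := by ring

theorem piH_ext {q : ℝ} (hq : 0 < q) {α : Sphere q} {T : HH →L[ℂ] HH}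
    (h : ∀ v, T (incl v) = incl (piV q hq α v)) : piH q hq α = T := by
  refine DFunLike.coe_injective (DenseRange.equalizer incl_dense (ContinuousLinearMap.continuous _)
    T.continuous (funext fun v => ?_))
  rw [Function.comp_apply, Function.comp_apply, piH_incl, h]

theorem hasBoundedCommutator_gen {q : ℝ} (hq : 0 < q) (hq1 : q ≤ 1) (z : ℂ) (g : SphereGen) :
    HasBoundedCommutator (diracOp q z)
      (piH q hq (RingQuot.mkAlgHom ℂ (SphereRel q) (FreeAlgebra.ι ℂ g))) := by
  set T := piH q hq (RingQuot.mkAlgHom ℂ (SphereRel q) (FreeAlgebra.ι ℂ g)) with hT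
  have hTa : ∀ x : HH, ⇑(T x) = (gen q g).act x := piH_gen_apply hq g
  have hK : 0 ≤ 2 * q⁻¹ ^ 2 := by positivity
  refine ⟨‖z‖ * (3 * (2 * q⁻¹ ^ 2)), fun x => ?_⟩
  obtain ⟨y, hy, hyn⟩ := (comm_gen_bounded hq hq1 g).exists_act hK (x : HH)
  obtain ⟨w, hw, hwn⟩ := exists_weighted y (s := Set.univ) (e := Idx.swap)
    (c := fun j => if j.sgn then starRingEnd ℂ z else z) (K := ‖z‖)
    (Function.Involutive.injective Idx.swap_swap).injOn (norm_nonneg z)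
    (fun j _ => by split_ifs <;> simp) (fun j hj => absurd (Set.mem_univ j) hj)
  have key : ∀ i, (T (diracOp q z x) + w) i = diracEntry q z i * T x i.swap := by
    intro i
    rw [lp.coeFn_add, Pi.add_apply, hTa, hTa, hw, hy, diracEntry_mul_act]
    rfl
  have hmem : T x ∈ (diracOp q z).domain := mem_diracOp key
  refine ⟨hmem, ?_⟩
  have : diracOp q z ⟨T x, hmem⟩ - T (diracOp q z x) = w := by
    rw [sub_eq_iff_eq_add']
    apply lp.ext
    funext i
    rw [diracOp_apply, key]
  rw [this, mul_assoc]
  exact hwn.trans (mul_le_mul_of_nonneg_left hyn (norm_nonneg z))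

theorem hasBoundedCommutator_piH {q : ℝ} (hq : 0 < q) (hq1 : q ≤ 1) (z : ℂ) (α : Sphere q) :
    HasBoundedCommutator (diracOp q z) (piH q hq α) := by
  obtain ⟨a, rfl⟩ := RingQuot.mkAlgHom_surjective ℂ _ α
  induction a using FreeAlgebra.induction with
  | grade0 r =>
    rw [piH_ext hq (T := r • 1)]
    · exact .smul_one _ r
    · intro v
      rw [AlgHom.commutes, AlgHom.commutes, Module.algebraMap_end_apply, map_smul]
      rfl
  | grade1 g => exact hasBoundedCommutator_gen hq hq1 z g
  | mul a b ha hb =>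
    rw [piH_ext hq (T := piH q hq (RingQuot.mkAlgHom ℂ (SphereRel q) a) *
      piH q hq (RingQuot.mkAlgHom ℂ (SphereRel q) b))]
    · exact ha.mul hb
    · intro v
      rw [mul_apply_eq_comp, piH_incl, piH_incl, map_mul, map_mul, Module.End.mul_apply]
  | add a b ha hb =>
    rw [piH_ext hq (T := piH q hq (RingQuot.mkAlgHom ℂ (SphereRel q) a) +
      piH q hq (RingQuot.mkAlgHom ℂ (SphereRel q) b))]
    · exact ha.add hb
    · intro v
      rw [_root_.add_apply, piH_incl, piH_incl, map_add, map_add, LinearMap.add_apply, map_add]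

theorem isDirac_diracOp {q : ℝ} (hq : 0 < q) (hq1 : q ≤ 1) {p : ℝ} (hp : 0 < p) {z : ℂ} (hz : z ≠ 0) :
    IsDirac q hq p (diracOp q z) where
  selfAdjoint := diracOp_selfAdjoint q z
  compactResolvent := diracOp_compactResolvent hq hq1 hz
  domain := incl_mem_diracOp q z
  equivariant := diracOp_equivariant hq z
  odd := diracOp_odd q z
  boundedCommutator := hasBoundedCommutator_piH hq hq1 z
  real := diracOp_real q p z
  firstOrder := diracOp_firstOrder hq hp z

end Podles

theorem theorem8 (q : ℝ) (hq : 0 < q) (hq1 : q ≤ 1) (p : ℝ) (hp : 0 < p)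
    (D : Podles.HH →ₗ.[ℂ] Podles.HH) :
    Podles.IsDirac q hq p D ↔ ∃ z : ℂ, z ≠ 0 ∧ D = Podles.diracOp q z := by
  constructor
  · exact Podles.eq_diracOp_of_isDirac hq hp
  · rintro ⟨z, hz, rfl⟩
    exact Podles.isDirac_diracOp hq hq1 hp hz
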